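/- Let $n\in\mathbb N$, $c>0$, let $\Gamma\in\mathbb R^{n\times n}$ be symmetric and positive definite, $\phi(x)=\frac1{2c}x^\top\Gamma x$, $H=L^2(\mathbb R^n;e^{-\phi}dx)$, $V=W^{1,2}(\mathbb R^n;e^{-\phi}dx)$, and let $A$ be the operator in $H$ associated with the form $a(v,w)=\int_{\mathbb R^n} e^{-\phi}\,\nabla v\cdot\nabla w\,dx$ on $V$ (that is, $v\in\mathcal D(A)$ and $Av=f$ iff $v\in V$ and $a(v,w)=\langle f,w\rangle_H$ for all $w\in V$). Put $\mathfrak H=L^2(\mathbb R^n;e^{\phi}dx)$, $h:H\to\mathfrak H$, $h(f)=e^{-\phi}f$, $\mathfrak A=h\circ A\circ h^{-1}$. Let $(T(t))_{t\ge0}$ be the $C_0$-semigroup on $\mathfrak H$ generated by the self-adjoint operator $-c\mathfrak A$, let $\mathfrak H_{-1}$ be its extrapolation space (the dual of $\mathcal D(\mathfrak A)$ with the graph norm, with respect to the pivot space $\mathfrak H$), and let $T_{-1}(t)$ be the extension of $T(t)$ to $\mathfrak H_{-1}$. For $q\in\mathfrak H^n$, $-\operatorname{div}q\in\mathfrak H_{-1}$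 is defined by $\langle -\operatorname{div}q,z\rangle=\int_{\mathbb R^n}q\cdot\nabla(e^{\phi}z)\,dx$ for $z\in\mathcal D(\mathfrak A)$. Let $g\in C^1(\mathbb R^n;\mathbb R^n)$ be such that $\|g(v)\|\le\bar g\|v\|$ for some $\bar g>0$ and all $v$, and $\sup_{s\in\mathbb R}\min_{\delta\le\|v\|\le1}v^\top g(-sv)=\infty$ for some $\delta\in(0,1)$. Let $p_0\in\mathfrak H$ and $u\in C([0,\infty);\mathbb R^n)$. For $t_1>0$, a function $p\in C([0,t_1];\mathfrak H)$ is a mild solution on $[0,t_1]$ of the Fokker-Planck equation $\dot p=-c\mathfrak A p-\operatorname{div}(p\,g(u))$, $p(0)=p_0$ (without disturbance) if $$p(t)=T(t)p_0+\int_0^tT_{-1}(t-s)\bigl(-\operatorname{div}(p(s)g(u(s)))\bigr)\,ds\quad\text{in }\mathfrak H_{-1}\text{ for all }t\in[0,t_1];$$ it is a mild solution on $[0,\infty)$ if its restriction to $[0,t_1]$ is one for every $t_1>0$. Let $\Gamma v_k=c\lambda_kv_k$ with an orthonormal basis $(v_1,\dots,v_n)$, and put $V_\Gamma=[v_1,\dots,v_n]$,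 $\Lambda=\operatorname{diag}(\lambda_1,\dots,\lambda_n)$, $R=\operatorname{diag}(\sqrt{\lambda_1/2},\dots,\sqrt{\lambda_n/2})$. Let $p$ be a mild solution on $[0,t_1]$. Then all the integrals below converge absolutely, and: (i) $\int_{\mathbb R^n} p(t,x)\,dx=\int_{\mathbb R^n} p_0(x)\,dx$ for all $t\in[0,t_1]$. (ii) If $p_0\ge0$ almost everywhere, then for all $t\in[0,t_1]$, $p(t,x)\ge0$ for almost all $x$. (iii) Suppose that $\int_{\mathbb R^n} p_0(x)\,dx=1$. With $y(t)=\int_{\mathbb R^n} x\,p(t,x)\,dx$ and $\operatorname{Cov}(t)=\int_{\mathbb R^n}(x-y(t))(x-y(t))^\top p(t,x)\,dx$, there is a matrix $K\in\mathbb R^{n\times n}$, which depends only on $c$, $\Gamma$, $p_0$ and the chosen eigenbasis (thus neither on $t_1$ nor on $g$ and the input $u$), such that for all $t\in[0,t_1]$ $$\operatorname{Cov}(t)=\tfrac14V_\Gamma R^{-1}\bigl(e^{-c\Lambda t}Ke^{-c\Lambda t}+2I\bigr)R^{-1}V_\Gamma^\top .$$ If $p$ is a mild solution on $[0,\infty)$,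 then $\lim_{t\to\infty}\operatorname{Cov}(t)=c\Gamma^{-1}$, and the convergence is exponential: there are $r>0$, depending only on $c$ and $\Gamma$, and $M$, depending only on $c$, $\Gamma$ and $p_0$, with $|\operatorname{Cov}(t)_{ij}-(c\Gamma^{-1})_{ij}|\le Me^{-rt}$ for all $t\ge0$ and all $i,j$. -/

import Mathlib

open MeasureTheory Filter Topology Set
open scoped ContDiff NNReal InnerProductSpace

namespace FokkerPlanck

/-! ### Strongly continuous semigroups and their generators -/

/-! The exponential of a bounded operator `-A` with `A` accretive. -/

section Bounded
variable {X : Type*} [NormedAddCommGroup X] [InnerProductSpace ℝ X] [CompleteSpace X]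

theorem expNeg_hasDerivAt (A : X →L[ℝ] X) (x : X) (t : ℝ) :
    HasDerivAt (fun s : ℝ => NormedSpace.exp (s • (-A)) x)
      (-(A (NormedSpace.exp (t • (-A)) x))) t := by
  have h := hasDerivAt_exp_smul_const' (𝕂 := ℝ) (-A) t
  have h2 := h.clm_apply (hasDerivAt_const t x)
  simpa using h2

theorem expNeg_norm_le (A : X →L[ℝ] X) (hA : ∀ x, 0 ≤ ⟪A x, x⟫_ℝ) (x : X) {t : ℝ} (ht : 0 ≤ t) :
    ‖NormedSpace.exp (t • (-A)) x‖ ≤ ‖x‖ := by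
  have hd : ∀ s : ℝ, HasDerivAt (fun s : ℝ => ‖NormedSpace.exp (s • (-A)) x‖ ^ 2)
      (2 * ⟪NormedSpace.exp (s • (-A)) x, -(A (NormedSpace.exp (s • (-A)) x))⟫_ℝ) s :=
    fun s => (expNeg_hasDerivAt A x s).norm_sq
  have hanti : Antitone (fun s : ℝ => ‖NormedSpace.exp (s • (-A)) x‖ ^ 2) := by
    apply antitone_of_deriv_nonpos
    · exact fun s => (hd s).differentiableAt
    · intro s
      rw [(hd s).deriv, inner_neg_right, real_inner_comm]
      have := hA (NormedSpace.exp (s • (-A)) x)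
      linarith
  have := hanti ht
  simp only [zero_smul, NormedSpace.exp_zero, one_apply_eq_self] at this
  exact le_of_sq_le_sq this (norm_nonneg _) 

theorem expNeg_sub_le (A B : X →L[ℝ] X) (hA : ∀ x, 0 ≤ ⟪A x, x⟫_ℝ) (hB : ∀ x, 0 ≤ ⟪B x, x⟫_ℝ)
    (hAB : Commute A B) (x : X) {t : ℝ} (ht : 0 ≤ t) :
    ‖NormedSpace.exp (t • (-A)) x - NormedSpace.exp (t • (-B)) x‖ ≤ t * ‖A x - B x‖ := by
  set f : ℝ → X := fun s =>
    NormedSpace.exp ((t - s) • (-B)) (NormedSpace.exp (s • (-A)) x) with hf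
  have hcomm : ∀ s r : ℝ, Commute (NormedSpace.exp (s • (-A))) (B - A) := by
    intro s r
    apply Commute.exp_left
    have : Commute (-A) (B - A) := (Commute.sub_right hAB (Commute.refl A)).neg_left
    exact this.smul_left s
  have hd : ∀ s : ℝ, HasDerivAt f
      (NormedSpace.exp ((t - s) • (-B)) (NormedSpace.exp (s • (-A)) ((B - A) x))) s := by
    intro s
    have h1 : HasDerivAt (fun s : ℝ => NormedSpace.exp ((t - s) • (-B)))
        ((-1 : ℝ) • (NormedSpace.exp ((t - s) • (-B)) * (-B))) s :=
      (hasDerivAt_exp_smul_const (𝕂 := ℝ) (-B) (t - s)).scomp s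
        ((hasDerivAt_id s).const_sub t)
    have h2 := h1.clm_apply (expNeg_hasDerivAt A x s)
    convert h2 using 1
    have h3 : NormedSpace.exp (s • (-A)) ((B - A) x) = (B - A) (NormedSpace.exp (s • (-A)) x) :=
      congrArg (fun T : X →L[ℝ] X => T x) (hcomm s 0).eq
    rw [h3]
    simp [map_neg, sub_eq_add_neg]
  have hbound := norm_image_sub_le_of_norm_deriv_le_segment' (f := f) (a := 0) (b := t)
    (C := ‖A x - B x‖)
    (f' := fun s => NormedSpace.exp ((t - s) • (-B)) (NormedSpace.exp (s • (-A)) ((B - A) x)))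
    (fun s _ => (hd s).hasDerivWithinAt) (by
      intro s hs
      refine (expNeg_norm_le B hB _ (sub_nonneg.2 hs.2.le)).trans ?_
      refine (expNeg_norm_le A hA _ hs.1).trans ?_
      rw [sub_apply, norm_sub_rev]) t ⟨ht, le_rfl⟩
  simpa [hf, mul_comm] using hbound

end Bounded

/-- A strongly continuous semigroup `(T(t))_{t ≥ 0}` of bounded operators. -/
structure C0Semigroup (X : Type*) [NormedAddCommGroup X] [NormedSpace ℝ X] where
  toFun : ℝ≥0 → X →L[ℝ] X
  map_zero : toFun 0 = ContinuousLinearMap.id ℝ X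
  map_add : ∀ s t, toFun (s + t) = (toFun s).comp (toFun t)
  continuous_orbit : ∀ x, Continuous fun t => toFun t x

/-- `x` is in the domain of the generator of `T`, and the generator maps `x` to `y`:
`(T(t) x - x) / t → y` as `t ↓ 0`. -/
def C0Semigroup.GeneratorMapsTo {X : Type*} [NormedAddCommGroup X] [NormedSpace ℝ X]
    (T : C0Semigroup X) (x y : X) : Prop :=
  Tendsto (fun t : ℝ≥0 => (t : ℝ)⁻¹ • (T.toFun t x - x)) (𝓝[>] 0) (𝓝 y)

section Generation
variable {X : Type*} [NormedAddCommGroup X] [InnerProductSpace ℝ X]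

/-- Resolvents of an accretive relation with full ranges. -/
theorem exists_resolvent (B : Submodule ℝ (X × X)) (acc : ∀ q ∈ B, 0 ≤ ⟪q.2, q.1⟫_ℝ)
    (surj : ∀ ε : ℝ, 0 < ε → ∀ f : X, ∃ q ∈ B, q.1 + ε • q.2 = f) {ε : ℝ} (hε : 0 < ε) :
    ∃ J A : X →L[ℝ] X, (∀ f, (J f, A f) ∈ B) ∧ (∀ f, J f + ε • A f = f) ∧
      (∀ q ∈ B, J (q.1 + ε • q.2) = q.1) ∧ (∀ f, ‖J f‖ ≤ ‖f‖) := by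
  have key : ∀ q ∈ B, ‖q.1‖ ≤ ‖q.1 + ε • q.2‖ := by
    intro q hq
    have h1 : ‖q.1‖ ^ 2 ≤ ⟪q.1 + ε • q.2, q.1⟫_ℝ := by
      rw [inner_add_left, inner_smul_left, real_inner_self_eq_norm_sq]
      have := mul_nonneg hε.le (acc q hq)
      simpa using this
    have h2 := real_inner_le_norm (q.1 + ε • q.2) q.1
    by_contra hlt
    push Not at hlt
    nlinarith [norm_nonneg q.1, norm_nonneg (q.1 + ε • q.2)]
  have uniq : ∀ q ∈ B, ∀ r ∈ B, q.1 + ε • q.2 = r.1 + ε • r.2 → q.1 = r.1 := by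
    intro q hq r hr h
    have := key (q - r) (B.sub_mem hq hr)
    have h0 : (q - r).1 + ε • (q - r).2 = 0 := by
      simp only [Prod.fst_sub, Prod.snd_sub, smul_sub]
      rw [← sub_eq_zero] at h
      rw [← h]; abel
    rw [h0, norm_zero, norm_le_zero_iff] at this
    exact sub_eq_zero.1 this
  choose R hRB hR using surj ε hε
  let Jl : X →ₗ[ℝ] X :=
    { toFun := fun f => (R f).1
      map_add' := fun f g => uniq _ (hRB _) (R f + R g) (B.add_mem (hRB _) (hRB _)) (by
        rw [hR]; simp only [Prod.fst_add, Prod.snd_add, smul_add]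
        nth_rewrite 1 [← hR f, ← hR g]; abel)
      map_smul' := fun a f => uniq _ (hRB _) (a • R f) (B.smul_mem _ (hRB _)) (by
        rw [hR]; simp only [Prod.smul_fst, Prod.smul_snd]
        nth_rewrite 1 [← hR f]; rw [smul_add, smul_comm]) }
  have hJn : ∀ f, ‖Jl f‖ ≤ 1 * ‖f‖ := fun f => by
    have := key _ (hRB f); rw [hR] at this; simpa [Jl] using this
  let J : X →L[ℝ] X := Jl.mkContinuous 1 hJn
  have hJ : ∀ f, J f = (R f).1 := fun f => rfl
  have hA : ∀ f, ε⁻¹ • (f - J f) = (R f).2 := fun f => by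
    rw [hJ]; nth_rewrite 1 [← hR f]; rw [add_sub_cancel_left, smul_smul, inv_mul_cancel₀ hε.ne',
      one_smul]
  refine ⟨J, ε⁻¹ • (ContinuousLinearMap.id ℝ X - J), ?_, ?_, ?_, ?_⟩
  · intro f
    have : (ε⁻¹ • (ContinuousLinearMap.id ℝ X - J)) f = (R f).2 := hA f
    rw [this, hJ]; exact hRB f
  · intro f
    have : (ε⁻¹ • (ContinuousLinearMap.id ℝ X - J)) f = (R f).2 := hA f
    rw [this, hJ]; exact hR f
  · intro q hq
    exact uniq _ (hRB _) q hq (hR _)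
  · intro f; rw [← one_mul ‖f‖]; exact hJn f

/-- If `B` is (the graph of) a densely defined accretive operator and every `1 + ε B`, `ε > 0`, is
onto, then `-B` is the generator of a strongly continuous semigroup, which is symmetric if `B` is. -/
theorem exists_semigroup [CompleteSpace X] (B : Submodule ℝ (X × X)) (acc : ∀ q ∈ B, 0 ≤ ⟪q.2, q.1⟫_ℝ)
    (surj : ∀ ε : ℝ, 0 < ε → ∀ f : X, ∃ q ∈ B, q.1 + ε • q.2 = f)
    (dense : Dense {z : X | ∃ y, (z, y) ∈ B}) :
    ∃ T : C0Semigroup X, (∀ z y, T.GeneratorMapsTo z (-y) ↔ (z, y) ∈ B) ∧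
      ((∀ p ∈ B, ∀ q ∈ B, ⟪p.2, q.1⟫_ℝ = ⟪p.1, q.2⟫_ℝ) →
        ∀ t x y, ⟪T.toFun t x, y⟫_ℝ = ⟪x, T.toFun t y⟫_ℝ) := by
  have hres := fun m : ℕ => exists_resolvent B acc surj (ε := 1 / ((m : ℝ) + 1)) (by positivity)
  choose J A hB hJA hJ hJn using hres
  have hAacc : ∀ m f, 0 ≤ ⟪A m f, f⟫_ℝ := by
    intro m f
    have h1 := acc _ (hB m f)
    have h2 : ⟪A m f, f⟫_ℝ = ⟪A m f, J m f⟫_ℝ + 1 / ((m : ℝ) + 1) * ⟪A m f, A m f⟫_ℝ := by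
      conv_lhs => rw [← hJA m f]
      rw [map_add, map_smul, inner_add_right, inner_smul_right]
      rw [← map_smul, ← inner_smul_right, ← inner_add_right, ← inner_smul_right, ← inner_add_right,
        ← map_add, hJA]
    rw [h2]
    exact add_nonneg h1 (mul_nonneg (by positivity) real_inner_self_nonneg)
  have hJB : ∀ m, ∀ q ∈ B, (J m q.1, J m q.2) ∈ B ∧ A m q.1 = J m q.2 := by
    intro m q hq
    have hpos : (0 : ℝ) < 1 / ((m : ℝ) + 1) := by positivity
    have h1 := hJ m q hq
    have h2 := hJA m q.1
    rw [map_add, map_smul] at h1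
    have h3 : A m q.1 = J m q.2 := by
      have : (1 / ((m : ℝ) + 1)) • A m q.1 = (1 / ((m : ℝ) + 1)) • J m q.2 := by
        have h4 := h1.trans h2.symm
        exact (add_left_cancel h4).symm
      exact smul_right_injective X hpos.ne' this
    refine ⟨?_, h3⟩
    rw [← h3]; exact hB m q.1
  have hJJ : ∀ k m f, J k (J m f) = J m (J k f) := by
    intro k m f
    have h1 := (hJB k _ (hB m f)).1
    have h2 := hJ m _ h1
    simp only at h2
    rw [← map_smul, ← map_add, hJA] at h2
    exact h2.symm
  have hAdef : ∀ m f, A m f = ((m : ℝ) + 1) • (f - J m f) := by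
    intro m f
    have h := hJA m f
    have hne : ((m : ℝ) + 1) ≠ 0 := by positivity
    have : f - J m f = (1 / ((m : ℝ) + 1)) • A m f := by
      rw [sub_eq_iff_eq_add, add_comm]; exact h.symm
    rw [this, smul_smul, mul_one_div_cancel hne, one_smul]
  have hcomm : ∀ k m, Commute (A k) (A m) := by
    intro k m
    ext f
    simp only [mul_apply_eq_comp, hAdef, map_smul, map_sub, hJJ k m]
    module
  -- bounds on the Yosida approximations on the domain
  have hAle : ∀ m, ∀ q ∈ B, ‖A m q.1‖ ≤ ‖q.2‖ := fun m q hq => by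
    rw [(hJB m q hq).2]; exact hJn m _
  have hJlim : ∀ f, Tendsto (fun m => J m f) atTop (𝓝 f) := by
    intro f
    rw [Metric.tendsto_atTop]
    intro η hη
    obtain ⟨z, hz, ⟨y, hzy⟩⟩ := Metric.dense_iff.1 dense f (η / 3) (by positivity)
    rw [Metric.mem_ball, dist_eq_norm] at hz
    obtain ⟨N, hN⟩ := exists_nat_gt (‖y‖ * 3 / η)
    refine ⟨N, fun m hm => ?_⟩
    have hm' : (N : ℝ) ≤ m := by exact_mod_cast hm
    have h1 : ‖J m z - z‖ < η / 3 := by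
      have h2 : J m z - z = -((1 / ((m : ℝ) + 1)) • A m z) := by
        nth_rewrite 2 [← hJA m z]; abel
      rw [h2, norm_neg, norm_smul, Real.norm_of_nonneg (by positivity), div_mul_eq_mul_div, one_mul,
        div_lt_iff₀ (by positivity)]
      have h3 := hAle m _ hzy
      simp only at h3
      rw [div_lt_iff₀ hη] at hN
      nlinarith
    have h2 : ‖J m (f - z)‖ < η / 3 := (hJn m _).trans_lt (by rwa [norm_sub_rev])
    rw [dist_eq_norm]
    calc ‖J m f - f‖ = ‖J m (f - z) + (J m z - z) + (z - f)‖ := by rw [map_sub]; congr 1; abel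
      _ ≤ ‖J m (f - z)‖ + ‖J m z - z‖ + ‖z - f‖ := norm_add₃_le
      _ < η := by linarith
  set S : ℕ → ℝ → X →L[ℝ] X := fun m t => NormedSpace.exp (t • (-(A m))) with hS
  have hSn : ∀ m t x, 0 ≤ t → ‖S m t x‖ ≤ ‖x‖ := fun m t x ht => expNeg_norm_le (A m) (hAacc m) x ht
  have hSadd : ∀ m s t x, S m (s + t) x = S m s (S m t x) := by
    intro m s t x
    simp only [hS]
    let _ : NormedAlgebra ℚ (X →L[ℝ] X) := NormedAlgebra.restrictScalars ℚ ℝ _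
    rw [add_smul, NormedSpace.exp_add_of_commute (((Commute.refl _).smul_left s).smul_right t)]
    rfl
  have hSdiff : ∀ k m t x, 0 ≤ t → ‖S k t x - S m t x‖ ≤ t * ‖A k x - A m x‖ :=
    fun k m t x ht => expNeg_sub_le (A k) (A m) (hAacc k) (hAacc m) (hcomm k m) x ht
  have hScauchy : ∀ t x, 0 ≤ t → CauchySeq (fun m => S m t x) := by
    intro t x ht
    rw [Metric.cauchySeq_iff]
    intro η hη
    obtain ⟨z, hz, ⟨y, hzy⟩⟩ := Metric.dense_iff.1 dense x (η / 3) (by positivity)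
    rw [Metric.mem_ball, dist_eq_norm] at hz
    have hc : CauchySeq (fun m => A m z) := by
      have : (fun m => A m z) = fun m => J m y := funext fun m => (hJB m _ hzy).2
      rw [this]; exact (hJlim y).cauchySeq
    obtain ⟨N, hN⟩ := Metric.cauchySeq_iff.1 hc (η / (3 * (t + 1))) (by positivity)
    refine ⟨N, fun k hk m hm => ?_⟩
    have h1 := hN k hk m hm
    rw [dist_eq_norm, lt_div_iff₀ (by positivity)] at h1
    have h2 := hSdiff k m t z ht
    have h3 := hSn k t (x - z) ht
    have h4 := hSn m t (z - x) ht
    rw [norm_sub_rev] at h3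
    rw [dist_eq_norm]
    have h5 : t * ‖A k z - A m z‖ < η / 3 := by
      nlinarith [norm_nonneg (A k z - A m z)]
    calc ‖S k t x - S m t x‖ = ‖S k t (x - z) + (S k t z - S m t z) + S m t (z - x)‖ := by
          rw [map_sub, map_sub]; congr 1; abel
      _ ≤ ‖S k t (x - z)‖ + ‖S k t z - S m t z‖ + ‖S m t (z - x)‖ := norm_add₃_le
      _ < η := by linarith
  have hlim : ∀ (t : ℝ≥0) (x : X), ∃ y, Tendsto (fun m => S m t x) atTop (𝓝 y) :=
    fun t x => cauchySeq_tendsto_of_complete (hScauchy t x t.2)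
  choose L hL using hlim
  have hLn : ∀ t x, ‖L t x‖ ≤ ‖x‖ := fun t x =>
    le_of_tendsto (hL t x).norm (Eventually.of_forall fun m => hSn m t x t.2)
  let T : ℝ≥0 → X →L[ℝ] X := fun t => LinearMap.mkContinuous
    { toFun := L t
      map_add' := fun x y => tendsto_nhds_unique (hL t (x + y))
        (((hL t x).add (hL t y)).congr fun m => (map_add _ _ _).symm)
      map_smul' := fun a x => tendsto_nhds_unique (hL t (a • x))
        (((hL t x).const_smul a).congr fun m => (map_smul _ _ _).symm) } 1
      (fun x => by simpa using hLn t x)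
  have hTL : ∀ t x, T t x = L t x := fun t x => rfl
  have hTn : ∀ t x, ‖T t x‖ ≤ ‖x‖ := hLn
  have hTzero : T 0 = ContinuousLinearMap.id ℝ X := by
    ext x
    refine tendsto_nhds_unique (hL 0 x) ?_
    simp [hS]
  have hTadd : ∀ s t, T (s + t) = (T s).comp (T t) := by
    intro s t
    ext x
    refine tendsto_nhds_unique (hL (s + t) x) ?_
    have h1 : Tendsto (fun m => S m s (S m t x - L t x) + S m s (L t x)) atTop
        (𝓝 (0 + L s (L t x))) := by
      refine Tendsto.add ?_ (hL s (L t x))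
      refine squeeze_zero_norm (fun m => hSn m s _ s.2) ?_
      have := (hL t x).sub_const (L t x)
      rw [sub_self] at this
      simpa using this.norm
    rw [zero_add] at h1
    refine h1.congr fun m => ?_
    rw [← map_add, sub_add_cancel, NNReal.coe_add, hSadd]
  have hTdom : ∀ q ∈ B, ∀ t : ℝ≥0, ‖T t q.1 - q.1‖ ≤ t * ‖q.2‖ := by
    intro q hq t
    refine le_of_tendsto ((hL t q.1).sub_const q.1).norm (Eventually.of_forall fun m => ?_)
    have h := expNeg_sub_le (A m) 0 (hAacc m) (fun x => by simp) (Commute.zero_right _) q.1 t.2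
    simp only [neg_zero, smul_zero, NormedSpace.exp_zero, one_apply_eq_self, zero_apply,
      sub_zero] at h
    exact h.trans (mul_le_mul_of_nonneg_left (hAle m q hq) t.2)
  have hTcont0 : ∀ x, Tendsto (fun t => T t x) (𝓝 0) (𝓝 x) := by
    intro x
    rw [Metric.tendsto_nhds]
    intro η hη
    obtain ⟨z, hz, ⟨y, hzy⟩⟩ := Metric.dense_iff.1 dense x (η / 3) (by positivity)
    rw [Metric.mem_ball, dist_eq_norm] at hz
    have hev : ∀ᶠ t : ℝ≥0 in 𝓝 0, (t : ℝ) * ‖y‖ < η / 3 := by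
      have : Tendsto (fun t : ℝ≥0 => (t : ℝ) * ‖y‖) (𝓝 0) (𝓝 (((0 : ℝ≥0) : ℝ) * ‖y‖)) :=
        (by fun_prop : Continuous fun t : ℝ≥0 => (t : ℝ) * ‖y‖).tendsto 0
      rw [NNReal.coe_zero, zero_mul] at this
      exact this.eventually (gt_mem_nhds (by positivity))
    filter_upwards [hev] with t ht
    have h1 := hTdom _ hzy t
    have h2 := hTn t (x - z)
    rw [norm_sub_rev] at h2
    simp only at h1
    rw [dist_eq_norm]
    calc ‖T t x - x‖ = ‖T t (x - z) + (T t z - z) + (z - x)‖ := by rw [map_sub]; congr 1; abel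
      _ ≤ ‖T t (x - z)‖ + ‖T t z - z‖ + ‖z - x‖ := norm_add₃_le
      _ < η := by linarith
  have hTholder : ∀ s t x, s ≤ t → ‖T t x - T s x‖ ≤ ‖T (t - s) x - x‖ := by
    intro s t x hst
    have : T t x = T s (T (t - s) x) := by
      have := congrArg (fun F : X →L[ℝ] X => F x) (hTadd s (t - s))
      simpa [add_tsub_cancel_of_le hst] using this
    rw [this, ← map_sub]; exact hTn _ _
  have hTcont : ∀ x, Continuous fun t => T t x := by
    intro x
    rw [Metric.continuous_iff]
    intro t η hη
    obtain ⟨δ, hδ, h⟩ := Metric.tendsto_nhds_nhds.1 (hTcont0 x) η hη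
    refine ⟨δ, hδ, fun s hs => ?_⟩
    rw [dist_eq_norm]
    rcases le_total t s with hts | hst
    · refine (hTholder t s x hts).trans_lt ?_
      rw [← dist_eq_norm]
      apply h
      rw [NNReal.dist_eq] at hs ⊢
      simpa [NNReal.coe_sub hts] using hs
    · rw [norm_sub_rev]
      refine (hTholder s t x hst).trans_lt ?_
      rw [← dist_eq_norm]
      apply h
      rw [NNReal.dist_eq] at hs ⊢
      rw [abs_sub_comm] at hs
      simpa [NNReal.coe_sub hst] using hs
  have hgen : ∀ z y, (z, y) ∈ B →
      Tendsto (fun t : ℝ≥0 => (t : ℝ)⁻¹ • (T t z - z)) (𝓝[>] 0) (𝓝 (-y)) := by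
    intro z y hzy
    have hest : ∀ y' y'', (y', y'') ∈ B → ∀ t : ℝ≥0,
        ‖T t z - z + (t : ℝ) • y‖ ≤ t * (2 * ‖y - y'‖ + t * ‖y''‖) := by
      intro y' y'' hy t
      have hm : ∀ m, ‖S m t z - z + (t : ℝ) • y‖ ≤
          (2 * ‖y - y'‖ + t * ‖y''‖ + ‖J m y - y‖) * t := by
        intro m
        have hd : ∀ s ∈ Icc (0 : ℝ) t, HasDerivWithinAt (fun s : ℝ => S m s z + s • y)
            (-(A m (S m s z)) + y) (Icc 0 t) s := fun s _ =>
          ((expNeg_hasDerivAt (A m) z s).add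
            (by simpa using (hasDerivAt_id s).smul_const y)).hasDerivWithinAt
        have hb := norm_image_sub_le_of_norm_deriv_le_segment' hd
          (C := 2 * ‖y - y'‖ + t * ‖y''‖ + ‖J m y - y‖) (fun s hs => ?_) t ⟨t.2, le_rfl⟩
        · have h0 : S m 0 z = z := by simp [hS]
          rw [h0, zero_smul, add_zero, sub_zero] at hb
          convert hb using 2
          abel
        · have hAS : A m (S m s z) = S m s (J m y) := by
            rw [← (hJB m _ hzy).2]
            have : Commute (A m) (S m s) :=
              (Commute.exp_left (((Commute.refl (A m)).neg_left).smul_left s)).symm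
            exact congrArg (fun F : X →L[ℝ] X => F z) this.eq
          have h1 : ‖S m s y' - y'‖ ≤ s * ‖y''‖ := by
            have h := expNeg_sub_le (A m) 0 (hAacc m) (fun x => by simp) (Commute.zero_right _)
              y' hs.1
            simp only [neg_zero, smul_zero, NormedSpace.exp_zero, one_apply_eq_self, zero_apply,
              sub_zero] at h
            exact h.trans (mul_le_mul_of_nonneg_left (hAle m _ hy) hs.1)
          have h2 : s * ‖y''‖ ≤ t * ‖y''‖ :=
            mul_le_mul_of_nonneg_right hs.2.le (norm_nonneg _)
          have h3 := hSn m s (J m y - y) hs.1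
          have h4 := hSn m s (y - y') hs.1
          rw [hAS]
          calc ‖-(S m s (J m y)) + y‖
              = ‖S m s (J m y - y) + S m s (y - y') + (S m s y' - y') + (y' - y)‖ := by
                rw [← norm_neg, map_sub, map_sub]; congr 1; abel
            _ ≤ ‖S m s (J m y - y) + S m s (y - y') + (S m s y' - y')‖ + ‖y' - y‖ :=
                norm_add_le _ _
            _ ≤ ‖S m s (J m y - y)‖ + ‖S m s (y - y')‖ + ‖S m s y' - y'‖ + ‖y' - y‖ := by
                gcongr; exact norm_add₃_le
            _ ≤ _ := by rw [norm_sub_rev y' y]; linarith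
      have hlimL := (((hL t z).sub_const z).add_const ((t : ℝ) • y)).norm
      have hlimR : Tendsto (fun m => (2 * ‖y - y'‖ + t * ‖y''‖ + ‖J m y - y‖) * (t : ℝ)) atTop
          (𝓝 ((2 * ‖y - y'‖ + t * ‖y''‖ + ‖y - y‖) * t)) :=
        ((((hJlim y).sub_const y).norm).const_add _).mul_const _
      have := le_of_tendsto_of_tendsto' hlimL hlimR hm
      rw [sub_self, norm_zero, add_zero, mul_comm] at this
      exact this
    rw [Metric.tendsto_nhds]
    intro η hη
    obtain ⟨y', hy', ⟨y'', hy⟩⟩ := Metric.dense_iff.1 dense y (η / 4) (by positivity)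
    rw [Metric.mem_ball, dist_eq_norm, norm_sub_rev] at hy'
    have hev : ∀ᶠ t : ℝ≥0 in 𝓝 0, (t : ℝ) * ‖y''‖ < η / 3 := by
      have : Tendsto (fun t : ℝ≥0 => (t : ℝ) * ‖y''‖) (𝓝 0) (𝓝 (((0 : ℝ≥0) : ℝ) * ‖y''‖)) :=
        (by fun_prop : Continuous fun t : ℝ≥0 => (t : ℝ) * ‖y''‖).tendsto 0
      rw [NNReal.coe_zero, zero_mul] at this
      exact this.eventually (gt_mem_nhds (by positivity))
    filter_upwards [nhdsWithin_le_nhds hev, self_mem_nhdsWithin] with t ht ht0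
    have htpos : (0 : ℝ) < t := ht0
    have h := hest y' y'' hy t
    rw [dist_eq_norm]
    have heq : (t : ℝ)⁻¹ • (T t z - z) - -y = (t : ℝ)⁻¹ • (T t z - z + (t : ℝ) • y) := by
      rw [smul_add, smul_smul, inv_mul_cancel₀ htpos.ne', one_smul, sub_neg_eq_add]
    rw [heq, norm_smul, norm_inv, Real.norm_of_nonneg htpos.le, inv_mul_lt_iff₀ htpos]
    refine h.trans_lt (mul_lt_mul_of_pos_left ?_ htpos)
    linarith
  refine ⟨⟨T, hTzero, hTadd, hTcont⟩, fun z y => ⟨fun h => ?_, fun h => hgen z y h⟩,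
    fun sym t x y => ?_⟩
  swap
  · have hAsym : ∀ m, IsSelfAdjoint (A m) := by
      intro m
      rw [ContinuousLinearMap.isSelfAdjoint_iff_isSymmetric]
      intro f g
      have h1 := sym _ (hB m f) _ (hB m g)
      simp only at h1
      simp only [ContinuousLinearMap.coe_coe]
      calc ⟪A m f, g⟫_ℝ = ⟪A m f, J m g + (1 / ((m : ℝ) + 1)) • A m g⟫_ℝ := by rw [hJA]
        _ = ⟪J m f + (1 / ((m : ℝ) + 1)) • A m f, A m g⟫_ℝ := by
          rw [inner_add_right, inner_add_left, h1, real_inner_smul_left, real_inner_smul_right]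
        _ = ⟪f, A m g⟫_ℝ := by rw [hJA]
    have hSsym : ∀ m, ⟪S m t x, y⟫_ℝ = ⟪x, S m t y⟫_ℝ := by
      intro m
      have h1 : IsSelfAdjoint (S m t) := ((IsSelfAdjoint.all (t : ℝ)).smul (hAsym m).neg).exp
      exact (ContinuousLinearMap.isSelfAdjoint_iff_isSymmetric.1 h1) x y
    exact tendsto_nhds_unique (((hL t x).inner tendsto_const_nhds).congr hSsym)
      (tendsto_const_nhds.inner (hL t y))
  obtain ⟨⟨a, b⟩, hab, heq⟩ := surj 1 one_pos (z + y)
  simp only [one_smul] at heq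
  have h1 : Tendsto (fun t : ℝ≥0 => (t : ℝ)⁻¹ • (T t (z - a) - (z - a))) (𝓝[>] 0)
      (𝓝 (-y - -b)) := by
    refine (Tendsto.sub h (hgen a b hab)).congr fun t => ?_
    rw [← smul_sub, map_sub]; congr 1; simp only; abel
  have h2 : -y - -b = z - a := by
    have : b = z + y - a := by rw [← heq]; abel
    rw [this]; abel
  rw [h2] at h1
  have h3 : ⟪z - a, z - a⟫_ℝ ≤ 0 := by
    refine le_of_tendsto (h1.inner tendsto_const_nhds) ?_
    filter_upwards with t
    rw [inner_smul_left, inner_sub_left, real_inner_self_eq_norm_sq]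
    have h4 := real_inner_le_norm (T t (z - a)) (z - a)
    have h5 := hTn t (z - a)
    apply mul_nonpos_of_nonneg_of_nonpos
    · simp
    · nlinarith [norm_nonneg (z - a)]
  have h4 : z - a = 0 := by
    rw [real_inner_self_eq_norm_sq] at h3
    exact norm_eq_zero.1 (by nlinarith [norm_nonneg (z - a)])
  have h5 : z = a := sub_eq_zero.1 h4
  have h6 : y = b := by rw [h5] at heq; exact (add_left_cancel heq).symm
  rw [h5, h6]; exact hab

end Generation

/-! ### The system and the weighted spaces -/

/-- The data of the Fokker-Planck equation of an `n`-dimensional Ornstein-Uhlenbeck process: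
a number `c > 0` and a symmetric positive definite matrix `Γ`. -/
structure OUParams (n : ℕ) where
  c : ℝ
  Γ : Matrix (Fin n) (Fin n) ℝ
  c_pos : 0 < c
  Γ_posDef : Γ.PosDef

noncomputable section

/-- The measure `e^{a(x)} dx` on `ℝⁿ`. -/
def expMeasure {n : ℕ} (a : EuclideanSpace ℝ (Fin n) → ℝ) : Measure (EuclideanSpace ℝ (Fin n)) :=
  volume.withDensity fun x => ENNReal.ofReal (Real.exp (a x))

section ExpMeasure
variable {n : ℕ} {F : Type*} [NormedAddCommGroup F] [NormedSpace ℝ F]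

theorem expMeasure_ac {a : EuclideanSpace ℝ (Fin n) → ℝ} (ha : Continuous a) :
    expMeasure a ≪ volume ∧ (volume : Measure (EuclideanSpace ℝ (Fin n))) ≪ expMeasure a := by
  refine ⟨withDensity_absolutelyContinuous _ _, withDensity_absolutelyContinuous' ?_ ?_⟩
  · exact (by fun_prop : Measurable fun x => ENNReal.ofReal (Real.exp (a x))).aemeasurable
  · exact Eventually.of_forall fun x => by simp [Real.exp_pos]

theorem expMeasure_zero :
    expMeasure (fun _ : EuclideanSpace ℝ (Fin n) => (0 : ℝ)) = volume := by
  simp [expMeasure]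

theorem eLpNorm_exp_smul {a b k : EuclideanSpace ℝ (Fin n) → ℝ} (ha : Continuous a)
    (hb : Continuous b) (hab : ∀ x, 2 * k x + b x = a x)
    (f : EuclideanSpace ℝ (Fin n) → F) :
    eLpNorm (fun x => Real.exp (k x) • f x) 2 (expMeasure b) = eLpNorm f 2 (expMeasure a) := by
  rw [eLpNorm_eq_lintegral_rpow_enorm_toReal (by norm_num) (by norm_num),
    eLpNorm_eq_lintegral_rpow_enorm_toReal (by norm_num) (by norm_num)]
  congr 1
  unfold expMeasure
  rw [lintegral_withDensity_eq_lintegral_mul_non_measurable _ (by fun_prop)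
    (Eventually.of_forall fun x => ENNReal.ofReal_lt_top),
    lintegral_withDensity_eq_lintegral_mul_non_measurable _ (by fun_prop)
    (Eventually.of_forall fun x => ENNReal.ofReal_lt_top)]
  refine lintegral_congr fun x => ?_
  simp only [Pi.mul_apply, enorm_smul, ENNReal.toReal_ofNat, ENNReal.rpow_ofNat, mul_pow]
  rw [← mul_assoc, Real.enorm_of_nonneg (Real.exp_pos _).le, ← ENNReal.ofReal_pow (Real.exp_pos _).le,
    ← ENNReal.ofReal_mul (Real.exp_pos _).le, ← Real.exp_nat_mul, ← Real.exp_add, ← hab x]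
  congr 3
  push_cast; ring

theorem memLp_exp_smul {a b k : EuclideanSpace ℝ (Fin n) → ℝ} (ha : Continuous a)
    (hb : Continuous b) (hk : Continuous k) (hab : ∀ x, 2 * k x + b x = a x)
    {f : EuclideanSpace ℝ (Fin n) → F} (hf : MemLp f 2 (expMeasure a)) :
    MemLp (fun x => Real.exp (k x) • f x) 2 (expMeasure b) := by
  refine ⟨?_, by rw [eLpNorm_exp_smul ha hb hab]; exact hf.2⟩
  have h1 : AEStronglyMeasurable f (expMeasure b) :=
    hf.1.mono_ac ((expMeasure_ac hb).1.trans (expMeasure_ac ha).2)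
  exact (by fun_prop : Continuous fun x => Real.exp (k x)).aestronglyMeasurable.smul h1

theorem memLp_locallyIntegrable {a : EuclideanSpace ℝ (Fin n) → ℝ} (ha : Continuous a)
    {f : EuclideanSpace ℝ (Fin n) → F} (hf : MemLp f 2 (expMeasure a)) :
    LocallyIntegrable f volume := by
  have h1 : MemLp (fun x => Real.exp (a x / 2) • f x) 2 volume := by
    rw [← expMeasure_zero]
    exact memLp_exp_smul ha continuous_const (by fun_prop) (fun x => by ring) hf
  have h2 := (h1.locallyIntegrable (by norm_num)).continuous_smul
    (f := fun x => Real.exp (a x / 2) • f x) (g := fun x => Real.exp (-(a x / 2)))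
    (by fun_prop)
  refine h2.congr (Eventually.of_forall fun x => ?_)
  simp only [smul_smul, ← Real.exp_add, neg_add_cancel, Real.exp_zero, one_smul]

/-- Multiplication `f ↦ e^{-a} f`, as an isometry of `L²(ℝⁿ; e^{-a})` onto `L²(ℝⁿ; e^{a})`. -/
def mulExpNeg (F : Type*) [NormedAddCommGroup F] [NormedSpace ℝ F]
    (a : EuclideanSpace ℝ (Fin n) → ℝ) (ha : Continuous a) :
    Lp F 2 (expMeasure fun x => -a x) ≃ₗᵢ[ℝ] Lp F 2 (expMeasure a) where
  toFun f := (memLp_exp_smul (k := fun x => -a x) (a := fun x => -a x) (by fun_prop) ha (by fun_prop) (fun x => by ring)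
    (Lp.memLp f)).toLp
  invFun f := (memLp_exp_smul (k := a) (b := fun x => -a x) ha (by fun_prop) ha (fun x => by ring) (Lp.memLp f)).toLp
  map_add' f g := by
    rw [← MemLp.toLp_add, MemLp.toLp_eq_toLp_iff]
    filter_upwards [((expMeasure_ac ha).1.trans (expMeasure_ac (a := fun x => -a x) (by fun_prop)).2).ae_le (Lp.coeFn_add f g)]
      with x hx
    simp only [Pi.add_apply] at hx ⊢
    rw [hx, smul_add]
  map_smul' r f := by
    rw [RingHom.id_apply, ← MemLp.toLp_const_smul, MemLp.toLp_eq_toLp_iff]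
    filter_upwards [((expMeasure_ac ha).1.trans (expMeasure_ac (a := fun x => -a x) (by fun_prop)).2).ae_le (Lp.coeFn_smul r f)]
      with x hx
    simp only [Pi.smul_apply] at hx ⊢
    rw [hx, smul_comm]
  left_inv f := by
    apply Lp.ext
    have h1 := ((expMeasure_ac (a := fun x => -a x) (by fun_prop)).1.trans (expMeasure_ac ha).2).ae_le
      (memLp_exp_smul (k := fun x => -a x) (a := fun x => -a x) (by fun_prop) ha (by fun_prop) (fun x => by ring)
        (Lp.memLp f)).coeFn_toLp
    refine (MemLp.coeFn_toLp _).trans ?_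
    filter_upwards [h1] with x hx
    rw [hx, smul_smul, ← Real.exp_add, add_neg_cancel, Real.exp_zero, one_smul]
  right_inv f := by
    apply Lp.ext
    have h1 := ((expMeasure_ac ha).1.trans (expMeasure_ac (a := fun x => -a x) (by fun_prop)).2).ae_le
      (memLp_exp_smul (k := a) (b := fun x => -a x) ha (by fun_prop) ha (fun x => by ring) (Lp.memLp f)).coeFn_toLp
    refine (MemLp.coeFn_toLp _).trans ?_
    filter_upwards [h1] with x hx
    rw [hx, smul_smul, ← Real.exp_add, neg_add_cancel, Real.exp_zero, one_smul]
  norm_map' f := by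
    refine (Lp.norm_toLp _ (memLp_exp_smul (k := fun x => -a x) (a := fun x => -a x)
      (by fun_prop) ha (by fun_prop) (fun x => by ring) (Lp.memLp f))).trans ?_
    rw [ eLpNorm_exp_smul (a := fun x => -a x) (by fun_prop) ha (fun x => by ring), Lp.norm_def]

end ExpMeasure

/-- `G` is the weak gradient of `f` on `ℝⁿ`: both are locally integrable and
`∫ f ∂ᵢψ dx = -∫ Gᵢ ψ dx` for all test functions `ψ ∈ C_c^∞(ℝⁿ)` and all `i`. -/
def IsWeakGradient {n : ℕ} (f : EuclideanSpace ℝ (Fin n) → ℝ)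
    (G : EuclideanSpace ℝ (Fin n) → EuclideanSpace ℝ (Fin n)) : Prop :=
  LocallyIntegrable f ∧ LocallyIntegrable G ∧
  ∀ ψ : EuclideanSpace ℝ (Fin n) → ℝ, ContDiff ℝ ∞ ψ → HasCompactSupport ψ →
    ∀ i : Fin n, ∫ x, f x * fderiv ℝ ψ x (EuclideanSpace.single i 1) = -∫ x, G x i * ψ x

theorem exists_testPairing {n : ℕ} {F : Type*} [NormedAddCommGroup F] [InnerProductSpace ℝ F]
    {a : EuclideanSpace ℝ (Fin n) → ℝ} (ha : Continuous a) (w : EuclideanSpace ℝ (Fin n) → F)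
    (hw : Continuous w) (hw' : HasCompactSupport w) :
    ∃ W : Lp F 2 (expMeasure a), ∀ f : Lp F 2 (expMeasure a), ⟪W, f⟫_ℝ = ∫ x, ⟪w x, f x⟫_ℝ := by
  have hloc : IsLocallyFiniteMeasure (expMeasure a) :=
    IsLocallyFiniteMeasure.withDensity_ofReal (by fun_prop)
  have hm : MemLp (fun x => Real.exp (-a x) • w x) 2 (expMeasure a) :=
    (by fun_prop : Continuous fun x => Real.exp (-a x) • w x).memLp_of_hasCompactSupport
      (hw'.smul_left)
  refine ⟨hm.toLp, fun f => ?_⟩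
  rw [L2.inner_def]
  have h1 : ∫ x, ⟪hm.toLp _ x, f x⟫_ℝ ∂(expMeasure a) =
      ∫ x, ⟪Real.exp (-a x) • w x, f x⟫_ℝ ∂(expMeasure a) := by
    refine integral_congr_ae ?_
    filter_upwards [hm.coeFn_toLp] with x hx
    rw [hx]
  rw [h1]
  unfold expMeasure
  rw [integral_withDensity_eq_integral_toReal_smul (by fun_prop)
    (Eventually.of_forall fun x => ENNReal.ofReal_lt_top)]
  refine integral_congr_ae (Eventually.of_forall fun x => ?_)
  simp only [ENNReal.toReal_ofReal (Real.exp_pos _).le, inner_smul_left, smul_eq_mul]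
  simp only [RCLike.conj_to_real, ← mul_assoc, ← Real.exp_add, add_neg_cancel, Real.exp_zero,
    one_mul]


theorem exists_gradPairing {n : ℕ} {a : EuclideanSpace ℝ (Fin n) → ℝ} (ha : Continuous a)
    (ψ : EuclideanSpace ℝ (Fin n) → ℝ) (hψ : ContDiff ℝ ∞ ψ) (hψ' : HasCompactSupport ψ)
    (i : Fin n) :
    ∃ (W₁ : Lp ℝ 2 (expMeasure a)) (W₂ : Lp (EuclideanSpace ℝ (Fin n)) 2 (expMeasure a)),
      (∀ f : Lp ℝ 2 (expMeasure a),
        ∫ x, f x * fderiv ℝ ψ x (EuclideanSpace.single i 1) = ⟪W₁, f⟫_ℝ) ∧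
      (∀ G : Lp (EuclideanSpace ℝ (Fin n)) 2 (expMeasure a), ∫ x, G x i * ψ x = ⟪W₂, G⟫_ℝ) := by
  obtain ⟨W₁, h₁⟩ := exists_testPairing ha
    (fun x => fderiv ℝ ψ x (EuclideanSpace.single i (1 : ℝ)))
    ((hψ.continuous_fderiv (by simp)).clm_apply continuous_const)
    (hψ'.fderiv_apply ℝ _)
  obtain ⟨W₂, h₂⟩ := exists_testPairing ha (fun x => ψ x • EuclideanSpace.single i (1 : ℝ))
    (hψ.continuous.smul continuous_const) hψ'.smul_right
  refine ⟨W₁, W₂, fun f => ?_, fun G => ?_⟩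
  · rw [h₁]; rfl
  · rw [h₂]
    refine integral_congr_ae (Eventually.of_forall fun x => ?_)
    simp [inner_smul_left, EuclideanSpace.inner_single_left, mul_comm]

/-- The weighted Sobolev space `W^{1,2}(ℝⁿ; e^a)`. A member `f` is represented by the pair `(f, ∇f)`
in `L²(e^a) × L²(e^a)ⁿ` (the weak gradient is unique), so that the norm and the inner product of the
surrounding `ℓ²`-product are the Sobolev ones. -/
def sobolevGraph {n : ℕ} (a : EuclideanSpace ℝ (Fin n) → ℝ) (ha : Continuous a) :
    Submodule ℝ (WithLp 2 (Lp ℝ 2 (expMeasure a) × Lp (EuclideanSpace ℝ (Fin n)) 2 (expMeasure a)))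
    where
  carrier := {q | IsWeakGradient q.fst q.snd}
  zero_mem' := by
    refine ⟨memLp_locallyIntegrable ha (Lp.memLp _), memLp_locallyIntegrable ha (Lp.memLp _), ?_⟩
    intro ψ hψ hψ' i
    obtain ⟨W₁, W₂, h₁, h₂⟩ := exists_gradPairing ha ψ hψ hψ' i
    rw [h₁, h₂]; simp
  add_mem' := by
    rintro p q ⟨-, -, hp⟩ ⟨-, -, hq⟩
    refine ⟨memLp_locallyIntegrable ha (Lp.memLp _), memLp_locallyIntegrable ha (Lp.memLp _), ?_⟩
    intro ψ hψ hψ' i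
    have hp1 := hp ψ hψ hψ' i
    have hq1 := hq ψ hψ hψ' i
    obtain ⟨W₁, W₂, h₁, h₂⟩ := exists_gradPairing ha ψ hψ hψ' i
    rw [h₁, h₂] at hp1 hq1 ⊢
    rw [WithLp.add_fst, WithLp.add_snd, inner_add_right, inner_add_right, hp1, hq1]; ring
  smul_mem' := by
    rintro r p ⟨-, -, hp⟩
    refine ⟨memLp_locallyIntegrable ha (Lp.memLp _), memLp_locallyIntegrable ha (Lp.memLp _), ?_⟩
    intro ψ hψ hψ' i
    have hp1 := hp ψ hψ hψ' i
    obtain ⟨W₁, W₂, h₁, h₂⟩ := exists_gradPairing ha ψ hψ hψ' i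
    rw [h₁, h₂] at hp1 ⊢
    rw [WithLp.smul_fst, WithLp.smul_snd, inner_smul_right, inner_smul_right, hp1]; ring

theorem isClosed_sobolevGraph {n : ℕ} {a : EuclideanSpace ℝ (Fin n) → ℝ} (ha : Continuous a) :
    IsClosed (sobolevGraph a ha : Set (WithLp 2 (Lp ℝ 2 (expMeasure a) ×
      Lp (EuclideanSpace ℝ (Fin n)) 2 (expMeasure a)))) := by
  rw [← isSeqClosed_iff_isClosed]
  intro u q hu hq
  refine ⟨memLp_locallyIntegrable ha (Lp.memLp _), memLp_locallyIntegrable ha (Lp.memLp _), ?_⟩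
  intro ψ hψ hψ' i
  have h := fun m => (hu m).2.2 ψ hψ hψ' i
  obtain ⟨W₁, W₂, h₁, h₂⟩ := exists_gradPairing ha ψ hψ hψ' i
  simp only [h₁, h₂] at h ⊢
  have hf : Tendsto (fun m => (u m).fst) atTop (𝓝 q.fst) :=
    ((WithLp.prod_continuous_ofLp 2 _ _).fst.tendsto q).comp hq
  have hg : Tendsto (fun m => (u m).snd) atTop (𝓝 q.snd) :=
    ((WithLp.prod_continuous_ofLp 2 _ _).snd.tendsto q).comp hq
  exact tendsto_nhds_unique ((tendsto_const_nhds.inner hf).congr h)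
    ((tendsto_const_nhds (x := W₂)).inner hg).neg

theorem dense_sobolevGraph {n : ℕ} {a : EuclideanSpace ℝ (Fin n) → ℝ} (ha : Continuous a) :
    Dense {f : Lp ℝ 2 (expMeasure a) | ∃ G, WithLp.toLp 2 (f, G) ∈ sobolevGraph a ha} := by
  have hloc : IsLocallyFiniteMeasure (expMeasure a) :=
    IsLocallyFiniteMeasure.withDensity_ofReal (by fun_prop)
  refine (Lp.dense_hasCompactSupport_contDiff (p := 2) (by norm_num)).mono ?_
  rintro f ⟨θ, hfθ, hθ, hθ'⟩
  have hgc : Continuous (gradient θ) := by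
    unfold gradient
    exact (LinearIsometryEquiv.continuous _).comp (hθ'.continuous_fderiv (by simp))
  have hgs : HasCompactSupport (gradient θ) :=
    (hθ.fderiv ℝ).comp_left (map_zero _)
  have hgm : MemLp (gradient θ) 2 (expMeasure a) := hgc.memLp_of_hasCompactSupport hgs
  refine ⟨hgm.toLp, memLp_locallyIntegrable ha (Lp.memLp _),
    memLp_locallyIntegrable ha (Lp.memLp _), ?_⟩
  intro ψ hψ hψ' i
  have e1 := (expMeasure_ac ha).2.ae_le hfθ
  have e2 := (expMeasure_ac ha).2.ae_le hgm.coeFn_toLp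
  have c1 : Continuous fun x => fderiv ℝ θ x (EuclideanSpace.single i (1 : ℝ)) :=
    (hθ'.continuous_fderiv (by simp)).clm_apply continuous_const
  have c2 : Continuous fun x => fderiv ℝ ψ x (EuclideanSpace.single i (1 : ℝ)) :=
    (hψ.continuous_fderiv (by simp)).clm_apply continuous_const
  have key := integral_mul_fderiv_eq_neg_fderiv_mul_of_integrable (f := θ) (g := ψ)
    (v := EuclideanSpace.single i (1 : ℝ)) (μ := volume)
    ((c1.mul hψ.continuous).integrable_of_hasCompactSupport hψ'.mul_left)
    ((hθ'.continuous.mul c2).integrable_of_hasCompactSupport hθ.mul_right)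
    ((hθ'.continuous.mul hψ.continuous).integrable_of_hasCompactSupport hθ.mul_right)
    (fun x _ => hθ'.differentiable (by simp) x) (fun x _ => hψ.differentiable (by simp) x)
  have r1 : ∫ x, f x * fderiv ℝ ψ x (EuclideanSpace.single i 1) =
      ∫ x, θ x * fderiv ℝ ψ x (EuclideanSpace.single i 1) := by
    refine integral_congr_ae ?_
    filter_upwards [e1] with x hx
    rw [hx]
  have r2 : ∫ x, hgm.toLp _ x i * ψ x =
      ∫ x, fderiv ℝ θ x (EuclideanSpace.single i 1) * ψ x := by
    refine integral_congr_ae ?_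
    filter_upwards [e2] with x hx
    rw [hx]
    congr 1
    have h1 : ⟪gradient θ x, EuclideanSpace.single i (1 : ℝ)⟫_ℝ =
        fderiv ℝ θ x (EuclideanSpace.single i 1) := by
      rw [gradient, InnerProductSpace.toDual_symm_apply]
    rw [← h1, EuclideanSpace.inner_single_right]
    simp
  exact r1.trans (key.trans (congrArg Neg.neg r2.symm))

/-! ### The operator of a symmetric form -/

section Form
variable {X Y : Type*} [NormedAddCommGroup X] [InnerProductSpace ℝ X]
  [NormedAddCommGroup Y] [InnerProductSpace ℝ Y]

/-- Let `W` be a space of pairs `q = (z, ∇z)`, with the form `a(q, r) = ⟨q.2, r.2⟩`. This is the graph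
`{(z, A z)}` of the operator `A` that the form defines: `z` is in the domain of `A` and `A z = u` iff
`z` is in the form domain and `a(z, w) = ⟨u, w⟩` for all `w` in the form domain. -/
def formOperator (W : Submodule ℝ (WithLp 2 (X × Y))) : Submodule ℝ (X × X) where
  carrier := {p | ∃ q ∈ W, q.fst = p.1 ∧ ∀ r ∈ W, ⟪q.snd, r.snd⟫_ℝ = ⟪p.2, r.fst⟫_ℝ}
  zero_mem' := ⟨0, W.zero_mem, by simp, by simp⟩
  add_mem' := by
    rintro p p' ⟨q, hq, h1, h2⟩ ⟨q', hq', h1', h2'⟩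
    refine ⟨q + q', W.add_mem hq hq', by simp [h1, h1'], fun r hr => ?_⟩
    rw [WithLp.add_snd, inner_add_left, h2 r hr, h2' r hr, Prod.snd_add, inner_add_left]
  smul_mem' := by
    rintro a p ⟨q, hq, h1, h2⟩
    refine ⟨a • q, W.smul_mem a hq, by simp [h1], fun r hr => ?_⟩
    rw [WithLp.smul_snd, inner_smul_left, h2 r hr, Prod.smul_snd, inner_smul_left]

theorem formOperator_nonneg (W : Submodule ℝ (WithLp 2 (X × Y))) :
    ∀ p ∈ formOperator W, 0 ≤ ⟪p.2, p.1⟫_ℝ := by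
  rintro p ⟨q, hq, h1, h2⟩
  rw [← h1, ← h2 q hq]
  exact real_inner_self_nonneg


theorem formOperator_symm (W : Submodule ℝ (WithLp 2 (X × Y))) :
    ∀ p ∈ formOperator W, ∀ p' ∈ formOperator W, ⟪p.2, p'.1⟫_ℝ = ⟪p.1, p'.2⟫_ℝ := by
  rintro p ⟨q, hq, h1, h2⟩ p' ⟨q', hq', h1', h2'⟩
  rw [← h1, ← h1', ← h2 q' hq', real_inner_comm, h2' q hq, real_inner_comm]

theorem formOperator_surj [CompleteSpace X] [CompleteSpace Y]
    {W : Submodule ℝ (WithLp 2 (X × Y))}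
    (hW : IsClosed (W : Set (WithLp 2 (X × Y)))) (ε : ℝ) (hε : 0 < ε) (f : X) :
    ∃ p ∈ formOperator W, p.1 + ε • p.2 = f := by
  have hs : 0 < √ε := Real.sqrt_pos.2 hε
  let L : WithLp 2 (X × Y) →ₗ[ℝ] WithLp 2 (X × Y) :=
    { toFun := fun q => WithLp.toLp 2 (q.fst, (√ε)⁻¹ • q.snd)
      map_add' := fun p q => congrArg (WithLp.toLp 2) (Prod.ext rfl (smul_add _ _ _))
      map_smul' := fun a q => congrArg (WithLp.toLp 2) (Prod.ext rfl (smul_comm _ _ _)) }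
  have hL : ∀ q, L q = WithLp.toLp 2 (q.fst, (√ε)⁻¹ • q.snd) := fun q => rfl
  have hLc : Continuous L := by
    refine (WithLp.prod_continuous_toLp 2 _ _).comp (Continuous.prodMk ?_ ?_)
    · exact (WithLp.prod_continuous_ofLp 2 _ _).fst
    · exact (WithLp.prod_continuous_ofLp 2 _ _).snd.const_smul _
  let W' := W.comap L
  have hW' : IsClosed (W' : Set (WithLp 2 (X × Y))) := hW.preimage hLc
  have : CompleteSpace W' := hW'.completeSpace_coe
  set g : WithLp 2 (X × Y) := WithLp.toLp 2 (f, 0) with hg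
  set q := W'.starProjection g with hq
  have hqW : L q ∈ W := (W'.starProjection_apply_mem g : q ∈ W')
  have horth : ∀ r ∈ W, ⟪f - q.fst, r.fst⟫_ℝ = √ε * ⟪q.snd, r.snd⟫_ℝ := by
    intro r hr
    have hr' : WithLp.toLp 2 (r.fst, √ε • r.snd) ∈ W' := by
      change L _ ∈ W
      have : L (WithLp.toLp 2 (r.fst, √ε • r.snd)) = r := by
        rw [hL]
        change WithLp.toLp 2 (r.fst, (√ε)⁻¹ • √ε • r.snd) = r
        rw [smul_smul, inv_mul_cancel₀ hs.ne', one_smul]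
        rfl
      rwa [this]
    have h := W'.starProjection_inner_eq_zero g _ hr'
    rw [← hq, WithLp.prod_inner_apply] at h
    simp only [WithLp.ofLp_fst, WithLp.ofLp_snd, WithLp.sub_fst, WithLp.sub_snd, WithLp.toLp_fst,
      WithLp.toLp_snd, hg, zero_sub, inner_neg_left, inner_smul_right] at h
    linarith
  refine ⟨(q.fst, ε⁻¹ • (f - q.fst)), ⟨L q, hqW, rfl, fun r hr => ?_⟩, ?_⟩
  · rw [hL, WithLp.toLp_snd, inner_smul_left, inner_smul_left, RCLike.conj_to_real,
      RCLike.conj_to_real, horth r hr, ← mul_assoc]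
    congr 1
    nth_rewrite 2 [← Real.mul_self_sqrt hε.le]
    field_simp
  · simp only [smul_smul, mul_inv_cancel₀ hε.ne', one_smul]; abel

theorem formOperator_dense [CompleteSpace X] [CompleteSpace Y]
    {W : Submodule ℝ (WithLp 2 (X × Y))}
    (hW : IsClosed (W : Set (WithLp 2 (X × Y))))
    (hd : Dense {x : X | ∃ y, WithLp.toLp 2 (x, y) ∈ W}) :
    Dense {x : X | ∃ y, (x, y) ∈ formOperator W} := by
  let D : Submodule ℝ X := (formOperator W).map (LinearMap.fst ℝ X X)
  have hD : (D : Set X) = {x : X | ∃ y, (x, y) ∈ formOperator W} := by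
    ext x; simp [D]
  rw [← hD, Submodule.dense_iff_topologicalClosure_eq_top,
    Submodule.topologicalClosure_eq_top_iff, Submodule.eq_bot_iff]
  intro f hf
  obtain ⟨⟨z, y⟩, hzy, hsum⟩ := formOperator_surj hW 1 one_pos f
  simp only [one_smul] at hsum
  have h1 : ⟪z, f⟫_ℝ = 0 := (Submodule.mem_orthogonal _ _).1 hf z ⟨(z, y), hzy, rfl⟩
  have h2 := formOperator_nonneg W _ hzy
  simp only at h2
  rw [← hsum, inner_add_right, real_inner_self_eq_norm_sq, real_inner_comm] at h1
  have hz : z = 0 := norm_eq_zero.1 (by nlinarith [norm_nonneg z])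
  subst hz
  obtain ⟨q, hq, hq1, hq2⟩ := hzy
  have hq0 : q.snd = 0 := by
    have := hq2 q hq
    rw [hq1] at this
    simpa using this
  have hy : ∀ x ∈ {x : X | ∃ y, WithLp.toLp 2 (x, y) ∈ W}, ⟪y, x⟫_ℝ = 0 := by
    rintro x ⟨w, hw⟩
    have := hq2 _ hw
    rw [hq0, inner_zero_left] at this
    exact this.symm
  have hy0 : ⟪y, y⟫_ℝ = 0 := by
    have hc : IsClosed {x : X | ⟪y, x⟫_ℝ = 0} :=
      isClosed_eq (by fun_prop) continuous_const
    exact hc.closure_subset_iff.2 hy (hd y)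
  rw [zero_add] at hsum
  rw [← hsum]
  exact inner_self_eq_zero.1 hy0

variable {Z : Type*} [NormedAddCommGroup Z] [InnerProductSpace ℝ Z]

/-- The graph of `e ∘ A ∘ e⁻¹`, where `A` is given by its graph and `e` is an isometry onto. -/
def transportOperator (e : X ≃ₗᵢ[ℝ] Z) (A : Submodule ℝ (X × X)) : Submodule ℝ (Z × Z) where
  carrier := {p | (e.symm p.1, e.symm p.2) ∈ A}
  zero_mem' := by
    change (e.symm (0 : Z), e.symm (0 : Z)) ∈ A
    rw [map_zero]; exact A.zero_mem
  add_mem' := fun {p q} hp hq => by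
    simpa using A.add_mem (x := (e.symm p.1, e.symm p.2)) (y := (e.symm q.1, e.symm q.2)) hp hq
  smul_mem' := fun a p hp => by
    simpa using A.smul_mem a (x := (e.symm p.1, e.symm p.2)) hp

theorem mem_transportOperator (e : X ≃ₗᵢ[ℝ] Z) (A : Submodule ℝ (X × X)) (p : Z × Z) :
    p ∈ transportOperator e A ↔ (e.symm p.1, e.symm p.2) ∈ A := Iff.rfl

/-- For `c > 0`, the operator `-c (e ∘ A ∘ e⁻¹)`, with `A` the operator of a closed densely defined
form, generates a strongly continuous semigroup of symmetric operators. -/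
theorem exists_semigroup_form [CompleteSpace X] [CompleteSpace Y] [CompleteSpace Z]
    {W : Submodule ℝ (WithLp 2 (X × Y))}
    (hW : IsClosed (W : Set (WithLp 2 (X × Y))))
    (hd : Dense {x : X | ∃ y, WithLp.toLp 2 (x, y) ∈ W}) (e : X ≃ₗᵢ[ℝ] Z) {c : ℝ} (hc : 0 < c) :
    ∃ T : C0Semigroup Z, (∀ z y,
      T.GeneratorMapsTo z (-(c • y)) ↔ (z, y) ∈ transportOperator e (formOperator W)) ∧
      ∀ t x y, ⟪T.toFun t x, y⟫_ℝ = ⟪x, T.toFun t y⟫_ℝ := by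
  let B : Submodule ℝ (Z × Z) :=
    (transportOperator e (formOperator W)).comap (LinearMap.id.prodMap (c⁻¹ • LinearMap.id))
  have hB : ∀ p, p ∈ B ↔ (e.symm p.1, c⁻¹ • e.symm p.2) ∈ formOperator W := fun p => by
    rw [← map_smul]; exact Iff.rfl
  obtain ⟨T, hT, hsym⟩ := exists_semigroup B (by
    intro p hp
    have h1 := formOperator_nonneg _ _ ((hB p).1 hp)
    simp only [inner_smul_left, RCLike.conj_to_real, LinearIsometryEquiv.inner_map_map] at h1
    exact nonneg_of_mul_nonneg_right h1 (inv_pos.2 hc)) (by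
    intro ε hε f
    obtain ⟨⟨v, u⟩, hp, hsum⟩ := formOperator_surj hW (ε * c) (by positivity) (e.symm f)
    refine ⟨(e v, c • e u), ?_, ?_⟩
    · rw [hB]
      simpa [smul_smul, inv_mul_cancel₀ hc.ne'] using hp
    · have := congrArg e hsum
      simpa [smul_smul] using this) (by
    have h1 := formOperator_dense hW hd
    have h2 := e.surjective.denseRange.dense_image e.continuous h1
    refine h2.mono ?_
    rintro _ ⟨v, ⟨u, hu⟩, rfl⟩
    refine ⟨c • e u, ?_⟩
    rw [hB]
    simpa [smul_smul, inv_mul_cancel₀ hc.ne'] using hu)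
  refine ⟨T, fun z y => ?_, hsym ?_⟩
  swap
  · intro p hp q hq
    have h1 := formOperator_symm W _ ((hB p).1 hp) _ ((hB q).1 hq)
    simp only [real_inner_smul_left, real_inner_smul_right,
      LinearIsometryEquiv.inner_map_map] at h1
    exact mul_left_cancel₀ (inv_pos.2 hc).ne' h1
  rw [hT, hB, mem_transportOperator]
  simp only [map_smul, smul_smul, inv_mul_cancel₀ hc.ne', one_smul]

/-- On the domain of the operator, with its graph norm, `z ↦ ∇(e⁻¹ z)` is a bounded operator. -/
theorem exists_grad_form (W : Submodule ℝ (WithLp 2 (X × Y))) (e : X ≃ₗᵢ[ℝ] Z) :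
    ∃ D : transportOperator e (formOperator W) →L[ℝ] Y,
      ∀ p : transportOperator e (formOperator W), WithLp.toLp 2 (e.symm p.1.1, D p) ∈ W := by
  have hex : ∀ p : transportOperator e (formOperator W), ∃ G : Y,
      WithLp.toLp 2 (e.symm p.1.1, G) ∈ W ∧
      ∀ r ∈ W, ⟪G, r.snd⟫_ℝ = ⟪e.symm p.1.2, r.fst⟫_ℝ := by
    rintro ⟨p, q, hq, h1, h2⟩
    refine ⟨q.snd, ?_, h2⟩
    have h3 : q.fst = e.symm p.1 := h1
    rw [← h3]; exact hq
  choose G hG hG' using hex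
  have uniq : ∀ (v u : X) (G₁ G₂ : Y), WithLp.toLp 2 (v, G₁) ∈ W →
      WithLp.toLp 2 (v, G₂) ∈ W → (∀ r ∈ W, ⟪G₁, r.snd⟫_ℝ = ⟪u, r.fst⟫_ℝ) →
      (∀ r ∈ W, ⟪G₂, r.snd⟫_ℝ = ⟪u, r.fst⟫_ℝ) → G₁ = G₂ := by
    intro v u G₁ G₂ m₁ m₂ e₁ e₂
    have h1 := e₁ _ (W.sub_mem m₁ m₂)
    have h2 := e₂ _ (W.sub_mem m₁ m₂)
    have h3 : ⟪G₁ - G₂, G₁ - G₂⟫_ℝ = 0 := by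
      rw [inner_sub_left, sub_eq_zero]
      exact h1.trans h2.symm
    exact sub_eq_zero.1 (inner_self_eq_zero.1 h3)
  have hadd : ∀ p q : transportOperator e (formOperator W), G (p + q) = G p + G q := fun p q =>
    uniq (e.symm (p + q).1.1) (e.symm (p + q).1.2) _ _ (hG _)
      (by
        have := W.add_mem (hG p) (hG q)
        rw [← WithLp.toLp_add, Prod.mk_add_mk, ← map_add] at this
        exact this) (hG' _)
      (fun r hr => by
        rw [inner_add_left, hG' p r hr, hG' q r hr, ← inner_add_left, ← map_add]; rfl)
  have hsmul : ∀ (a : ℝ) (p : transportOperator e (formOperator W)), G (a • p) = a • G p :=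
    fun a p =>
    uniq (e.symm (a • p).1.1) (e.symm (a • p).1.2) _ _ (hG _)
      (by
        have := W.smul_mem a (hG p)
        rw [← WithLp.toLp_smul, Prod.smul_mk, ← map_smul] at this
        exact this) (hG' _)
      (fun r hr => by
        rw [inner_smul_left, hG' p r hr, RCLike.conj_to_real, ← real_inner_smul_left, ← map_smul]
        rfl)
  refine ⟨LinearMap.mkContinuous { toFun := G, map_add' := hadd, map_smul' := hsmul } 1 ?_,
    fun p => hG p⟩
  intro p
  have h1 := hG' p _ (hG p)
  rw [WithLp.toLp_snd, WithLp.toLp_fst, real_inner_self_eq_norm_sq,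
    LinearIsometryEquiv.inner_map_map] at h1
  have h2 := real_inner_le_norm p.1.2 p.1.1
  have h3 : ‖p.1.1‖ ≤ ‖p‖ := norm_fst_le p.1
  have h4 : ‖p.1.2‖ ≤ ‖p‖ := norm_snd_le p.1
  have h5 : ‖G p‖ ^ 2 ≤ ‖p‖ ^ 2 := by
    rw [h1]; nlinarith [norm_nonneg p.1.1, norm_nonneg p.1.2, norm_nonneg p]
  rw [one_mul]
  exact le_of_sq_le_sq h5 (norm_nonneg _)

end Form

/-! ### The Fokker-Planck operator, its semigroup, and mild solutions -/

namespace OUParams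
variable {n : ℕ} (S : OUParams n)

/-- `φ(x) = xᵀ Γ x / (2 c)`. -/
def phi (x : EuclideanSpace ℝ (Fin n)) : ℝ :=
  1 / (2 * S.c) * (x.ofLp ⬝ᵥ S.Γ.mulVec x.ofLp)

theorem continuous_phi : Continuous S.phi := by
  have h1 : Continuous fun x : EuclideanSpace ℝ (Fin n) => x.ofLp :=
    PiLp.continuous_ofLp 2 _
  exact continuous_const.mul (h1.dotProduct (continuous_const.matrix_mulVec h1))

theorem continuous_neg_phi : Continuous fun x => -S.phi x := S.continuous_phi.neg

/-- `H = L²(ℝⁿ; e^{-φ})`. -/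
abbrev HSpace : Type := Lp ℝ 2 (expMeasure fun x => -S.phi x)
/-- `Hⁿ = L²(ℝⁿ; e^{-φ})ⁿ`. -/
abbrev HVec : Type := Lp (EuclideanSpace ℝ (Fin n)) 2 (expMeasure fun x => -S.phi x)
/-- The state space `𝔥 = L²(ℝⁿ; e^{φ})`. -/
abbrev StateSpace : Type := Lp ℝ 2 (expMeasure S.phi)
/-- `𝔥ⁿ = L²(ℝⁿ; e^{φ})ⁿ`. -/
abbrev StateVec : Type := Lp (EuclideanSpace ℝ (Fin n)) 2 (expMeasure S.phi)

/-- The bijection `h : H → 𝔥`, `f ↦ e^{-φ} f`. -/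
def h : S.HSpace ≃ₗᵢ[ℝ] S.StateSpace := mulExpNeg ℝ S.phi S.continuous_phi
/-- `f ↦ e^{-φ} f` for vector fields, `Hⁿ → 𝔥ⁿ`. -/
def hVec : S.HVec ≃ₗᵢ[ℝ] S.StateVec :=
  mulExpNeg (EuclideanSpace ℝ (Fin n)) S.phi S.continuous_phi

/-- `V = W^{1,2}(ℝⁿ; e^{-φ})`, as the space of the pairs `(v, ∇v)`. -/
def sobolev : Submodule ℝ (WithLp 2 (S.HSpace × S.HVec)) :=
  sobolevGraph (fun x => -S.phi x) S.continuous_neg_phi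

/-- The graph of the self-adjoint operator `A` in `H` of the form
`a(v₁, v₂) = ∫ ∇v₁ · ∇v₂ e^{-φ} dx` on `V`. -/
def opA : Submodule ℝ (S.HSpace × S.HSpace) := formOperator S.sobolev

/-- The graph of the operator `𝔄 = h ∘ A ∘ h⁻¹` in `𝔥`, for which
`-c 𝔄 z = div (c ∇z + z Γ x)` is the Fokker-Planck operator. -/
def opFA : Submodule ℝ (S.StateSpace × S.StateSpace) := transportOperator S.h S.opA

theorem mem_opFA (p : S.StateSpace × S.StateSpace) :
    p ∈ S.opFA ↔ (S.h.symm p.1, S.h.symm p.2) ∈ S.opA := mem_transportOperator S.h S.opA p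

theorem exists_fpSemigroup : ∃ T : C0Semigroup S.StateSpace,
    (∀ z y, T.GeneratorMapsTo z (-(S.c • y)) ↔ (z, y) ∈ S.opFA) ∧
      ∀ t x y, ⟪T.toFun t x, y⟫_ℝ = ⟪x, T.toFun t y⟫_ℝ :=
  exists_semigroup_form (isClosed_sobolevGraph S.continuous_neg_phi)
    (dense_sobolevGraph S.continuous_neg_phi) S.h S.c_pos

/-- The semigroup `(T(t))_{t ≥ 0}` on `𝔥` that is generated by `-c 𝔄`. -/
def fpSemigroup : C0Semigroup S.StateSpace := S.exists_fpSemigroup.choose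

/-- The generator of `T` is `-c 𝔄`, with the same domain. -/
theorem fpSemigroup_generator (z y : S.StateSpace) :
    S.fpSemigroup.GeneratorMapsTo z (-(S.c • y)) ↔ (z, y) ∈ S.opFA :=
  S.exists_fpSemigroup.choose_spec.1 z y

theorem fpSemigroup_symm (t : ℝ≥0) (x y : S.StateSpace) :
    ⟪S.fpSemigroup.toFun t x, y⟫_ℝ = ⟪x, S.fpSemigroup.toFun t y⟫_ℝ :=
  S.exists_fpSemigroup.choose_spec.2 t x y

/-- `T(t)` maps the domain of `𝔄` into itself and commutes with `𝔄` there. -/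
theorem fpSemigroup_mem (t : ℝ≥0) (p : S.opFA) :
    (S.fpSemigroup.toFun t p.1.1, S.fpSemigroup.toFun t p.1.2) ∈ S.opFA := by
  have h := (S.fpSemigroup_generator p.1.1 p.1.2).2 p.2
  rw [← fpSemigroup_generator, ← map_smul, ← map_neg]
  refine (((S.fpSemigroup.toFun t).continuous.tendsto _).comp h).congr fun s => ?_
  have hst : ∀ x, S.fpSemigroup.toFun s (S.fpSemigroup.toFun t x) =
      S.fpSemigroup.toFun t (S.fpSemigroup.toFun s x) := fun x => by
    have h1 := S.fpSemigroup.map_add s t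
    rw [add_comm, S.fpSemigroup.map_add t s] at h1
    exact (congrArg (fun L : S.StateSpace →L[ℝ] S.StateSpace => L x) h1).symm
  simp only [Function.comp_apply, map_smul, map_sub, hst]

/-- The extrapolation space `𝔥₋₁` of the self-adjoint operator `-c 𝔄`, realized as the dual, with
respect to the pivot space `𝔥`, of the domain of `𝔄` with its graph norm (the domain is represented
by the graph `{(z, 𝔄 z)}`). On `𝔥` the dual norm is equivalent to `‖(1 + c 𝔄)⁻¹ x‖`, and `𝔥` is dense,
so this is the completion of `𝔥` for that norm. -/
abbrev HMinusOne : Type := StrongDual ℝ S.opFA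

/-- The embedding `𝔥 ⊆ 𝔥₋₁`, `x ↦ (z ↦ ⟨x, z⟩)`. -/
def embed (x : S.StateSpace) : S.HMinusOne :=
  (innerSL ℝ x).comp ((ContinuousLinearMap.fst ℝ S.StateSpace S.StateSpace).comp S.opFA.subtypeL)

/-- The restriction of `T(t)` to the domain of `𝔄`. -/
def fpSemigroupDom (t : ℝ≥0) : S.opFA →L[ℝ] S.opFA :=
  (((S.fpSemigroup.toFun t).prodMap (S.fpSemigroup.toFun t)).comp S.opFA.subtypeL).codRestrict
    S.opFA (S.fpSemigroup_mem t)

/-- The extension `T₋₁(t)` of `T(t)` to `𝔥₋₁`. As `T(t)` is self-adjoint, it is the transpose of the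
restriction of `T(t)` to the domain of `𝔄`. -/
def extrapSemigroup (t : ℝ≥0) (ξ : S.HMinusOne) : S.HMinusOne := ξ.comp (S.fpSemigroupDom t)

/-- `T₋₁(t)` extends `T(t)`. -/
theorem extrapSemigroup_embed (t : ℝ≥0) (x : S.StateSpace) :
    S.extrapSemigroup t (S.embed x) = S.embed (S.fpSemigroup.toFun t x) := by
  ext p
  exact (S.fpSemigroup_symm t x p.1.1).symm

theorem exists_grad : ∃ D : S.opFA →L[ℝ] S.HVec,
    ∀ p : S.opFA, WithLp.toLp 2 (S.h.symm p.1.1, D p) ∈ S.sobolev :=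
  exists_grad_form S.sobolev S.h

/-- The operator `z ↦ ∇(e^{φ} z)` from the domain of `𝔄` to `Hⁿ`. -/
def grad : S.opFA →L[ℝ] S.HVec := S.exists_grad.choose

theorem grad_mem (p : S.opFA) : WithLp.toLp 2 (S.h.symm p.1.1, S.grad p) ∈ S.sobolev :=
  S.exists_grad.choose_spec p

/-- The control operator `𝔅₁ : 𝔥ⁿ → 𝔥₋₁`, `v ↦ -div v`, where the divergence is taken in the sense of
the duality with pivot space `𝔥`: the pairing of `-div v` with `z` in the domain of `𝔄` is
`-∫ e^{φ} z div v dx = ∫ v · ∇(e^{φ} z) dx = ⟨e^{φ} v, ∇(e^{φ} z)⟩_{Hⁿ}`. -/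
def negDiv (v : S.StateVec) : S.HMinusOne := (innerSL ℝ (S.hVec.symm v)).comp S.grad

/-- `F(v, u) = v g(u)`: the field `x ↦ v(x) w` for the constant vector `w = g(u)`. -/
def flux (w : EuclideanSpace ℝ (Fin n)) (v : S.StateSpace) : S.StateVec :=
  (ContinuousLinearMap.toSpanSingleton ℝ w).compLp v

/-- Mild solution on `[0, t₁]` of `p' = -c 𝔄 p - div (g(u) p) + d`, `p(0) = p₀`: a continuous
`p : [0, t₁] → 𝔥` with
`p(t) = T(t) p₀ + ∫₀ᵗ T₋₁(t - s) (𝔅₁ F(p(s), u(s)) + d(s)) ds` for all `t ∈ [0, t₁]`,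
where the integral is the Bochner integral in `𝔥₋₁` and the identity is one in `𝔥₋₁`
(into which `𝔥` is embedded). -/
def IsMildSolutionOn (g : EuclideanSpace ℝ (Fin n) → EuclideanSpace ℝ (Fin n))
    (u : ℝ → EuclideanSpace ℝ (Fin n)) (d : ℝ → S.StateSpace) (p₀ : S.StateSpace) (t₁ : ℝ)
    (p : ℝ → S.StateSpace) : Prop :=
  ContinuousOn p (Icc 0 t₁) ∧
  ∀ t ∈ Icc (0 : ℝ) t₁, S.embed (p t) = S.embed (S.fpSemigroup.toFun t.toNNReal p₀) +
    ∫ s in (0 : ℝ)..t, S.extrapSemigroup (t - s).toNNReal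
      (S.negDiv (S.flux (g (u s)) (p s)) + S.embed (d s))

/-- Mild solution on `[0, ∞)`: its restriction to every `[0, t₁]` is a mild solution there. -/
def IsMildSolution (g : EuclideanSpace ℝ (Fin n) → EuclideanSpace ℝ (Fin n))
    (u : ℝ → EuclideanSpace ℝ (Fin n)) (d : ℝ → S.StateSpace) (p₀ : S.StateSpace)
    (p : ℝ → S.StateSpace) : Prop :=
  ∀ t₁ : ℝ, 0 < t₁ → S.IsMildSolutionOn g u d p₀ t₁ p

end OUParams

/-- The standing assumptions on the input nonlinearity `g`: it is `C¹`, linearly bounded, and has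
the high-gain property `sup_{s ∈ ℝ} min_{δ ≤ ‖v‖ ≤ 1} vᵀ g(-s v) = ∞` for some `δ ∈ (0,1)`. -/
structure IsAdmissibleDrift {n : ℕ}
    (g : EuclideanSpace ℝ (Fin n) → EuclideanSpace ℝ (Fin n)) : Prop where
  contDiff : ContDiff ℝ 1 g
  linear_bound : ∃ C : ℝ, 0 < C ∧ ∀ v, ‖g v‖ ≤ C * ‖v‖
  high_gain : ∃ δ : ℝ, 0 < δ ∧ δ < 1 ∧ ∀ M : ℝ, ∃ s : ℝ,
    ∀ v : EuclideanSpace ℝ (Fin n), δ ≤ ‖v‖ → ‖v‖ ≤ 1 → M ≤ ⟪v, g (-(s • v))⟫_ℝ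

/-- The mean value `y = ∫ x f(x) dx`. -/
def meanValue {n : ℕ} (f : EuclideanSpace ℝ (Fin n) → ℝ) (i : Fin n) : ℝ := ∫ x, x i * f x

/-- The covariance matrix `∫ (x - y) (x - y)ᵀ f(x) dx` with `y = ∫ x f(x) dx`. -/
def covMatrix {n : ℕ} (f : EuclideanSpace ℝ (Fin n) → ℝ) : Matrix (Fin n) (Fin n) ℝ :=
  Matrix.of fun i j => ∫ x, (x i - meanValue f i) * (x j - meanValue f j) * f x

/-- All the integrals that enter `meanValue f` and `covMatrix f` converge absolutely. -/
def HasSecondMoments {n : ℕ} (f : EuclideanSpace ℝ (Fin n) → ℝ) : Prop :=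
  Integrable f ∧ (∀ i, Integrable fun x => x i * f x) ∧
  ∀ i j, Integrable fun x => (x i - meanValue f i) * (x j - meanValue f j) * f x

/-- `V = [v₁, …, vₙ]`, the matrix with the vectors `v₁, …, vₙ` as columns. -/
def eigenvectorMatrix {n : ℕ}
    (v : OrthonormalBasis (Fin n) ℝ (EuclideanSpace ℝ (Fin n))) : Matrix (Fin n) (Fin n) ℝ :=
  Matrix.of fun i k => v k i

/-- `Λ = diag(λ₁, …, λₙ)`. -/
def lambdaMatrix {n : ℕ} (lam : Fin n → ℝ) : Matrix (Fin n) (Fin n) ℝ := Matrix.diagonal lam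

/-- `R = diag(√(λ₁/2), …, √(λₙ/2))`. -/
def rMatrix {n : ℕ} (lam : Fin n → ℝ) : Matrix (Fin n) (Fin n) ℝ :=
  Matrix.diagonal fun k => √(lam k / 2)

end

end FokkerPlanck

/-! ### Orbits of a strongly continuous semigroup -/

namespace FokkerPlanck

/-! Everything follows by testing the mild equation with explicit solutions of the drift-free dual
equation. The weights of the two spaces cancel: for `z = e^{-φ} w` the inner product `⟨p, z⟩` of `𝔥`
is `∫ p w dx`, and `𝔄 z = e^{-φ} A w` with `A w = -Δw + ∇φ · ∇w`. As `T(t)` is symmetric, the mild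
equation paired with `e^{-φ} w(0)` becomes `∫ p(t) w(0) = ∫ p₀ w(t) + ∫₀ᵗ ∫ p(s) g(u(s)) · ∇w(t-s)
dx ds` whenever `w' = -c A w` (`IsMildSolutionOn.integral_mul_eq`). The semigroup need not be
computed: accretivity of `𝔄` makes any explicit solution curve of the dual equation its orbit
(`C0Semigroup.eq_of_hasDerivAt`). The admissible `w` are functions of temperate growth, all of which
lie in `L²(e^{-φ})` because `φ` is a positive definite quadratic form.

Moments come from the Hermite polynomials of degree at most two, which are eigenfunctions of `A`.
The constant has gradient zero, which gives conservation of mass. In an eigenbasis, the first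
moments `m_k` satisfy linear equations with the input `γ_k = g(u) · v_k`, and the second moments see
the input `γ_k m_l + γ_l m_k`. Since `g(u)` does not depend on `x`, this is just the input of the
product `m_k m_l`, so that it cancels in the covariance (`secondMoment_sub_mul_eq`). What remains is
the decay of the deviation from `Λ⁻¹` with the factor `e^{-c(λ_k + λ_l)t}`, and hence the formula,
the limit and the rate.

Nonnegativity comes from the Fourier transform. The waves `cos(ξ · x + θ)` have the explicit orbits
`e^{-q_t(ξ)/2} cos(e^{-Γt}ξ · x + θ)` (Mehler's formula, `hasDerivAt_mehler`). The drift only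
rotates the pair of phases `0` and `-π/2`. Solving this rotation shows that the transform of `p(t)`
at `ξ` is a phase, linear in `ξ`, times `e^{-q_t(ξ)/2}` times the transform of `p₀` at `e^{-Γt}ξ`.
For `p₀ ≥ 0` this is the characteristic function of a finite measure: the image of `p₀` under
`e^{-Γt}`, convolved with a Gaussian and translated. Uniqueness of characteristic functions then
forces `p(t) ≥ 0` (`ae_nonneg_of_charFun_eq`). -/

theorem C0Semigroup.GeneratorMapsTo.hasDerivWithinAt_orbit {X : Type*} [NormedAddCommGroup X]
    [NormedSpace ℝ X] {T : C0Semigroup X} {z w : X} {t : ℝ} (ht : 0 ≤ t)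
    (h : T.GeneratorMapsTo (T.toFun t.toNNReal z) w) :
    HasDerivWithinAt (fun s : ℝ => T.toFun s.toNNReal z) w (Ici t) t := by
  rw [hasDerivWithinAt_iff_tendsto_slope, Ici_sdiff_left]
  have h1 : Tendsto (fun s : ℝ => (s - t).toNNReal) (𝓝[>] t) (𝓝[>] 0) := by
    refine tendsto_nhdsWithin_iff.2 ⟨?_, ?_⟩
    · have : Continuous fun s : ℝ => (s - t).toNNReal := by fun_prop
      simpa using (this.tendsto t).mono_left nhdsWithin_le_nhds
    · filter_upwards [self_mem_nhdsWithin] with s hs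
      exact Real.toNNReal_pos.2 (sub_pos.2 hs)
  refine (h.comp h1).congr' ?_
  filter_upwards [self_mem_nhdsWithin] with s hs
  have hs' : 0 ≤ s - t := sub_nonneg.2 (le_of_lt hs)
  have h2 : s.toNNReal = (s - t).toNNReal + t.toNNReal := by
    rw [← Real.toNNReal_add hs' ht, sub_add_cancel]
  rw [slope_def_module, Function.comp_apply, Real.coe_toNNReal _ hs', h2, T.map_add,
    ContinuousLinearMap.comp_apply]

/-- Uniform boundedness principle: each orbit is continuous, hence bounded on the compact interval
`[0, b]`. A bound on bounded time intervals is all that the continuity of the transposed semigroup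
requires. -/
theorem C0Semigroup.exists_norm_le {X : Type*} [NormedAddCommGroup X] [NormedSpace ℝ X]
    [CompleteSpace X] (T : C0Semigroup X) (b : ℝ≥0) :
    ∃ C : ℝ, 0 ≤ C ∧ ∀ t ≤ b, ∀ x, ‖T.toFun t x‖ ≤ C * ‖x‖ := by
  obtain ⟨C, hC⟩ := banach_steinhaus (g := fun t : Icc (0 : ℝ≥0) b => T.toFun t) (by
    intro x
    obtain ⟨C, hC⟩ := (isCompact_Icc (a := (0 : ℝ≥0)) (b := b)).exists_bound_of_continuousOn
      (T.continuous_orbit x).continuousOn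
    exact ⟨C, fun t => hC t t.2⟩)
  refine ⟨C, (norm_nonneg _).trans (hC ⟨0, le_rfl, zero_le⟩), fun t ht x => ?_⟩
  exact (T.toFun t).le_of_opNorm_le (hC ⟨t, zero_le, ht⟩) x

/-- Uniqueness of the solution of `z' = -c A z`, with `A` accretive, which is an orbit of the
semigroup generated by `-c A`. -/
theorem C0Semigroup.eq_of_hasDerivAt {X : Type*} [NormedAddCommGroup X] [InnerProductSpace ℝ X]
    (T : C0Semigroup X) (A : Submodule ℝ (X × X)) {c : ℝ} (hc : 0 ≤ c)
    (acc : ∀ p ∈ A, 0 ≤ ⟪p.2, p.1⟫_ℝ)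
    (gen : ∀ p ∈ A, T.GeneratorMapsTo p.1 (-(c • p.2)) ∧
      ∀ t, (T.toFun t p.1, T.toFun t p.2) ∈ A)
    {z y : ℝ → X} (hz : ∀ t, HasDerivAt z (-(c • y t)) t) (hzy : ∀ t, (z t, y t) ∈ A)
    {t : ℝ} (ht : 0 ≤ t) : T.toFun t.toNNReal (z 0) = z t := by
  set d : ℝ → X := fun s => T.toFun s.toNNReal (z 0) - z s with hd
  set d' : ℝ → X := fun s => -(c • (T.toFun s.toNNReal (y 0) - y s)) with hd'
  have hmem : ∀ s, (d s, T.toFun s.toNNReal (y 0) - y s) ∈ A := fun s =>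
    A.sub_mem ((gen _ (hzy 0)).2 s.toNNReal) (hzy s)
  have hderiv : ∀ s, 0 ≤ s → HasDerivWithinAt d (d' s) (Ici s) s := by
    intro s hs
    have h1 := C0Semigroup.GeneratorMapsTo.hasDerivWithinAt_orbit hs
      (gen _ ((gen _ (hzy 0)).2 s.toNNReal)).1
    refine (h1.sub (hz s).hasDerivWithinAt).congr_deriv ?_
    simp only [hd', smul_sub]
    abel
  have hcont : Continuous fun s => ‖d s‖ ^ 2 := by
    have h1 : Continuous z := continuous_iff_continuousAt.2 fun s => (hz s).continuousAt
    have h2 : Continuous fun s : ℝ => T.toFun s.toNNReal (z 0) :=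
      (T.continuous_orbit (z 0)).comp continuous_real_toNNReal
    exact (h2.sub h1).norm.pow 2
  have h0 : ‖d 0‖ ^ 2 ≤ 0 := by
    simp [hd, T.map_zero]
  -- Energy estimate: `‖d‖²` starts at zero and has the right derivative `-2c ⟨A d, d⟩ ≤ 0`.
  -- One-sided derivatives suffice, and the definition of the generator yields nothing more
  -- directly.
  have hle := image_le_of_deriv_right_le_deriv_boundary (f := fun s => ‖d s‖ ^ 2)
    (f' := fun s => 2 * ⟪d s, d' s⟫_ℝ) (a := 0) (b := t) (B := fun _ => 0) (B' := fun _ => 0)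
    hcont.continuousOn (fun s hs => (hderiv s hs.1).norm_sq) h0 continuousOn_const
    (fun s _ => hasDerivWithinAt_const _ _ _) (fun s _ => by
      have h1 := mul_nonneg hc (acc _ (hmem s))
      simp only [hd', inner_neg_right, inner_smul_right]
      rw [real_inner_comm]
      simp only at h1
      linarith) ⟨ht, le_rfl⟩
  have h3 : d t = 0 := norm_eq_zero.1 (pow_eq_zero_iff (two_ne_zero)|>.1
    (le_antisymm hle (by positivity)))
  exact sub_eq_zero.1 h3

/-! ### The transposed semigroup on the dual of the graph -/

section Extrapolation
variable {X Y : Type*} [NormedAddCommGroup X] [InnerProductSpace ℝ X] [NormedAddCommGroup Y]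
  [InnerProductSpace ℝ Y]

/-- Every functional on a space of pairs is of the form `(z, y) ↦ ⟨a, z⟩ + ⟨b, y⟩`. -/
theorem exists_inner_add_inner_repr [CompleteSpace X] (D : Submodule ℝ (X × X)) (ξ : StrongDual ℝ D) :
    ∃ a b : X, ∀ p : D, ξ p = ⟪a, p.1.1⟫_ℝ + ⟪b, p.1.2⟫_ℝ := by
  -- Hahn-Banach extends the functional to `X × X`. The product carries the sup norm and is no
  -- Hilbert space, so Riesz is applied to each factor.
  obtain ⟨Ξ, hΞ, -⟩ := exists_extension_norm_eq D ξ
  refine ⟨(InnerProductSpace.toDual ℝ _).symm (Ξ.comp (ContinuousLinearMap.inl ℝ X X)),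
    (InnerProductSpace.toDual ℝ _).symm (Ξ.comp (ContinuousLinearMap.inr ℝ X X)), fun p => ?_⟩
  rw [InnerProductSpace.toDual_symm_apply, InnerProductSpace.toDual_symm_apply, ← hΞ]
  simp only [ContinuousLinearMap.comp_apply, ContinuousLinearMap.inl_apply,
    ContinuousLinearMap.inr_apply, ← map_add, Prod.mk_add_mk, add_zero, zero_add, Prod.mk.eta]

variable {N : Type*} [NormedAddCommGroup N] [NormedSpace ℝ N] {j : N →ₗᵢ[ℝ] X × X}
  {T : C0Semigroup X} {TD : ℝ≥0 → N →L[ℝ] N}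

/-- The transpose of a symmetric semigroup, restricted to a space of pairs, is strongly
continuous. -/
theorem continuous_comp_semigroup (hsymm : ∀ t x y, ⟪T.toFun t x, y⟫_ℝ = ⟪x, T.toFun t y⟫_ℝ)
    (hTD : ∀ t p, j (TD t p) = (T.toFun t (j p).1, T.toFun t (j p).2))
    (hrep : ∀ ξ : StrongDual ℝ N, ∃ a b : X, ∀ p, ξ p = ⟪a, (j p).1⟫_ℝ + ⟪b, (j p).2⟫_ℝ) (ξ : StrongDual ℝ N) :
    Continuous fun t => ξ.comp (TD t) := by
  obtain ⟨a, b, hab⟩ := hrep ξ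
  -- Symmetry moves `T` onto the two representing vectors, so that continuity in the dual norm
  -- reduces to that of two orbits in `X`.
  have hle : ∀ s t, ‖ξ.comp (TD s) - ξ.comp (TD t)‖ ≤
      ‖T.toFun s a - T.toFun t a‖ + ‖T.toFun s b - T.toFun t b‖ := by
    intro s t
    refine ContinuousLinearMap.opNorm_le_bound _ (by positivity) fun p => ?_
    have h1 : (ξ.comp (TD s) - ξ.comp (TD t)) p =
        ⟪T.toFun s a - T.toFun t a, (j p).1⟫_ℝ + ⟪T.toFun s b - T.toFun t b, (j p).2⟫_ℝ := by
      have h2 : ∀ r, ξ.comp (TD r) p =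
          ⟪T.toFun r a, (j p).1⟫_ℝ + ⟪T.toFun r b, (j p).2⟫_ℝ := by
        intro r
        rw [hsymm, hsymm, ContinuousLinearMap.comp_apply, hab, hTD]
      rw [sub_apply, h2, h2, inner_sub_left, inner_sub_left]
      ring
    rw [h1, add_mul]
    refine (norm_add_le _ _).trans (add_le_add ?_ ?_)
    · exact (norm_inner_le_norm _ _).trans
        (mul_le_mul_of_nonneg_left ((norm_fst_le (j p)).trans_eq (j.norm_map p)) (norm_nonneg _))
    · exact (norm_inner_le_norm _ _).trans
        (mul_le_mul_of_nonneg_left ((norm_snd_le (j p)).trans_eq (j.norm_map p)) (norm_nonneg _))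
  refine continuous_iff_continuousAt.2 fun t => ?_
  rw [ContinuousAt, tendsto_iff_norm_sub_tendsto_zero]
  refine squeeze_zero (fun _ => norm_nonneg _) (fun s => hle s t) ?_
  have h1 := tendsto_iff_norm_sub_tendsto_zero.1 ((T.continuous_orbit a).tendsto t)
  have h2 := tendsto_iff_norm_sub_tendsto_zero.1 ((T.continuous_orbit b).tendsto t)
  simpa using h1.add h2

/-- The increment splits into `(ξ s - ξ s₀) ∘ TD (t - s)`, small by the bound of `T` on `[0, t]`,
and the increment for the fixed functional `ξ s₀`, small by strong continuity. This makes the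
integrand of the mild equation Bochner integrable, without which its integral could not be evaluated
at an element of the domain. -/
theorem continuousOn_comp_semigroup [CompleteSpace X]
    (hsymm : ∀ t x y, ⟪T.toFun t x, y⟫_ℝ = ⟪x, T.toFun t y⟫_ℝ)
    (hTD : ∀ t p, j (TD t p) = (T.toFun t (j p).1, T.toFun t (j p).2))
    (hrep : ∀ ξ : StrongDual ℝ N, ∃ a b : X, ∀ p, ξ p = ⟪a, (j p).1⟫_ℝ + ⟪b, (j p).2⟫_ℝ)
    {ξ : ℝ → StrongDual ℝ N} {t : ℝ} (hξ : ContinuousOn ξ (Icc 0 t)) :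
    ContinuousOn (fun s => (ξ s).comp (TD (t - s).toNNReal)) (Icc 0 t) := by
  obtain ⟨C, hC0, hC⟩ := T.exists_norm_le t.toNNReal
  have hnorm : ∀ r ≤ t.toNNReal, ∀ ζ : StrongDual ℝ N, ‖ζ.comp (TD r)‖ ≤ C * ‖ζ‖ := by
    intro r hr ζ
    refine ContinuousLinearMap.opNorm_le_bound _ (by positivity) fun p => ?_
    have h1 : ‖TD r p‖ ≤ C * ‖p‖ := by
      rw [← j.norm_map, hTD]
      refine max_le ?_ ?_
      · exact (hC r hr _).trans (mul_le_mul_of_nonneg_left ((norm_fst_le (j p)).trans_eq (j.norm_map p)) hC0)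
      · exact (hC r hr _).trans (mul_le_mul_of_nonneg_left ((norm_snd_le (j p)).trans_eq (j.norm_map p)) hC0)
    have h2 := ζ.le_of_opNorm_le_of_le le_rfl h1
    refine h2.trans_eq (by ring)
  intro s₀ hs₀
  rw [ContinuousWithinAt, tendsto_iff_norm_sub_tendsto_zero]
  have h1 : Tendsto (fun s => C * ‖ξ s - ξ s₀‖ + ‖(ξ s₀).comp (TD (t - s).toNNReal) -
      (ξ s₀).comp (TD (t - s₀).toNNReal)‖) (𝓝[Icc 0 t] s₀) (𝓝 (C * 0 + 0)) := by
    refine ((tendsto_iff_norm_sub_tendsto_zero.1 (hξ s₀ hs₀)).const_mul C).add ?_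
    refine tendsto_iff_norm_sub_tendsto_zero.1 ?_
    have h2 : Continuous fun s : ℝ => (ξ s₀).comp (TD (t - s).toNNReal) :=
      (continuous_comp_semigroup hsymm hTD hrep (ξ s₀)).comp
        (continuous_real_toNNReal.comp (continuous_const.sub continuous_id))
    exact (h2.tendsto s₀).mono_left nhdsWithin_le_nhds
  rw [mul_zero, add_zero] at h1
  refine squeeze_zero' (Eventually.of_forall fun _ => norm_nonneg _) ?_ h1
  filter_upwards [self_mem_nhdsWithin] with s hs
  have h3 : (ξ s).comp (TD (t - s).toNNReal) =
      (ξ s - ξ s₀).comp (TD (t - s).toNNReal) + (ξ s₀).comp (TD (t - s).toNNReal) := by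
    ext p
    simp
  rw [h3, add_sub_assoc]
  refine (norm_add_le _ _).trans (add_le_add_left (hnorm _ ?_ _) _)
  exact Real.toNNReal_le_toNNReal (by linarith [hs.1])

/-- The variation of constants integral of a control operator `v ↦ (z ↦ ⟨v, ∇z⟩)`, evaluated. -/
theorem integral_control_apply [CompleteSpace X]
    (hsymm : ∀ t x y, ⟪T.toFun t x, y⟫_ℝ = ⟪x, T.toFun t y⟫_ℝ)
    (hTD : ∀ t p, j (TD t p) = (T.toFun t (j p).1, T.toFun t (j p).2))
    (hrep : ∀ ξ : StrongDual ℝ N, ∃ a b : X, ∀ p, ξ p = ⟪a, (j p).1⟫_ℝ + ⟪b, (j p).2⟫_ℝ) (B : N →L[ℝ] Y)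
    {v : ℝ → Y} {t : ℝ} (ht : 0 ≤ t) (hv : ContinuousOn v (Icc 0 t)) (z : N) :
    (∫ s in (0 : ℝ)..t, ((innerSL ℝ (v s)).comp B).comp (TD (t - s).toNNReal)) z =
      ∫ s in (0 : ℝ)..t, ⟪v s, B (TD (t - s).toNNReal z)⟫_ℝ := by
  have h1 : ContinuousOn (fun s => (innerSL ℝ (v s)).comp B) (Icc 0 t) :=
    ((innerSL ℝ).continuous.comp_continuousOn hv).clm_comp continuousOn_const
  rw [ContinuousLinearMap.intervalIntegral_apply
    ((continuousOn_comp_semigroup hsymm hTD hrep h1).intervalIntegrable_of_Icc (μ := volume) ht)]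
  rfl

end Extrapolation

/-! ### Testing the mild equation with a known orbit -/

namespace OUParams
variable {n : ℕ} (S : OUParams n)

theorem opFA_nonneg (p : S.StateSpace × S.StateSpace) (hp : p ∈ S.opFA) : 0 ≤ ⟪p.2, p.1⟫_ℝ := by
  have h := formOperator_nonneg S.sobolev _ ((S.mem_opFA p).1 hp)
  simpa only [LinearIsometryEquiv.inner_map_map] using h

/-- Uniqueness of the solution of `z' = -c 𝔄 z`, which is the orbit of the semigroup. -/
theorem fpSemigroup_eq_of_hasDerivAt {z y : ℝ → S.StateSpace}
    (hz : ∀ t, HasDerivAt z (-(S.c • y t)) t) (hzy : ∀ t, (z t, y t) ∈ S.opFA)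
    {t : ℝ} (ht : 0 ≤ t) : S.fpSemigroup.toFun t.toNNReal (z 0) = z t := by
  refine C0Semigroup.eq_of_hasDerivAt S.fpSemigroup S.opFA S.c_pos.le S.opFA_nonneg
    (fun p hp => ?_) hz hzy ht
  refine ⟨(S.fpSemigroup_generator _ _).2 hp, fun t => S.fpSemigroup_mem t ⟨p, hp⟩⟩

/-- The difference of each pair of components integrates to zero against all test functions, so the
fundamental lemma of the calculus of variations applies. -/
theorem weakGradient_unique {f : EuclideanSpace ℝ (Fin n) → ℝ}
    {G₁ G₂ : EuclideanSpace ℝ (Fin n) → EuclideanSpace ℝ (Fin n)}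
    (h₁ : IsWeakGradient f G₁) (h₂ : IsWeakGradient f G₂) : G₁ =ᵐ[volume] G₂ := by
  have hi : ∀ i : Fin n, ∀ᵐ x, G₁ x i - G₂ x i = 0 := by
    intro i
    have hl : ∀ G : EuclideanSpace ℝ (Fin n) → EuclideanSpace ℝ (Fin n), LocallyIntegrable G →
        LocallyIntegrable fun x => G x i := fun G hG x => by
      obtain ⟨s, hs, h⟩ := hG x
      exact ⟨s, hs, (EuclideanSpace.proj (𝕜 := ℝ) i).integrable_comp h⟩
    refine ae_eq_zero_of_integral_contDiff_smul_eq_zero ((hl _ h₁.2.1).sub (hl _ h₂.2.1)) ?_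
    intro ψ hψ hψ'
    have e₁ := h₁.2.2 ψ hψ hψ' i
    have e₂ := h₂.2.2 ψ hψ hψ' i
    have i₁ := (hl _ h₁.2.1).integrable_smul_left_of_hasCompactSupport hψ.continuous hψ'
    have i₂ := (hl _ h₂.2.1).integrable_smul_left_of_hasCompactSupport hψ.continuous hψ'
    simp only [smul_sub]
    rw [integral_sub i₁ i₂]
    simp only [smul_eq_mul, mul_comm (ψ _)]
    linarith
  filter_upwards [ae_all_iff.2 hi] with x hx
  ext i
  exact sub_eq_zero.1 (hx i)

/-- `grad` is obtained by choice. Uniqueness of weak gradients makes it computable from any explicit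
candidate. -/
theorem grad_eq {p : S.opFA} {G : S.HVec}
    (h : WithLp.toLp 2 (S.h.symm p.1.1, G) ∈ S.sobolev) : S.grad p = G := by
  apply Lp.ext
  have h1 := weakGradient_unique (S.grad_mem p) h
  exact (expMeasure_ac S.continuous_neg_phi).1.ae_le h1

/-- Separates the vector from the density: joint continuity of the flux then reduces to finitely
many products of a continuous scalar and a fixed bounded operator applied to the density. -/
theorem flux_eq_sum (w : EuclideanSpace ℝ (Fin n)) (f : S.StateSpace) :
    S.flux w f = ∑ i : Fin n, (w i) • S.flux (EuclideanSpace.single i 1) f := by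
  apply Lp.ext
  refine EventuallyEq.trans
    (ContinuousLinearMap.coeFn_compLp (ContinuousLinearMap.toSpanSingleton ℝ w) f) ?_
  refine EventuallyEq.trans ?_ (Lp.coeFn_fun_finsetSum _ _).symm
  have h1 : ∀ i : Fin n, ∀ᵐ x ∂(expMeasure S.phi),
      (w i • S.flux (EuclideanSpace.single i 1) f : S.StateVec) x =
        w i • f x • EuclideanSpace.single i (1 : ℝ) := fun i => by
    filter_upwards [Lp.coeFn_smul (w i) (S.flux (EuclideanSpace.single i 1) f),
      ContinuousLinearMap.coeFn_compLp
        (ContinuousLinearMap.toSpanSingleton ℝ (EuclideanSpace.single i (1 : ℝ))) f] with x h h'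
    rw [h, Pi.smul_apply, flux, h', ContinuousLinearMap.toSpanSingleton_apply]
  filter_upwards [ae_all_iff.2 h1] with x hx
  simp only [hx]
  rw [ContinuousLinearMap.toSpanSingleton_apply]
  ext j
  simp [mul_comm, Pi.single_apply]

theorem continuousOn_flux {w : ℝ → EuclideanSpace ℝ (Fin n)} {f : ℝ → S.StateSpace} {s : Set ℝ}
    (hw : ContinuousOn w s) (hf : ContinuousOn f s) :
    ContinuousOn (fun r => S.hVec.symm (S.flux (w r) (f r))) s := by
  simp only [S.flux_eq_sum (w _)]
  refine S.hVec.symm.continuous.comp_continuousOn (continuousOn_finsetSum _ fun i _ => ?_)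
  have h1 : ContinuousOn (fun r => w r i) s :=
    (EuclideanSpace.proj (𝕜 := ℝ) i).continuous.comp_continuousOn hw
  have h2 : ContinuousOn (fun r => S.flux (EuclideanSpace.single i 1) (f r)) s :=
    ((ContinuousLinearMap.toSpanSingleton ℝ
      (EuclideanSpace.single i (1 : ℝ))).compLpL 2 (expMeasure S.phi)).continuous.comp_continuousOn hf
  exact h1.smul h2

theorem integral_extrapSemigroup_apply {v : ℝ → S.StateVec} {t : ℝ} (ht : 0 ≤ t)
    (hv : ContinuousOn (fun s => S.hVec.symm (v s)) (Icc 0 t)) (z : S.opFA) :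
    (∫ s in (0 : ℝ)..t, S.extrapSemigroup (t - s).toNNReal (S.negDiv (v s))) z =
      ∫ s in (0 : ℝ)..t, ⟪S.hVec.symm (v s), S.grad (S.fpSemigroupDom (t - s).toNNReal z)⟫_ℝ :=
  integral_control_apply (N := S.opFA) (j := S.opFA.subtypeₗᵢ) S.fpSemigroup_symm
    (TD := S.fpSemigroupDom) (fun _ _ => rfl) (exists_inner_add_inner_repr S.opFA) S.grad ht hv z

theorem embed_zero : S.embed 0 = 0 := by ext q; simp [embed]

/-- The mild equation, tested with an element of the domain of `𝔄` whose orbit is known. -/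
theorem IsMildSolutionOn.test {S : OUParams n} {g : EuclideanSpace ℝ (Fin n) → EuclideanSpace ℝ (Fin n)}
    {u : ℝ → EuclideanSpace ℝ (Fin n)} {p₀ : S.StateSpace} {t₁ : ℝ} {p : ℝ → S.StateSpace}
    (hp : S.IsMildSolutionOn g u (fun _ => 0) p₀ t₁ p) (hg : Continuous g)
    (hu : ContinuousOn u (Ici 0)) {z y : ℝ → S.StateSpace} {G : ℝ → S.HVec}
    (hz : ∀ t, HasDerivAt z (-(S.c • y t)) t) (hzy : ∀ t, (z t, y t) ∈ S.opFA)
    (hG : ∀ t, WithLp.toLp 2 (S.h.symm (z t), G t) ∈ S.sobolev) {t : ℝ} (ht : t ∈ Icc 0 t₁) :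
    ⟪p t, z 0⟫_ℝ = ⟪p₀, z t⟫_ℝ +
      ∫ s in (0 : ℝ)..t, ⟪S.hVec.symm (S.flux (g (u s)) (p s)), G (t - s)⟫_ℝ := by
  have hv := S.continuousOn_flux (hg.comp_continuousOn (hu.mono fun s (hs : s ∈ Icc 0 t) => hs.1))
    (hp.1.mono (Icc_subset_Icc_right ht.2))
  have hint := S.integral_extrapSemigroup_apply ht.1 hv ⟨(z 0, y 0), hzy 0⟩
  have h0 := hp.2 t ht
  simp only [embed_zero, add_zero] at h0
  have h1 := congrArg (fun ξ : S.HMinusOne => ξ ⟨(z 0, y 0), hzy 0⟩) h0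
  simp only [add_apply] at h1
  have e1 : S.embed (p t) ⟨(z 0, y 0), hzy 0⟩ = ⟪p t, z 0⟫_ℝ := rfl
  -- By symmetry `T(t)` passes from `p₀` to `z 0`, whose orbit is `z` by uniqueness.
  have e2 : S.embed (S.fpSemigroup.toFun t.toNNReal p₀) ⟨(z 0, y 0), hzy 0⟩ = ⟪p₀, z t⟫_ℝ := by
    have : S.embed (S.fpSemigroup.toFun t.toNNReal p₀) ⟨(z 0, y 0), hzy 0⟩ =
      ⟪S.fpSemigroup.toFun t.toNNReal p₀, z 0⟫_ℝ := rfl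
    rw [this, S.fpSemigroup_symm, S.fpSemigroup_eq_of_hasDerivAt hz hzy ht.1]
  rw [e1, e2] at h1
  rw [h1]
  congr 1
  refine hint.trans ?_
  refine intervalIntegral.integral_congr fun s hs => ?_
  rw [uIcc_of_le ht.1] at hs
  -- The same uniqueness identifies the orbit in the drift term, at time `t - s`, and uniqueness of
  -- weak gradients then yields its gradient.
  have e4 : S.grad (S.fpSemigroupDom (t - s).toNNReal ⟨(z 0, y 0), hzy 0⟩) = G (t - s) := by
    apply S.grad_eq
    have : (S.fpSemigroupDom (t - s).toNNReal ⟨(z 0, y 0), hzy 0⟩).1.1 = z (t - s) :=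
      S.fpSemigroup_eq_of_hasDerivAt hz hzy (sub_nonneg.2 hs.2)
    rw [this]
    exact hG (t - s)
  simp only [e4]
  rfl

end OUParams
end FokkerPlanck

/-! ### Functions of temperate growth and the Gaussian weight -/

namespace FokkerPlanck

section Growth
variable {E F : Type*} [NormedAddCommGroup E] [NormedSpace ℝ E]
  [NormedAddCommGroup F] [NormedSpace ℝ F]

theorem hasTemperateGrowth_fderiv {f : E → F} (hf : f.HasTemperateGrowth) :
    (fderiv ℝ f).HasTemperateGrowth := by
  refine ⟨hf.1.fderiv_right (by simp), fun n => ?_⟩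
  obtain ⟨k, C, h⟩ := hf.2 (n + 1)
  exact ⟨k, C, fun x => by rw [norm_iteratedFDeriv_fderiv]; exact h x⟩

theorem hasTemperateGrowth_fderiv_apply {f : E → F} (hf : f.HasTemperateGrowth) (a : E) :
    (fun x => fderiv ℝ f x a).HasTemperateGrowth :=
  (ContinuousLinearMap.apply ℝ F a).hasTemperateGrowth.comp (hasTemperateGrowth_fderiv hf)

theorem hasTemperateGrowth_cos : Real.cos.HasTemperateGrowth := by
  refine ⟨Real.contDiff_cos, fun n => ⟨0, 1, fun x => ?_⟩⟩
  rw [norm_iteratedFDeriv_eq_norm_iteratedDeriv]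
  simpa using Real.abs_iteratedDeriv_cos_le_one n x

theorem hasTemperateGrowth_sin : Real.sin.HasTemperateGrowth := by
  refine ⟨Real.contDiff_sin, fun n => ⟨0, 1, fun x => ?_⟩⟩
  rw [norm_iteratedFDeriv_eq_norm_iteratedDeriv]
  simpa using Real.abs_iteratedDeriv_sin_le_one n x

end Growth

section Weighted
variable {n : ℕ} {F : Type*} [NormedAddCommGroup F]

theorem integral_expMeasure [NormedSpace ℝ F] {a : EuclideanSpace ℝ (Fin n) → ℝ}
    (ha : Continuous a) (f : EuclideanSpace ℝ (Fin n) → F) :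
    ∫ x, f x ∂(expMeasure a) = ∫ x, Real.exp (a x) • f x := by
  unfold expMeasure
  rw [integral_withDensity_eq_integral_toReal_smul (by fun_prop)
    (Eventually.of_forall fun x => ENNReal.ofReal_lt_top)]
  simp only [ENNReal.toReal_ofReal (Real.exp_pos _).le]

theorem integrable_expMeasure_iff [NormedSpace ℝ F] {a : EuclideanSpace ℝ (Fin n) → ℝ}
    (ha : Continuous a) (f : EuclideanSpace ℝ (Fin n) → F) :
    Integrable f (expMeasure a) ↔ Integrable fun x => Real.exp (a x) • f x := by
  unfold expMeasure
  rw [integrable_withDensity_iff_integrable_smul' (by fun_prop)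
    (Eventually.of_forall fun x => ENNReal.ofReal_lt_top)]
  simp only [ENNReal.toReal_ofReal (Real.exp_pos _).le]

/-- A function of temperate growth is square integrable for a Gaussian weight. -/
theorem memLp_of_hasTemperateGrowth [NormedSpace ℝ F] {φ : EuclideanSpace ℝ (Fin n) → ℝ}
    (hφ : Continuous φ) {ε : ℝ} (hε : 0 < ε) (hφε : ∀ x, ε * ‖x‖ ^ 2 ≤ φ x)
    {w : EuclideanSpace ℝ (Fin n) → F} (hw : w.HasTemperateGrowth) :
    MemLp w 2 (expMeasure fun x => -φ x) := by
  have hwc : Continuous w := hw.1.continuous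
  rw [memLp_two_iff_integrable_sq_norm hwc.aestronglyMeasurable,
    integrable_expMeasure_iff (by fun_prop)]
  obtain ⟨k, C, hC⟩ := hw.2 0
  simp only [norm_iteratedFDeriv_zero] at hC
  -- With `r = 1 + ‖x‖`, the Gaussian is bounded by a multiple of `r ^ (-2m)` and `‖w‖²` by a
  -- multiple of `r ^ (2k)`. This `m` leaves `r ^ (-2(n+1))`, integrable as `2(n+1) > n`.
  set m := k + n + 1 with hm
  set D : ℝ := Real.exp ε * (m.factorial * (ε / 2)⁻¹ ^ m) * C ^ 2 with hD
  have hdom : Integrable fun x : EuclideanSpace ℝ (Fin n) =>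
      D * (1 + ‖x‖) ^ (-((2 * (n + 1) : ℕ) : ℝ)) := by
    refine (integrable_one_add_norm ?_).const_mul D
    rw [finrank_euclideanSpace_fin]
    exact_mod_cast (by omega : n < 2 * (n + 1))
  refine hdom.mono (by fun_prop : Continuous fun x => Real.exp (-φ x) • ‖w x‖ ^ 2).aestronglyMeasurable
    (Eventually.of_forall fun x => ?_)
  have hr : 0 < 1 + ‖x‖ := by positivity
  rw [Real.rpow_neg hr.le, Real.rpow_natCast, Real.norm_of_nonneg (by positivity)]
  refine le_trans ?_ (le_abs_self _)
  -- The exponents compare because `ε‖x‖² + ε - (ε/2)(1 + ‖x‖)² = (ε/2)(‖x‖ - 1)²`.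
  have h1 : Real.exp (-φ x) ≤ Real.exp ε * Real.exp (-(ε / 2 * (1 + ‖x‖) ^ 2)) := by
    rw [← Real.exp_add, Real.exp_le_exp]
    nlinarith [hφε x, mul_nonneg hε.le (sq_nonneg (‖x‖ - 1))]
  have h2 : Real.exp (-(ε / 2 * (1 + ‖x‖) ^ 2)) ≤
      m.factorial * (ε / 2)⁻¹ ^ m * ((1 + ‖x‖) ^ (2 * m))⁻¹ := by
    have h3 := Real.pow_div_factorial_le_exp (ε / 2 * (1 + ‖x‖) ^ 2) (by positivity) m
    rw [Real.exp_neg]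
    refine (inv_anti₀ (by positivity) h3).trans_eq ?_
    rw [inv_div, mul_pow, pow_mul, inv_pow, div_eq_mul_inv, mul_inv, mul_assoc]
  have h3 : ‖w x‖ ^ 2 ≤ C ^ 2 * (1 + ‖x‖) ^ (2 * k) := by
    have := pow_le_pow_left₀ (norm_nonneg _) (hC x) 2
    refine this.trans_eq ?_
    rw [mul_pow, ← pow_mul, mul_comm k 2]
  calc Real.exp (-φ x) • ‖w x‖ ^ 2
      ≤ (Real.exp ε * (m.factorial * (ε / 2)⁻¹ ^ m * ((1 + ‖x‖) ^ (2 * m))⁻¹)) *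
        (C ^ 2 * (1 + ‖x‖) ^ (2 * k)) := by
        rw [smul_eq_mul]
        refine mul_le_mul (h1.trans ?_) h3 (by positivity) (by positivity)
        exact mul_le_mul_of_nonneg_left h2 (Real.exp_pos _).le
    _ = D * ((1 + ‖x‖) ^ (2 * (n + 1)))⁻¹ := by
        have h4 : (1 + ‖x‖) ^ (2 * m) = (1 + ‖x‖) ^ (2 * k) * (1 + ‖x‖) ^ (2 * (n + 1)) := by
          rw [← pow_add]; congr 1; omega
        rw [h4, hD]
        field_simp

/-- The pairing of `L²(e^{a})` and `L²(e^{-a})`, and the inner product of `L²(e^{-a})`. -/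
theorem inner_mulExpNeg_symm [InnerProductSpace ℝ F] {a : EuclideanSpace ℝ (Fin n) → ℝ}
    (ha : Continuous a) (f : Lp F 2 (expMeasure a)) (w : Lp F 2 (expMeasure fun x => -a x)) :
    Integrable (fun x => ⟪f x, w x⟫_ℝ) ∧
      ⟪(mulExpNeg F a ha).symm f, w⟫_ℝ = ∫ x, ⟪f x, w x⟫_ℝ := by
  have h1 : ((mulExpNeg F a ha).symm f : EuclideanSpace ℝ (Fin n) → F) =ᵐ[volume]
      fun x => Real.exp (a x) • f x :=
    (expMeasure_ac (a := fun x => -a x) (by fun_prop)).2.ae_le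
      (memLp_exp_smul (k := a) (b := fun x => -a x) ha (by fun_prop) ha (fun x => by ring)
        (Lp.memLp f)).coeFn_toLp
  have h2 : (fun x => Real.exp (-a x) • ⟪(mulExpNeg F a ha).symm f x, w x⟫_ℝ) =ᵐ[volume]
      fun x => ⟪f x, w x⟫_ℝ := by
    filter_upwards [h1] with x hx
    rw [hx, real_inner_smul_left, smul_eq_mul, ← mul_assoc, ← Real.exp_add, neg_add_cancel,
      Real.exp_zero, one_mul]
  have h3 := L2.integrable_inner (𝕜 := ℝ) ((mulExpNeg F a ha).symm f) w
  rw [integrable_expMeasure_iff (by fun_prop)] at h3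
  refine ⟨h3.congr h2, ?_⟩
  rw [L2.inner_def, integral_expMeasure (by fun_prop)]
  exact integral_congr_ae h2

end Weighted

/-! ### The potential `φ` in an eigenbasis of `Γ` -/

namespace OUParams
variable {n : ℕ} (S : OUParams n)

theorem exists_eigenbasis : ∃ (v : OrthonormalBasis (Fin n) ℝ (EuclideanSpace ℝ (Fin n)))
    (lam : Fin n → ℝ), ∀ k, S.Γ.mulVec (v k).ofLp = (S.c * lam k) • (v k).ofLp := by
  refine ⟨S.Γ_posDef.isHermitian.eigenvectorBasis,
    fun k => S.c⁻¹ * S.Γ_posDef.isHermitian.eigenvalues k, fun k => ?_⟩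
  rw [mul_inv_cancel_left₀ S.c_pos.ne']
  exact S.Γ_posDef.isHermitian.mulVec_eigenvectorBasis k

section Eigenbasis
variable {S} {v : OrthonormalBasis (Fin n) ℝ (EuclideanSpace ℝ (Fin n))} {lam : Fin n → ℝ}

theorem eigenvalue_pos (hv : ∀ k, S.Γ.mulVec (v k).ofLp = (S.c * lam k) • (v k).ofLp)
    (k : Fin n) : 0 < lam k := by
  have h1 : (v k).ofLp ≠ 0 := by
    intro h
    have := v.norm_eq_one k
    rw [show v k = 0 from (WithLp.ofLp_eq_zero 2).1 h] at this
    simp at this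
  have h2 := S.Γ_posDef.dotProduct_mulVec_pos h1
  rw [hv, star_trivial, dotProduct_smul, smul_eq_mul] at h2
  have h3 : (v k).ofLp ⬝ᵥ (v k).ofLp = 1 := by
    have := real_inner_self_eq_norm_sq (v k)
    rw [v.norm_eq_one, EuclideanSpace.inner_eq_star_dotProduct, star_trivial] at this
    simpa using this
  rw [h3, mul_one] at h2
  exact pos_of_mul_pos_right h2 S.c_pos.le

theorem phi_eq_sum (hv : ∀ k, S.Γ.mulVec (v k).ofLp = (S.c * lam k) • (v k).ofLp)
    (x : EuclideanSpace ℝ (Fin n)) : S.phi x = 1 / 2 * ∑ k, lam k * ⟪v k, x⟫_ℝ ^ 2 := by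
  have h1 : S.Γ.mulVec x.ofLp = ∑ k, ⟪v k, x⟫_ℝ • (S.c * lam k) • (v k).ofLp := by
    conv_lhs => rw [← v.sum_repr' x]
    rw [WithLp.ofLp_sum, Matrix.mulVec_sum]
    refine Finset.sum_congr rfl fun k _ => ?_
    rw [WithLp.ofLp_smul, Matrix.mulVec_smul, hv]
  have h2 : ∀ k, x.ofLp ⬝ᵥ (v k).ofLp = ⟪v k, x⟫_ℝ := fun k => by
    rw [EuclideanSpace.inner_eq_star_dotProduct, star_trivial]
  have hc := S.c_pos.ne'
  rw [phi, h1, dotProduct_sum, Finset.mul_sum, Finset.mul_sum]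
  refine Finset.sum_congr rfl fun k _ => ?_
  rw [dotProduct_smul, dotProduct_smul, h2]
  simp only [smul_eq_mul]
  field_simp

theorem phi_hasTemperateGrowth : (S.phi).HasTemperateGrowth := by
  obtain ⟨v, lam, hv⟩ := S.exists_eigenbasis
  rw [show S.phi = fun x => 1 / 2 * ∑ k, lam k * ⟪v k, x⟫_ℝ ^ 2 from funext (phi_eq_sum hv)]
  fun_prop

theorem fderiv_phi (hv : ∀ k, S.Γ.mulVec (v k).ofLp = (S.c * lam k) • (v k).ofLp)
    (x a : EuclideanSpace ℝ (Fin n)) :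
    fderiv ℝ S.phi x a = ∑ k, lam k * (⟪v k, x⟫_ℝ * ⟪v k, a⟫_ℝ) := by
  have h1 : ∀ k, HasFDerivAt (fun x => ⟪v k, x⟫_ℝ) (innerSL ℝ (v k)) x := fun k =>
    (innerSL ℝ (v k)).hasFDerivAt
  have h2 : HasFDerivAt (fun x => 1 / 2 * ∑ k, lam k * ⟪v k, x⟫_ℝ ^ 2) _ x :=
    (HasFDerivAt.fun_sum fun k _ => ((h1 k).pow 2).const_mul (lam k)).const_mul (1 / 2)
  rw [show S.phi = fun x => 1 / 2 * ∑ k, lam k * ⟪v k, x⟫_ℝ ^ 2 from funext (phi_eq_sum hv),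
    h2.fderiv]
  simp [Finset.mul_sum]
  refine Finset.sum_congr rfl fun k _ => by ring

theorem fderiv_phi_eigenvector (hv : ∀ k, S.Γ.mulVec (v k).ofLp = (S.c * lam k) • (v k).ofLp)
    (x : EuclideanSpace ℝ (Fin n)) (j : Fin n) :
    fderiv ℝ S.phi x (v j) = lam j * ⟪v j, x⟫_ℝ := by
  rw [fderiv_phi hv, Finset.sum_eq_single j]
  · simp
  · intro k _ hk
    simp [v.inner_eq_zero hk]
  · simp

end Eigenbasis

theorem exists_le_phi : ∃ ε : ℝ, 0 < ε ∧ ∀ x, ε * ‖x‖ ^ 2 ≤ S.phi x := by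
  obtain ⟨v, lam, hv⟩ := S.exists_eigenbasis
  obtain ⟨ε, hε, hle⟩ : ∃ ε : ℝ, 0 < ε ∧ ∀ k, ε ≤ lam k := by
    rcases isEmpty_or_nonempty (Fin n) with h | h
    · exact ⟨1, one_pos, fun k => h.elim k⟩
    · obtain ⟨k, hk⟩ := Finite.exists_min lam
      exact ⟨lam k, eigenvalue_pos hv k, hk⟩
  refine ⟨ε / 2, by positivity, fun x => ?_⟩
  rw [phi_eq_sum hv, ← v.sum_sq_norm_inner_right x, Finset.mul_sum, Finset.mul_sum]
  refine Finset.sum_le_sum fun k _ => ?_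
  rw [Real.norm_eq_abs, sq_abs]
  nlinarith [hle k, sq_nonneg ⟪v k, x⟫_ℝ]

theorem memLp_of_hasTemperateGrowth {F : Type*} [NormedAddCommGroup F] [NormedSpace ℝ F]
    {w : EuclideanSpace ℝ (Fin n) → F} (hw : w.HasTemperateGrowth) :
    MemLp w 2 (expMeasure fun x => -S.phi x) := by
  obtain ⟨ε, hε, h⟩ := S.exists_le_phi
  exact FokkerPlanck.memLp_of_hasTemperateGrowth S.continuous_phi hε h hw

end OUParams
end FokkerPlanck

/-! ### Integration by parts and test functions -/

namespace FokkerPlanck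

theorem euclidean_eq_sum_single {n : ℕ} (a : EuclideanSpace ℝ (Fin n)) :
    a = ∑ i, a i • EuclideanSpace.single i (1 : ℝ) := by
  ext j
  simp [Pi.single_apply]

/-- The definition only has the coordinate directions. By linearity every direction is allowed, in
particular eigenvectors of `Γ` and frequency vectors. -/
theorem IsWeakGradient.integral_mul_fderiv {n : ℕ} {f : EuclideanSpace ℝ (Fin n) → ℝ}
    {G : EuclideanSpace ℝ (Fin n) → EuclideanSpace ℝ (Fin n)} (h : IsWeakGradient f G)
    {ψ : EuclideanSpace ℝ (Fin n) → ℝ} (hψ : ContDiff ℝ ∞ ψ) (hψ' : HasCompactSupport ψ)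
    (a : EuclideanSpace ℝ (Fin n)) :
    ∫ x, f x * fderiv ℝ ψ x a = -∫ x, ⟪a, G x⟫_ℝ * ψ x := by
  have hi₁ : ∀ i : Fin n, Integrable fun x =>
      a i * (f x * fderiv ℝ ψ x (EuclideanSpace.single i 1)) := fun i => by
    have := h.1.integrable_smul_left_of_hasCompactSupport
      ((hψ.continuous_fderiv (by simp)).clm_apply (continuous_const (y := EuclideanSpace.single i (1 : ℝ))))
      (hψ'.fderiv_apply ℝ _)
    simp only [smul_eq_mul, mul_comm _ (f _)] at this
    exact this.const_mul _
  have hi₂ : ∀ i : Fin n, Integrable fun x => a i * (G x i * ψ x) := fun i => by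
    have := (EuclideanSpace.proj (𝕜 := ℝ) i).integrable_comp
      (h.2.1.integrable_smul_left_of_hasCompactSupport hψ.continuous hψ')
    refine (this.congr (Eventually.of_forall fun x => ?_)).const_mul _
    simp [mul_comm]
  have e₁ : ∀ x, f x * fderiv ℝ ψ x a =
      ∑ i, a i * (f x * fderiv ℝ ψ x (EuclideanSpace.single i 1)) := fun x => by
    conv_lhs => rw [euclidean_eq_sum_single a, map_sum, Finset.mul_sum]
    refine Finset.sum_congr rfl fun i _ => ?_
    rw [map_smul, smul_eq_mul]; ring
  have e₂ : ∀ x, ⟪a, G x⟫_ℝ * ψ x = ∑ i, a i * (G x i * ψ x) := fun x => by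
    rw [PiLp.inner_apply, Finset.sum_mul]
    refine Finset.sum_congr rfl fun i _ => ?_
    simp; ring
  simp only [e₁, e₂]
  rw [integral_finsetSum _ fun i _ => hi₁ i, integral_finsetSum _ fun i _ => hi₂ i,
    ← Finset.sum_neg_distrib]
  refine Finset.sum_congr rfl fun i _ => ?_
  rw [integral_const_mul, integral_const_mul, h.2.2 ψ hψ hψ' i, mul_neg]

/-- A smooth function has its gradient as weak gradient. -/
theorem isWeakGradient_of_hasFDerivAt {n : ℕ} {w : EuclideanSpace ℝ (Fin n) → ℝ}
    {G : EuclideanSpace ℝ (Fin n) → EuclideanSpace ℝ (Fin n)} (hw : ContDiff ℝ ∞ w)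
    (hG : Continuous G) (hwG : ∀ x, HasFDerivAt w (innerSL ℝ (G x)) x) : IsWeakGradient w G := by
  refine ⟨hw.continuous.locallyIntegrable, hG.locallyIntegrable, fun ψ hψ hψ' i => ?_⟩
  have c1 : ∀ {θ : EuclideanSpace ℝ (Fin n) → ℝ}, ContDiff ℝ ∞ θ →
      Continuous fun x => fderiv ℝ θ x (EuclideanSpace.single i (1 : ℝ)) := fun hθ =>
    (hθ.continuous_fderiv (by simp)).clm_apply continuous_const
  have key := integral_mul_fderiv_eq_neg_fderiv_mul_of_integrable (f := w) (g := ψ)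
    (v := EuclideanSpace.single i (1 : ℝ)) (μ := volume)
    (((c1 hw).mul hψ.continuous).integrable_of_hasCompactSupport hψ'.mul_left)
    ((hw.continuous.mul (c1 hψ)).integrable_of_hasCompactSupport
      (HasCompactSupport.mul_left (hψ'.fderiv_apply ℝ _)))
    ((hw.continuous.mul hψ.continuous).integrable_of_hasCompactSupport hψ'.mul_left)
    (fun x _ => hw.differentiable (by simp) x) (fun x _ => hψ.differentiable (by simp) x)
  rw [key]
  congr 1
  refine integral_congr_ae (Eventually.of_forall fun x => ?_)
  simp only [(hwG x).fderiv, innerSL_apply_apply, EuclideanSpace.inner_single_right]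
  simp

/-- Dilates `b(x/(m+1))` of one bump function: their derivatives are at most `C/(m+1)`. -/
theorem exists_cutoff (n : ℕ) : ∃ χ : ℕ → EuclideanSpace ℝ (Fin n) → ℝ,
    (∀ m, ContDiff ℝ ∞ (χ m) ∧ HasCompactSupport (χ m)) ∧
    (∀ m x, |χ m x| ≤ 1) ∧ (∀ x, Tendsto (fun m => χ m x) atTop (𝓝 1)) ∧
    ∃ C, (∀ m x, ‖fderiv ℝ (χ m) x‖ ≤ C) ∧
      ∀ x, Tendsto (fun m => fderiv ℝ (χ m) x) atTop (𝓝 0) := by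
  let b : ContDiffBump (0 : EuclideanSpace ℝ (Fin n)) := ⟨1, 2, one_pos, one_lt_two⟩
  have hb : ContDiff ℝ ∞ b := b.contDiff
  obtain ⟨C, hC⟩ := (b.hasCompactSupport.fderiv ℝ).exists_bound_of_continuous
    (hb.continuous_fderiv (by simp))
  have hC0 : 0 ≤ C := (norm_nonneg _).trans (hC 0)
  have hfd : ∀ (m : ℕ) (x : EuclideanSpace ℝ (Fin n)),
      fderiv ℝ (fun x => b (((m : ℝ) + 1)⁻¹ • x)) x =
        ((m : ℝ) + 1)⁻¹ • fderiv ℝ b (((m : ℝ) + 1)⁻¹ • x) := fun m x => by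
    rw [fderiv_comp_smul]
  have hlim : Tendsto (fun m : ℕ => ((m : ℝ) + 1)⁻¹) atTop (𝓝 0) := by
    simpa [one_div] using tendsto_one_div_add_atTop_nhds_zero_nat (𝕜 := ℝ)
  refine ⟨fun m x => b (((m : ℝ) + 1)⁻¹ • x), fun m => ⟨?_, ?_⟩, fun m x => ?_, fun x => ?_,
    C, fun m x => ?_, fun x => ?_⟩
  · exact hb.comp (contDiff_const_smul _)
  · exact b.hasCompactSupport.comp_smul (by positivity)
  · rw [abs_of_nonneg b.nonneg]; exact b.le_one
  · have h1 : Tendsto (fun m : ℕ => ((m : ℝ) + 1)⁻¹ • x) atTop (𝓝 0) := by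
      simpa using hlim.smul_const x
    have h2 := (b.continuous.tendsto 0).comp h1
    rwa [b.one_of_mem_closedBall (by simp [b.rIn_pos.le])] at h2
  · rw [hfd, norm_smul, Real.norm_of_nonneg (by positivity)]
    have : ((m : ℝ) + 1)⁻¹ ≤ 1 := inv_le_one_of_one_le₀ (by linarith [Nat.cast_nonneg (α := ℝ) m])
    nlinarith [hC (((m : ℝ) + 1)⁻¹ • x), norm_nonneg (fderiv ℝ b (((m : ℝ) + 1)⁻¹ • x))]
  · simp only [hfd]
    refine squeeze_zero_norm (fun m => ?_) (by simpa using hlim.mul_const C)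
    rw [norm_smul, Real.norm_of_nonneg (by positivity)]
    exact mul_le_mul_of_nonneg_left (hC _) (by positivity)

namespace OUParams
variable {n : ℕ} (S : OUParams n)

section TempLp
variable {F : Type*} [NormedAddCommGroup F] [NormedSpace ℝ F]

/-- A function of temperate growth, as an element of `L²(e^{-φ})`. -/
noncomputable def tempLp (w : EuclideanSpace ℝ (Fin n) → F) (hw : w.HasTemperateGrowth) :
    Lp F 2 (expMeasure fun x => -S.phi x) :=
  (S.memLp_of_hasTemperateGrowth hw).toLp w

theorem coeFn_tempLp {w : EuclideanSpace ℝ (Fin n) → F} (hw : w.HasTemperateGrowth) :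
    S.tempLp w hw =ᵐ[volume] w :=
  (expMeasure_ac S.continuous_neg_phi).2.ae_le (MemLp.coeFn_toLp _)

theorem tempLp_smul {w : EuclideanSpace ℝ (Fin n) → F} (hw : w.HasTemperateGrowth) (a : ℝ) :
    S.tempLp (fun x => a • w x) (by fun_prop) = a • S.tempLp w hw :=
  MemLp.toLp_const_smul _ _

end TempLp

theorem integrable_mul_tempered {r : EuclideanSpace ℝ (Fin n) → ℝ}
    (hr : MemLp r 2 (expMeasure fun x => -S.phi x)) {w : EuclideanSpace ℝ (Fin n) → ℝ}
    (hw : w.HasTemperateGrowth) :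
    Integrable (fun x => r x * w x) (expMeasure fun x => -S.phi x) :=
  hr.integrable_mul (S.memLp_of_hasTemperateGrowth hw)

theorem sobolev_memLp_inner (r : WithLp 2 (S.HSpace × S.HVec)) (a : EuclideanSpace ℝ (Fin n)) :
    MemLp (fun x => ⟪a, r.snd x⟫_ℝ) 2 (expMeasure fun x => -S.phi x) :=
  (innerSL ℝ a).comp_memLp' (Lp.memLp r.snd)

/-- Integration by parts against a Sobolev function. -/
theorem integral_inner_mul_eq {r : WithLp 2 (S.HSpace × S.HVec)} (hr : r ∈ S.sobolev)
    {ψ : EuclideanSpace ℝ (Fin n) → ℝ} (hψ : ψ.HasTemperateGrowth)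
    (a : EuclideanSpace ℝ (Fin n)) :
    ∫ x, ⟪a, r.snd x⟫_ℝ * ψ x ∂(expMeasure fun x => -S.phi x) =
      ∫ x, r.fst x * (ψ x * fderiv ℝ S.phi x a - fderiv ℝ ψ x a)
        ∂(expMeasure fun x => -S.phi x) := by
  obtain ⟨χ, hχ, hχ1, hχlim, C, hC, hdlim⟩ := exists_cutoff n
  have hφ := phi_hasTemperateGrowth (S := S)
  have hφa := hasTemperateGrowth_fderiv_apply hφ a
  have hψa := hasTemperateGrowth_fderiv_apply hψ a
  set μ := expMeasure fun x => -S.phi x with hμ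
  have hfd : ∀ m x, fderiv ℝ (fun x => Real.exp (-S.phi x) * (χ m x * ψ x)) x a =
      Real.exp (-S.phi x) * (fderiv ℝ (χ m) x a * ψ x -
        χ m x * (ψ x * fderiv ℝ S.phi x a - fderiv ℝ ψ x a)) := by
    intro m x
    have h1 := ((hχ m).1.differentiable (by simp) x).hasFDerivAt
    have h2 := (hψ.1.differentiable (by simp) x).hasFDerivAt
    have h3 := (hφ.1.differentiable (by simp) x).hasFDerivAt
    rw [(h3.fun_neg.exp.fun_mul (h1.fun_mul h2)).fderiv]
    simp
    ring
  -- The weak gradient is tested with the compactly supported function `e^{-φ} χ_m ψ`;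
  -- differentiating the weight produces the term with `∇φ`.
  have key : ∀ m, ∫ x, r.fst x * (χ m x * (ψ x * fderiv ℝ S.phi x a - fderiv ℝ ψ x a) -
      fderiv ℝ (χ m) x a * ψ x) ∂μ = ∫ x, ⟪a, r.snd x⟫_ℝ * (χ m x * ψ x) ∂μ := by
    intro m
    have h1 : ContDiff ℝ ∞ fun x => Real.exp (-S.phi x) * (χ m x * ψ x) :=
      (Real.contDiff_exp.comp hφ.1.neg).mul ((hχ m).1.mul hψ.1)
    have h2 : HasCompactSupport fun x => Real.exp (-S.phi x) * (χ m x * ψ x) :=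
      ((hχ m).2.mul_right).mul_left
    have h3 := IsWeakGradient.integral_mul_fderiv (f := r.fst) (G := r.snd) hr h1 h2 a
    rw [integral_expMeasure S.continuous_neg_phi, integral_expMeasure S.continuous_neg_phi]
    simp only [hfd] at h3
    rw [← neg_inj, ← integral_neg]
    refine Eq.trans (integral_congr_ae (Eventually.of_forall fun x => ?_))
      (h3.trans (congrArg Neg.neg (integral_congr_ae (Eventually.of_forall fun x => ?_))))
    · simp only [smul_eq_mul]; ring
    · simp only [smul_eq_mul]; ring
  have hcont : ∀ m, Continuous fun x => fderiv ℝ (χ m) x a := fun m =>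
    ((hχ m).1.continuous_fderiv (by simp)).clm_apply continuous_const
  have hr1 : MemLp r.fst 2 μ := Lp.memLp _
  have hr2 := S.sobolev_memLp_inner r a
  have hL : (fun x => ψ x * fderiv ℝ S.phi x a - fderiv ℝ ψ x a).HasTemperateGrowth := by fun_prop
  have i1 := (S.integrable_mul_tempered hr1 hL).abs
  have i2 := (S.integrable_mul_tempered hr1 hψ).abs.const_mul (C * ‖a‖)
  have i3 := (S.integrable_mul_tempered hr2 hψ).abs
  -- The cutoff is removed by dominated convergence: the majorants are products of an `L²(e^{-φ})`
  -- function with one of temperate growth, and the derivatives of the cutoffs vanish in the limit.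
  have lim1 : Tendsto (fun m => ∫ x, r.fst x * (χ m x * (ψ x * fderiv ℝ S.phi x a -
      fderiv ℝ ψ x a) - fderiv ℝ (χ m) x a * ψ x) ∂μ) atTop
      (𝓝 (∫ x, r.fst x * (1 * (ψ x * fderiv ℝ S.phi x a - fderiv ℝ ψ x a) -
        (0 : EuclideanSpace ℝ (Fin n) →L[ℝ] ℝ) a * ψ x) ∂μ)) := by
    refine tendsto_integral_of_dominated_convergence _ (fun m => ?_) (i1.add i2) (fun m => ?_) ?_
    · exact hr1.1.mul (((hχ m).1.continuous.mul hL.1.continuous).sub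
        ((hcont m).mul hψ.1.continuous)).aestronglyMeasurable
    · refine Eventually.of_forall fun x => ?_
      have h1 : |fderiv ℝ (χ m) x a| ≤ C * ‖a‖ := (fderiv ℝ (χ m) x).le_of_opNorm_le (hC m x) a
      rw [mul_sub, Real.norm_eq_abs]
      refine (abs_sub _ _).trans (add_le_add ?_ ?_)
      · rw [mul_left_comm, abs_mul]
        exact mul_le_of_le_one_left (abs_nonneg _) (hχ1 m x)
      · rw [mul_left_comm, abs_mul]
        exact mul_le_mul_of_nonneg_right h1 (abs_nonneg _)
    · refine Eventually.of_forall fun x => Tendsto.const_mul _ (Tendsto.sub ?_ ?_)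
      · exact (hχlim x).mul_const _
      · exact Tendsto.mul_const _ (((ContinuousLinearMap.apply ℝ ℝ a).continuous.tendsto 0).comp
          (hdlim x))
  have lim2 : Tendsto (fun m => ∫ x, ⟪a, r.snd x⟫_ℝ * (χ m x * ψ x) ∂μ) atTop
      (𝓝 (∫ x, ⟪a, r.snd x⟫_ℝ * (1 * ψ x) ∂μ)) := by
    refine tendsto_integral_of_dominated_convergence _ (fun m => ?_) i3 (fun m => ?_) ?_
    · exact hr2.1.mul ((hχ m).1.continuous.mul hψ.1.continuous).aestronglyMeasurable
    · refine Eventually.of_forall fun x => ?_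
      rw [mul_left_comm, Real.norm_eq_abs, abs_mul]
      exact mul_le_of_le_one_left (abs_nonneg _) (hχ1 m x)
    · exact Eventually.of_forall fun x => ((hχlim x).mul_const _).const_mul _
  simp only [one_mul, zero_apply, zero_mul, sub_zero] at lim1 lim2
  exact tendsto_nhds_unique lim2 (lim1.congr key)

/-- `w` is a function of temperate growth with gradient `G`, and `L = -Δw + ∇φ · ∇w`. -/
structure IsTestFunction (w L : EuclideanSpace ℝ (Fin n) → ℝ)
    (G : EuclideanSpace ℝ (Fin n) → EuclideanSpace ℝ (Fin n)) : Prop where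
  temp : w.HasTemperateGrowth
  temp_L : L.HasTemperateGrowth
  temp_G : G.HasTemperateGrowth
  grad_mem : WithLp.toLp 2 (S.tempLp w temp, S.tempLp G temp_G) ∈ S.sobolev
  mem_opA : (S.tempLp w temp, S.tempLp L temp_L) ∈ S.opA

/-- With the gradient in the form `∑ ψ_j a_j`, integrating each term by parts in the direction `a_j`
against an arbitrary Sobolev function gives `A w`, and no second derivatives of `w` appear. The
constant needs no term, linear functions and waves need one, products of two linear functions need
two. -/
theorem isTestFunction {ι : Type*} [Fintype ι] {w : EuclideanSpace ℝ (Fin n) → ℝ}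
    (hw : w.HasTemperateGrowth) {ψ : ι → EuclideanSpace ℝ (Fin n) → ℝ}
    (hψ : ∀ j, (ψ j).HasTemperateGrowth) (a : ι → EuclideanSpace ℝ (Fin n))
    (hwψ : ∀ x, HasFDerivAt w (innerSL ℝ (∑ j, ψ j x • a j)) x) :
    S.IsTestFunction w
      (fun x => ∑ j, (ψ j x * fderiv ℝ S.phi x (a j) - fderiv ℝ (ψ j) x (a j)))
      (fun x => ∑ j, ψ j x • a j) := by
  have hφa := fun j => hasTemperateGrowth_fderiv_apply (phi_hasTemperateGrowth (S := S)) (a j)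
  have hψa := fun j => hasTemperateGrowth_fderiv_apply (hψ j) (a j)
  have hG : (fun x => ∑ j, ψ j x • a j).HasTemperateGrowth :=
    Function.HasTemperateGrowth.sum fun j _ => (hψ j).fun_smul (.const _)
  have hL : (fun x => ∑ j, (ψ j x * fderiv ℝ S.phi x (a j) -
      fderiv ℝ (ψ j) x (a j))).HasTemperateGrowth :=
    Function.HasTemperateGrowth.sum fun j _ => ((hψ j).fun_mul (hφa j)).fun_sub (hψa j)
  have hmem : WithLp.toLp 2 (S.tempLp w hw, S.tempLp _ hG) ∈ S.sobolev := by
    have h1 := isWeakGradient_of_hasFDerivAt hw.1 hG.1.continuous hwψ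
    refine ⟨memLp_locallyIntegrable S.continuous_neg_phi (Lp.memLp _),
      memLp_locallyIntegrable S.continuous_neg_phi (Lp.memLp _), fun θ hθ hθ' i => ?_⟩
    refine Eq.trans (integral_congr_ae ?_) ((h1.2.2 θ hθ hθ' i).trans
      (congrArg Neg.neg (integral_congr_ae ?_)))
    · filter_upwards [S.coeFn_tempLp hw] with x hx
      simp only [WithLp.toLp_fst, hx]
    · filter_upwards [S.coeFn_tempLp hG] with x hx
      simp only [WithLp.toLp_snd, hx]
  refine ⟨hw, hL, hG, hmem, _, hmem, rfl, fun r hr => ?_⟩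
  have hr1 : MemLp r.fst 2 (expMeasure fun x => -S.phi x) := Lp.memLp _
  rw [WithLp.toLp_snd, L2.inner_def, L2.inner_def]
  have e1 : ∫ x, ⟪S.tempLp _ hG x, r.snd x⟫_ℝ ∂(expMeasure fun x => -S.phi x) =
      ∫ x, ∑ j, ⟪a j, r.snd x⟫_ℝ * ψ j x ∂(expMeasure fun x => -S.phi x) := by
    refine integral_congr_ae ?_
    filter_upwards [(S.memLp_of_hasTemperateGrowth hG).coeFn_toLp] with x hx
    rw [tempLp, hx, sum_inner]
    simp only [real_inner_smul_left, mul_comm]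
  have e2 : ∫ x, ⟪S.tempLp _ hL x, r.fst x⟫_ℝ ∂(expMeasure fun x => -S.phi x) =
      ∫ x, ∑ j, r.fst x * (ψ j x * fderiv ℝ S.phi x (a j) - fderiv ℝ (ψ j) x (a j))
        ∂(expMeasure fun x => -S.phi x) := by
    refine integral_congr_ae ?_
    filter_upwards [(S.memLp_of_hasTemperateGrowth hL).coeFn_toLp] with x hx
    rw [tempLp, hx, ← Finset.mul_sum]
    rfl
  rw [e1, e2, integral_finsetSum _ fun j _ =>
      S.integrable_mul_tempered (S.sobolev_memLp_inner r (a j)) (hψ j),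
    integral_finsetSum _ fun j _ => S.integrable_mul_tempered hr1
      (((hψ j).fun_mul (hφa j)).fun_sub (hψa j))]
  exact Finset.sum_congr rfl fun j _ => S.integral_inner_mul_eq hr (hψ j) (a j)

end OUParams
end FokkerPlanck

/-! ### The dual equation and its Hermite eigenfunctions -/

namespace FokkerPlanck
namespace OUParams
variable {n : ℕ} {S : OUParams n}

section TempLp
variable {F : Type*} [NormedAddCommGroup F] [NormedSpace ℝ F]

theorem tempLp_congr {w w' : EuclideanSpace ℝ (Fin n) → F} (hw : w.HasTemperateGrowth)
    (hw' : w'.HasTemperateGrowth) (h : ∀ x, w x = w' x) : S.tempLp w hw = S.tempLp w' hw' := by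
  obtain rfl : w = w' := funext h
  rfl

theorem tempLp_add {w w' : EuclideanSpace ℝ (Fin n) → F} (hw : w.HasTemperateGrowth)
    (hw' : w'.HasTemperateGrowth) :
    S.tempLp (fun x => w x + w' x) (hw.fun_add hw') = S.tempLp w hw + S.tempLp w' hw' :=
  MemLp.toLp_add _ _

end TempLp

/-- `L²(e^{φ})` and `L²(e^{-φ})` are dual under the unweighted integral, and functions of temperate
growth lie in the second. All moments of elements of `𝔥` converge for this reason. -/
theorem integrable_mul (f : S.StateSpace) {w : EuclideanSpace ℝ (Fin n) → ℝ}
    (hw : w.HasTemperateGrowth) : Integrable fun x => f x * w x := by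
  refine (inner_mulExpNeg_symm S.continuous_phi f (S.tempLp w hw)).1.congr ?_
  filter_upwards [S.coeFn_tempLp hw] with x hx
  rw [hx]
  simp [mul_comm]

/-- The weight `e^{φ}` of the inner product cancels the factor `e^{-φ}` of `h`. -/
theorem inner_h_tempLp (f : S.StateSpace) {w : EuclideanSpace ℝ (Fin n) → ℝ}
    (hw : w.HasTemperateGrowth) : ⟪f, S.h (S.tempLp w hw)⟫_ℝ = ∫ x, f x * w x := by
  have h1 : ⟪f, S.h (S.tempLp w hw)⟫_ℝ = ⟪S.h.symm f, S.tempLp w hw⟫_ℝ := by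
    rw [← S.h.inner_map_map, S.h.apply_symm_apply]
  refine h1.trans ((inner_mulExpNeg_symm S.continuous_phi f (S.tempLp w hw)).2.trans
    (integral_congr_ae ?_))
  filter_upwards [S.coeFn_tempLp hw] with x hx
  rw [hx]
  simp [mul_comm]

theorem inner_hVec_symm_flux (b : EuclideanSpace ℝ (Fin n)) (f : S.StateSpace)
    {G : EuclideanSpace ℝ (Fin n) → EuclideanSpace ℝ (Fin n)} (hG : G.HasTemperateGrowth) :
    ⟪S.hVec.symm (S.flux b f), S.tempLp G hG⟫_ℝ = ∫ x, f x * ⟪b, G x⟫_ℝ := by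
  refine (inner_mulExpNeg_symm S.continuous_phi (S.flux b f) (S.tempLp G hG)).2.trans
    (integral_congr_ae ?_)
  filter_upwards [S.coeFn_tempLp hG, (expMeasure_ac S.continuous_phi).2.ae_le
    (ContinuousLinearMap.coeFn_compLp (ContinuousLinearMap.toSpanSingleton ℝ b) f)] with x hx hx'
  rw [hx, flux, hx', ContinuousLinearMap.toSpanSingleton_apply, real_inner_smul_left]

/-- The mild equation, tested with a solution of the dual equation without drift. -/
theorem IsMildSolutionOn.integral_mul_eq
    {g : EuclideanSpace ℝ (Fin n) → EuclideanSpace ℝ (Fin n)}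
    {u : ℝ → EuclideanSpace ℝ (Fin n)} {p₀ : S.StateSpace} {t₁ : ℝ} {p : ℝ → S.StateSpace}
    (hp : S.IsMildSolutionOn g u (fun _ => 0) p₀ t₁ p) (hg : Continuous g)
    (hu : ContinuousOn u (Ici 0)) {w L : ℝ → EuclideanSpace ℝ (Fin n) → ℝ}
    {G : ℝ → EuclideanSpace ℝ (Fin n) → EuclideanSpace ℝ (Fin n)}
    (hT : ∀ t, S.IsTestFunction (w t) (L t) (G t))
    (hd : ∀ t, HasDerivAt (fun t => S.tempLp (w t) (hT t).temp)
      (-(S.c • S.tempLp (L t) (hT t).temp_L)) t) {t : ℝ} (ht : t ∈ Icc 0 t₁) :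
    ∫ x, p t x * w 0 x = (∫ x, p₀ x * w t x) +
      ∫ s in (0 : ℝ)..t, ∫ x, p s x * ⟪g (u s), G (t - s) x⟫_ℝ := by
  have h1 := IsMildSolutionOn.test hp hg hu
    (z := fun t => S.h (S.tempLp (w t) (hT t).temp))
    (y := fun t => S.h (S.tempLp (L t) (hT t).temp_L))
    (G := fun t => S.tempLp (G t) (hT t).temp_G)
    (fun t => by
      have := S.h.toContinuousLinearEquiv.toContinuousLinearMap.hasFDerivAt.comp_hasDerivAt t (hd t)
      refine this.congr_deriv ?_
      rw [map_neg, map_smul]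
      rfl)
    (fun t => by
      rw [mem_opFA]
      simp only [LinearIsometryEquiv.symm_apply_apply]
      exact (hT t).mem_opA)
    (fun t => by
      rw [LinearIsometryEquiv.symm_apply_apply]
      exact (hT t).grad_mem) ht
  rw [inner_h_tempLp, inner_h_tempLp] at h1
  rw [h1]
  congr 1
  exact intervalIntegral.integral_congr fun s _ => inner_hVec_symm_flux _ _ _

theorem IsTestFunction.congr {w w' L L' : EuclideanSpace ℝ (Fin n) → ℝ}
    {G G' : EuclideanSpace ℝ (Fin n) → EuclideanSpace ℝ (Fin n)} (h : S.IsTestFunction w L G)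
    (hw : ∀ x, w x = w' x) (hL : ∀ x, L x = L' x) (hG : ∀ x, G x = G' x) :
    S.IsTestFunction w' L' G' := by
  obtain rfl : w = w' := funext hw
  obtain rfl : L = L' := funext hL
  obtain rfl : G = G' := funext hG
  exact h

theorem IsTestFunction.smul {w L : EuclideanSpace ℝ (Fin n) → ℝ}
    {G : EuclideanSpace ℝ (Fin n) → EuclideanSpace ℝ (Fin n)} (h : S.IsTestFunction w L G)
    (a : ℝ) : S.IsTestFunction (fun x => a • w x) (fun x => a • L x) (fun x => a • G x) := by
  have h1 := h.temp
  have h2 := h.temp_L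
  have h3 := h.temp_G
  refine ⟨by fun_prop, by fun_prop, by fun_prop, ?_, ?_⟩
  · rw [tempLp_smul _ h1, tempLp_smul _ h3]
    exact S.sobolev.smul_mem a h.grad_mem
  · rw [tempLp_smul _ h1, tempLp_smul _ h2]
    exact S.opA.smul_mem a h.mem_opA

/-- The mild equation, tested with an eigenfunction. -/
theorem IsMildSolutionOn.integral_mul_eigenfunction
    {g : EuclideanSpace ℝ (Fin n) → EuclideanSpace ℝ (Fin n)}
    {u : ℝ → EuclideanSpace ℝ (Fin n)} {p₀ : S.StateSpace} {t₁ : ℝ} {p : ℝ → S.StateSpace}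
    (hp : S.IsMildSolutionOn g u (fun _ => 0) p₀ t₁ p) (hg : Continuous g)
    (hu : ContinuousOn u (Ici 0)) {w : EuclideanSpace ℝ (Fin n) → ℝ} {κ : ℝ}
    {G : EuclideanSpace ℝ (Fin n) → EuclideanSpace ℝ (Fin n)}
    (hT : S.IsTestFunction w (fun x => κ * w x) G) {t : ℝ} (ht : t ∈ Icc 0 t₁) :
    ∫ x, p t x * w x = Real.exp (-(S.c * κ * t)) * (∫ x, p₀ x * w x) +
      ∫ s in (0 : ℝ)..t, Real.exp (-(S.c * κ * (t - s))) * ∫ x, p s x * ⟪g (u s), G x⟫_ℝ := by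
  -- The orbit of an eigenfunction with eigenvalue `κ` is `e^{-cκt} w`.
  have hT' : ∀ t : ℝ, S.IsTestFunction (fun x => Real.exp (-(S.c * κ * t)) • w x)
      (fun x => Real.exp (-(S.c * κ * t)) • (κ * w x))
      (fun x => Real.exp (-(S.c * κ * t)) • G x) := fun t => hT.smul _
  have hw := hT.temp
  have h1 := hp.integral_mul_eq hg hu hT' (fun t => by
    simp only [tempLp_smul _ hw, tempLp_smul _ hT.temp_L]
    have e1 : S.tempLp (fun x => κ * w x) hT.temp_L = κ • S.tempLp w hw := tempLp_smul S hw κ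
    have e2 : HasDerivAt (fun t : ℝ => Real.exp (-(S.c * κ * t)))
        (Real.exp (-(S.c * κ * t)) * -(S.c * κ)) t := by
      refine HasDerivAt.exp ?_
      simpa using ((hasDerivAt_id t).const_mul (S.c * κ)).fun_neg
    refine (e2.smul_const _).congr_deriv ?_
    rw [e1, smul_smul, smul_smul, ← neg_smul]
    congr 1
    ring) ht
  simp only [mul_zero, neg_zero, Real.exp_zero, one_smul] at h1
  rw [h1, ← integral_const_mul]
  congr 1
  · refine integral_congr_ae (Eventually.of_forall fun x => ?_)
    simp only [smul_eq_mul]; ring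
  · refine intervalIntegral.integral_congr fun s _ => ?_
    rw [← integral_const_mul]
    refine integral_congr_ae (Eventually.of_forall fun x => ?_)
    simp only [real_inner_smul_right]; ring

section Eigenfunctions
variable {v : OrthonormalBasis (Fin n) ℝ (EuclideanSpace ℝ (Fin n))} {lam : Fin n → ℝ}

/-- The Hermite polynomial of degree zero. `0 * 1` displays it as an eigenfunction with `κ = 0`, and
its zero gradient removes the drift. -/
theorem isTestFunction_one : S.IsTestFunction (fun _ => 1) (fun _ => 0 * 1) (fun _ => 0) := by
  refine (S.isTestFunction (ι := Fin 0) (w := fun _ => 1) (.const 1) (ψ := fun _ _ => 0)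
    (fun _ => .const 0) (fun _ => 0) fun x => ?_).congr (fun _ => rfl) (by simp) (by simp)
  simpa using hasFDerivAt_const (𝕜 := ℝ) (1 : ℝ) x

/-- Degree one: the gradient is constant and the derivative of `φ` in the direction `v_k` is `λ_k
⟨v_k, x⟩`. -/
theorem isTestFunction_linear (hv : ∀ k, S.Γ.mulVec (v k).ofLp = (S.c * lam k) • (v k).ofLp)
    (k : Fin n) :
    S.IsTestFunction (fun x => ⟪v k, x⟫_ℝ) (fun x => lam k * ⟪v k, x⟫_ℝ) (fun _ => v k) := by
  refine (S.isTestFunction (ι := Unit) (w := fun x => ⟪v k, x⟫_ℝ) (by fun_prop)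
    (ψ := fun _ _ => 1) (fun _ => .const 1) (fun _ => v k) fun x => ?_).congr (fun _ => rfl)
    (fun x => ?_) (by simp)
  · simpa using (innerSL ℝ (v k)).hasFDerivAt
  · simp [fderiv_phi_eigenvector hv]

/-- Degree two: `A` maps `x_k x_l` to `(λ_k + λ_l) x_k x_l - 2 ⟨v_k, v_l⟩`, and subtracting the
constant `⟨v_k, v_l⟩ / λ_k` turns this into an eigenvalue equation. The constant vanishes for `k ≠
l`, so it is symmetric in `k` and `l`. -/
theorem isTestFunction_quadratic
    (hv : ∀ k, S.Γ.mulVec (v k).ofLp = (S.c * lam k) • (v k).ofLp) (k l : Fin n) :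
    S.IsTestFunction (fun x => ⟪v k, x⟫_ℝ * ⟪v l, x⟫_ℝ - ⟪v k, v l⟫_ℝ / lam k)
      (fun x => (lam k + lam l) * (⟪v k, x⟫_ℝ * ⟪v l, x⟫_ℝ - ⟪v k, v l⟫_ℝ / lam k))
      (fun x => ⟪v l, x⟫_ℝ • v k + ⟪v k, x⟫_ℝ • v l) := by
  have hd : ∀ (j : Fin n) x, HasFDerivAt (fun x => ⟪v j, x⟫_ℝ) (innerSL ℝ (v j)) x := fun j x =>
    (innerSL ℝ (v j)).hasFDerivAt
  refine (S.isTestFunction (ι := Fin 2)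
    (w := fun x => ⟪v k, x⟫_ℝ * ⟪v l, x⟫_ℝ - ⟪v k, v l⟫_ℝ / lam k) (by fun_prop)
    (ψ := ![fun x => ⟪v l, x⟫_ℝ, fun x => ⟪v k, x⟫_ℝ]) (fun j => ?_) ![v k, v l]
    fun x => ?_).congr (fun _ => rfl) (fun x => ?_) (fun x => by simp)
  · fin_cases j
    · exact Function.hasTemperateGrowth_inner_right (v l)
    · exact Function.hasTemperateGrowth_inner_right (v k)
  · refine (((hd k x).fun_mul (hd l x)).sub_const _).congr_fderiv ?_
    ext y
    simp
    ring
  · have hk := (eigenvalue_pos hv k).ne'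
    have hl : lam l * ⟪v k, v l⟫_ℝ = lam k * ⟪v k, v l⟫_ℝ := by
      rcases eq_or_ne k l with rfl | h
      · rfl
      · simp [v.inner_eq_zero h]
    simp only [Fin.sum_univ_two, Matrix.cons_val_zero, Matrix.cons_val_one, (hd _ x).fderiv,
      fderiv_phi_eigenvector hv, innerSL_apply_apply]
    rw [real_inner_comm (v k) (v l)]
    field_simp
    linear_combination hl

end Eigenfunctions

end OUParams
end FokkerPlanck

/-! ### Moment equations and the cancellation of the input -/

namespace FokkerPlanck

/-- The primitive of an extension of a function which is continuous on an interval. -/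
theorem exists_primitive {F : Type*} [NormedAddCommGroup F] [NormedSpace ℝ F] [CompleteSpace F]
    {f : ℝ → F} {t₁ : ℝ} (ht₁ : 0 ≤ t₁) (hf : ContinuousOn f (Icc 0 t₁)) :
    ∃ J J' : ℝ → F, Continuous J' ∧ (∀ t, HasDerivAt J (J' t) t) ∧
      ∀ t ∈ Icc 0 t₁, J' t = f t ∧ J t = ∫ s in (0 : ℝ)..t, f s := by
  -- The extension, constant outside the interval, makes the primitive differentiable from both
  -- sides at every point, endpoints included.
  set f' : ℝ → F := IccExtend ht₁ ((Icc (0 : ℝ) t₁).domRestrict f) with hf'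
  have hc : Continuous f' := (continuousOn_iff_continuous_domRestrict.1 hf).Icc_extend'
  have he : ∀ t ∈ Icc 0 t₁, f' t = f t := fun t ht => by
    rw [hf', IccExtend_of_mem _ _ ht, domRestrict_apply]
  refine ⟨fun t => ∫ s in (0 : ℝ)..t, f' s, f', hc,
    fun t => (hc.integral_hasStrictDerivAt 0 t).hasDerivAt, fun t ht => ⟨he t ht, ?_⟩⟩
  refine intervalIntegral.integral_congr fun s hs => ?_
  rw [uIcc_of_le ht.1] at hs
  exact he s ⟨hs.1, hs.2.trans ht.2⟩

/-- The input cancels in the difference of a second moment and the product of the first moments. -/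
theorem secondMoment_sub_mul_eq {a b t₁ m₁₀ m₂₀ N₀ : ℝ} {γ₁ γ₂ m₁ m₂ N : ℝ → ℝ}
    (hγ₁ : ContinuousOn γ₁ (Icc 0 t₁)) (hγ₂ : ContinuousOn γ₂ (Icc 0 t₁))
    (h₁ : ∀ t ∈ Icc 0 t₁, m₁ t = Real.exp (-(a * t)) * m₁₀ +
      ∫ s in (0 : ℝ)..t, Real.exp (-(a * (t - s))) * γ₁ s)
    (h₂ : ∀ t ∈ Icc 0 t₁, m₂ t = Real.exp (-(b * t)) * m₂₀ +
      ∫ s in (0 : ℝ)..t, Real.exp (-(b * (t - s))) * γ₂ s)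
    (hN : ∀ t ∈ Icc 0 t₁, N t = Real.exp (-((a + b) * t)) * N₀ +
      ∫ s in (0 : ℝ)..t, Real.exp (-((a + b) * (t - s))) * (γ₁ s * m₂ s + γ₂ s * m₁ s))
    {t : ℝ} (ht : t ∈ Icc 0 t₁) :
    N t - m₁ t * m₂ t = Real.exp (-((a + b) * t)) * (N₀ - m₁₀ * m₂₀) := by
  have hsplit : ∀ (κ t : ℝ) (f : ℝ → ℝ), ∫ s in (0 : ℝ)..t, Real.exp (-(κ * (t - s))) * f s =
      Real.exp (-(κ * t)) * ∫ s in (0 : ℝ)..t, Real.exp (κ * s) * f s := by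
    intro κ t f
    rw [← intervalIntegral.integral_const_mul]
    refine intervalIntegral.integral_congr fun s _ => ?_
    rw [← mul_assoc, ← Real.exp_add]
    congr 2; ring
  have hexp : ∀ κ : ℝ, Continuous fun s => Real.exp (κ * s) := fun κ => by fun_prop
  have h0 : 0 ≤ t₁ := ht.1.trans ht.2
  obtain ⟨I₁, I₁', c₁, d₁, e₁⟩ := exists_primitive h0
    (f := fun s => Real.exp (a * s) * γ₁ s) ((hexp a).continuousOn.mul hγ₁)
  obtain ⟨I₂, I₂', c₂, d₂, e₂⟩ := exists_primitive h0
    (f := fun s => Real.exp (b * s) * γ₂ s) ((hexp b).continuousOn.mul hγ₂)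
  simp only [hsplit] at h₁ h₂ hN
  have f₁ : ∀ s ∈ Icc 0 t₁, m₁ s = Real.exp (-(a * s)) * (m₁₀ + I₁ s) := fun s hs => by
    rw [h₁ s hs, (e₁ s hs).2, mul_add]
  have f₂ : ∀ s ∈ Icc 0 t₁, m₂ s = Real.exp (-(b * s)) * (m₂₀ + I₂ s) := fun s hs => by
    rw [h₂ s hs, (e₂ s hs).2, mul_add]
  -- With `m₁ = e^{-at}(m₁₀ + I₁)` and `m₂ = e^{-bt}(m₂₀ + I₂)`, this derivative is `e^{(a+b)s}(γ₁
  -- m₂ + γ₂ m₁)`, the integrand in the equation for `N` after its exponential is split.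
  have hd : ∀ s, HasDerivAt (fun s => (m₁₀ + I₁ s) * (m₂₀ + I₂ s))
      (I₁' s * (m₂₀ + I₂ s) + (m₁₀ + I₁ s) * I₂' s) s := fun s =>
    ((d₁ s).const_add m₁₀).fun_mul ((d₂ s).const_add m₂₀)
  have k₁ : Continuous I₁ := continuous_iff_continuousAt.2 fun s => (d₁ s).continuousAt
  have k₂ : Continuous I₂ := continuous_iff_continuousAt.2 fun s => (d₂ s).continuousAt
  have ftc := intervalIntegral.integral_eq_sub_of_hasDerivAt (a := 0) (b := t) (fun s _ => hd s)
    ((by fun_prop : Continuous fun s =>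
      I₁' s * (m₂₀ + I₂ s) + (m₁₀ + I₁ s) * I₂' s).intervalIntegrable 0 t)
  have hint : ∫ s in (0 : ℝ)..t, Real.exp ((a + b) * s) * (γ₁ s * m₂ s + γ₂ s * m₁ s) =
      ∫ s in (0 : ℝ)..t, (I₁' s * (m₂₀ + I₂ s) + (m₁₀ + I₁ s) * I₂' s) := by
    refine intervalIntegral.integral_congr fun s hs => ?_
    rw [uIcc_of_le ht.1] at hs
    have hs' : s ∈ Icc 0 t₁ := ⟨hs.1, hs.2.trans ht.2⟩
    have x₁ : Real.exp (a * s) * Real.exp (-(a * s)) = 1 := by rw [← Real.exp_add]; simp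
    have x₂ : Real.exp (b * s) * Real.exp (-(b * s)) = 1 := by rw [← Real.exp_add]; simp
    simp only [(e₁ s hs').1, (e₂ s hs').1, f₁ s hs', f₂ s hs', add_mul, Real.exp_add]
    linear_combination Real.exp (a * s) * γ₁ s * (m₂₀ + I₂ s) * x₂ +
      Real.exp (b * s) * γ₂ s * (m₁₀ + I₁ s) * x₁
  have z : I₁ 0 = 0 ∧ I₂ 0 = 0 := by
    rw [(e₁ 0 ⟨le_rfl, h0⟩).2, (e₂ 0 ⟨le_rfl, h0⟩).2]; simp
  rw [hN t ht, hint, ftc, f₁ t ht, f₂ t ht, z.1, z.2, add_mul, neg_add, Real.exp_add]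
  ring

/-- The mean values of the coordinates with respect to a basis. -/
noncomputable def coordMean {n : ℕ} (v : OrthonormalBasis (Fin n) ℝ (EuclideanSpace ℝ (Fin n)))
    (f : EuclideanSpace ℝ (Fin n) → ℝ) (k : Fin n) : ℝ := ∫ x, f x * ⟪v k, x⟫_ℝ

/-- The covariances of the coordinates with respect to a basis. -/
noncomputable def coordCov {n : ℕ} (v : OrthonormalBasis (Fin n) ℝ (EuclideanSpace ℝ (Fin n)))
    (f : EuclideanSpace ℝ (Fin n) → ℝ) : Matrix (Fin n) (Fin n) ℝ :=
  Matrix.of fun k l => (∫ x, f x * (⟪v k, x⟫_ℝ * ⟪v l, x⟫_ℝ)) - coordMean v f k * coordMean v f l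

namespace OUParams
variable {n : ℕ} {S : OUParams n}

theorem hasTemperateGrowth_coord (i : Fin n) :
    (fun x : EuclideanSpace ℝ (Fin n) => x i).HasTemperateGrowth :=
  (EuclideanSpace.proj (𝕜 := ℝ) i).hasTemperateGrowth

theorem integrable_stateSpace (f : S.StateSpace) : Integrable f := by
  simpa using integrable_mul f (w := fun _ => 1) (.const 1)

theorem hasSecondMoments (f : S.StateSpace) : HasSecondMoments f := by
  refine ⟨integrable_stateSpace f, fun i => ?_, fun i j => ?_⟩
  · simpa only [mul_comm] using integrable_mul f (hasTemperateGrowth_coord i)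
  · have h1 := hasTemperateGrowth_coord i
    have h2 := hasTemperateGrowth_coord j
    simpa only [mul_comm (f _)] using integrable_mul f
      (w := fun x => (x i - meanValue f i) * (x j - meanValue f j)) (by fun_prop)

/-- Expansion of `x` in the basis `v`. Mass one turns each centred second moment into a second
moment minus a product of means, as `coordCov` has it. -/
theorem covMatrix_eq (v : OrthonormalBasis (Fin n) ℝ (EuclideanSpace ℝ (Fin n)))
    (f : S.StateSpace) (hf : ∫ x, f x = 1) :
    covMatrix f = eigenvectorMatrix v * coordCov v f * (eigenvectorMatrix v).transpose := by
  have hx : ∀ (x : EuclideanSpace ℝ (Fin n)) i, x i = ∑ k, ⟪v k, x⟫_ℝ * v k i := fun x i => by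
    conv_lhs => rw [← v.sum_repr' x]
    simp
  have i1 : ∀ k, Integrable fun x => f x * ⟪v k, x⟫_ℝ := fun k => integrable_mul f (by fun_prop)
  have i2 : ∀ k l, Integrable fun x => f x * (⟪v k, x⟫_ℝ * ⟪v l, x⟫_ℝ) := fun k l =>
    integrable_mul f (by fun_prop)
  have i0 := integrable_stateSpace f
  have hmean : ∀ i, meanValue f i = ∑ k, coordMean v f k * v k i := fun i => by
    simp only [meanValue, coordMean, ← integral_mul_const]
    rw [← integral_finsetSum _ fun k _ => (i1 k).mul_const _]
    refine integral_congr_ae (Eventually.of_forall fun x => ?_)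
    simp only
    rw [hx x i, Finset.sum_mul]
    exact Finset.sum_congr rfl fun k _ => by ring
  have hcc : ∀ k l, Integrable (fun x => f x * ((⟪v k, x⟫_ℝ - coordMean v f k) *
      (⟪v l, x⟫_ℝ - coordMean v f l))) ∧ ∫ x, f x * ((⟪v k, x⟫_ℝ - coordMean v f k) *
      (⟪v l, x⟫_ℝ - coordMean v f l)) = coordCov v f k l := fun k l => by
    refine ⟨integrable_mul f (by fun_prop), ?_⟩
    set a := coordMean v f k with ha
    set b := coordMean v f l with hb
    have e : ∀ x, f x * ((⟪v k, x⟫_ℝ - a) * (⟪v l, x⟫_ℝ - b)) =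
        f x * (⟪v k, x⟫_ℝ * ⟪v l, x⟫_ℝ) - (b * (f x * ⟪v k, x⟫_ℝ) +
          (a * (f x * ⟪v l, x⟫_ℝ) - a * b * f x)) := fun x => by ring
    have j1 : Integrable fun x => a * (f x * ⟪v l, x⟫_ℝ) - a * b * f x :=
      ((i1 l).const_mul _).sub (i0.const_mul _)
    have j2 : Integrable fun x => b * (f x * ⟪v k, x⟫_ℝ) +
        (a * (f x * ⟪v l, x⟫_ℝ) - a * b * f x) := ((i1 k).const_mul _).add j1
    have hcov : coordCov v f k l = (∫ x, f x * (⟪v k, x⟫_ℝ * ⟪v l, x⟫_ℝ)) - a * b := rfl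
    simp only [e]
    rw [integral_sub (i2 k l) j2, integral_add ((i1 k).const_mul _) j1,
      integral_sub ((i1 l).const_mul _) (i0.const_mul _), integral_const_mul, integral_const_mul,
      integral_const_mul, hf, hcov, show ∫ x, f x * ⟪v k, x⟫_ℝ = a from rfl,
      show ∫ x, f x * ⟪v l, x⟫_ℝ = b from rfl]
    ring
  ext i j
  simp only [covMatrix, Matrix.of_apply, Matrix.mul_apply, Matrix.transpose_apply,
    eigenvectorMatrix, ← (hcc _ _).2, Finset.sum_mul]
  have e : ∀ x : EuclideanSpace ℝ (Fin n),
      (x i - meanValue f i) * (x j - meanValue f j) * f x =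
        ∑ l, ∑ k, f x * ((⟪v k, x⟫_ℝ - coordMean v f k) * (⟪v l, x⟫_ℝ - coordMean v f l)) *
          (v k i * v l j) := fun x => by
    rw [hx x i, hx x j, hmean, hmean, ← Finset.sum_sub_distrib, ← Finset.sum_sub_distrib,
      Finset.sum_mul_sum, Finset.sum_comm, Finset.sum_mul]
    refine Finset.sum_congr rfl fun l _ => ?_
    rw [Finset.sum_mul]
    exact Finset.sum_congr rfl fun k _ => by ring
  simp only [e]
  rw [integral_finsetSum _ fun l _ => integrable_finsetSum _ fun k _ =>
    (hcc k l).1.mul_const _]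
  refine Finset.sum_congr rfl fun l _ => ?_
  rw [integral_finsetSum _ fun k _ => (hcc k l).1.mul_const _]
  refine Finset.sum_congr rfl fun k _ => ?_
  rw [integral_mul_const]
  ring

section Mild
variable {v : OrthonormalBasis (Fin n) ℝ (EuclideanSpace ℝ (Fin n))} {lam : Fin n → ℝ}
  {g : EuclideanSpace ℝ (Fin n) → EuclideanSpace ℝ (Fin n)}
  {u : ℝ → EuclideanSpace ℝ (Fin n)} {p₀ : S.StateSpace} {t₁ : ℝ} {p : ℝ → S.StateSpace}

/-- Conservation of mass. -/
theorem IsMildSolutionOn.integral_eq (hp : S.IsMildSolutionOn g u (fun _ => 0) p₀ t₁ p)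
    (hg : Continuous g) (hu : ContinuousOn u (Ici 0)) {t : ℝ} (ht : t ∈ Icc 0 t₁) :
    ∫ x, p t x = ∫ x, p₀ x := by
  simpa using hp.integral_mul_eigenfunction hg hu isTestFunction_one ht

/-- Mass one makes `γ_k = ⟨g(u), v_k⟩` the input of the first moments, and the gradient of the
quadratic eigenfunction gives the second moments the input `γ_k m_l + γ_l m_k`. These are the
hypotheses of `secondMoment_sub_mul_eq`, with `a = cλ_k` and `b = cλ_l`. -/
theorem IsMildSolutionOn.coordCov_eq (hp : S.IsMildSolutionOn g u (fun _ => 0) p₀ t₁ p)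
    (hg : Continuous g) (hu : ContinuousOn u (Ici 0))
    (hv : ∀ k, S.Γ.mulVec (v k).ofLp = (S.c * lam k) • (v k).ofLp) (hp₀ : ∫ x, p₀ x = 1)
    (k l : Fin n) {t : ℝ} (ht : t ∈ Icc 0 t₁) :
    coordCov v (p t) k l - ⟪v k, v l⟫_ℝ / lam k =
      Real.exp (-((S.c * lam k + S.c * lam l) * t)) *
        (coordCov v p₀ k l - ⟪v k, v l⟫_ℝ / lam k) := by
  have hγ : ∀ k, ContinuousOn (fun s => ⟪g (u s), v k⟫_ℝ) (Icc 0 t₁) := fun k =>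
    ((hg.comp_continuousOn (hu.mono fun s (hs : s ∈ Icc 0 t₁) => hs.1)).inner continuousOn_const)
  have h1 : ∀ k, ∀ t ∈ Icc 0 t₁, coordMean v (p t) k = Real.exp (-(S.c * lam k * t)) *
      coordMean v p₀ k +
      ∫ s in (0 : ℝ)..t, Real.exp (-(S.c * lam k * (t - s))) * ⟪g (u s), v k⟫_ℝ := by
    intro k t ht
    rw [coordMean, hp.integral_mul_eigenfunction hg hu (isTestFunction_linear hv k) ht]
    congr 1
    refine intervalIntegral.integral_congr fun s hs => ?_
    rw [uIcc_of_le ht.1] at hs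
    simp only [integral_mul_const]
    rw [hp.integral_eq hg hu ⟨hs.1, hs.2.trans ht.2⟩, hp₀, one_mul]
  have i1 : ∀ (f : S.StateSpace) k, Integrable fun x => f x * ⟪v k, x⟫_ℝ := fun f k =>
    integrable_mul f (by fun_prop)
  have h2 : ∀ (f : S.StateSpace), ∫ x, f x = 1 →
      ∫ x, f x * (⟪v k, x⟫_ℝ * ⟪v l, x⟫_ℝ - ⟪v k, v l⟫_ℝ / lam k) =
        (∫ x, f x * (⟪v k, x⟫_ℝ * ⟪v l, x⟫_ℝ)) - ⟪v k, v l⟫_ℝ / lam k := by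
    intro f hf
    simp only [mul_sub]
    rw [integral_sub (integrable_mul f (by fun_prop)) ((integrable_stateSpace f).mul_const _),
      integral_mul_const, hf, one_mul]
  have h3 := secondMoment_sub_mul_eq (N₀ := ∫ x, p₀ x * (⟪v k, x⟫_ℝ * ⟪v l, x⟫_ℝ -
      ⟪v k, v l⟫_ℝ / lam k))
    (N := fun t => ∫ x, p t x * (⟪v k, x⟫_ℝ * ⟪v l, x⟫_ℝ - ⟪v k, v l⟫_ℝ / lam k))
    (hγ k) (hγ l) (h1 k) (h1 l) (fun t ht => by
      have h4 := hp.integral_mul_eigenfunction hg hu (isTestFunction_quadratic hv k l) ht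
      rw [mul_add] at h4
      rw [h4]
      congr 1
      refine intervalIntegral.integral_congr fun s hs => ?_
      congr 1
      simp only [coordMean, ← integral_const_mul]
      rw [← integral_add ((i1 (p s) l).const_mul _) ((i1 (p s) k).const_mul _)]
      refine integral_congr_ae (Eventually.of_forall fun x => ?_)
      simp only [inner_add_right, real_inner_smul_right]
      ring) ht
  rw [h2 _ hp₀, h2 _ ((hp.integral_eq hg hu ht).trans hp₀)] at h3
  simp only [coordCov, Matrix.of_apply]
  linear_combination h3

end Mild

end OUParams
end FokkerPlanck

/-! ### The covariance matrix: formula and convergence -/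

namespace FokkerPlanck

theorem eigenvectorMatrix_mul_transpose {n : ℕ}
    (v : OrthonormalBasis (Fin n) ℝ (EuclideanSpace ℝ (Fin n))) :
    eigenvectorMatrix v * (eigenvectorMatrix v).transpose = 1 := by
  rw [mul_eq_one_comm]
  ext k l
  have h := orthonormal_iff_ite.1 v.orthonormal k l
  rw [Matrix.one_apply, ← h, PiLp.inner_apply]
  simp [Matrix.mul_apply, eigenvectorMatrix, mul_comm]

theorem abs_basis_apply_le_one {n : ℕ}
    (v : OrthonormalBasis (Fin n) ℝ (EuclideanSpace ℝ (Fin n))) (k i : Fin n) : |v k i| ≤ 1 := by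
  have := PiLp.norm_apply_le (v k) i
  rwa [v.norm_eq_one] at this

theorem exp_smul_lambdaMatrix {n : ℕ} (t : ℝ) (lam : Fin n → ℝ) :
    NormedSpace.exp (t • lambdaMatrix lam) = Matrix.diagonal fun k => Real.exp (t * lam k) := by
  rw [lambdaMatrix, ← Matrix.diagonal_smul, Matrix.exp_diagonal]
  congr 1
  funext k
  rw [Pi.coe_exp, Real.exp_eq_exp_ℝ]
  rfl

theorem rMatrix_inv {n : ℕ} {lam : Fin n → ℝ} (h : ∀ k, 0 < lam k) :
    (rMatrix lam)⁻¹ = Matrix.diagonal fun k => (√(lam k / 2))⁻¹ := by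
  refine Matrix.inv_eq_right_inv ?_
  rw [rMatrix, Matrix.diagonal_mul_diagonal, ← Matrix.diagonal_one]
  congr 1
  funext k
  exact mul_inv_cancel₀ (Real.sqrt_pos.2 (half_pos (h k))).ne'

namespace OUParams
variable {n : ℕ} {S : OUParams n} {v : OrthonormalBasis (Fin n) ℝ (EuclideanSpace ℝ (Fin n))}
  {lam : Fin n → ℝ}

theorem smul_inv_eq (hv : ∀ k, S.Γ.mulVec (v k).ofLp = (S.c * lam k) • (v k).ofLp) :
    S.c • S.Γ⁻¹ = eigenvectorMatrix v * Matrix.diagonal (fun k => (lam k)⁻¹) *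
      (eigenvectorMatrix v).transpose := by
  have hc := S.c_pos.ne'
  have h1 : S.Γ * eigenvectorMatrix v =
      eigenvectorMatrix v * Matrix.diagonal fun k => S.c * lam k := by
    ext i k
    have := congrFun (hv k) i
    rw [Matrix.mul_diagonal]
    simp only [Pi.smul_apply, smul_eq_mul] at this
    rw [mul_comm]
    exact this
  have h2 : S.Γ⁻¹ = eigenvectorMatrix v * Matrix.diagonal (fun k => (S.c * lam k)⁻¹) *
      (eigenvectorMatrix v).transpose := by
    refine Matrix.inv_eq_right_inv ?_
    rw [← Matrix.mul_assoc, ← Matrix.mul_assoc, h1, Matrix.mul_assoc (eigenvectorMatrix v),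
      Matrix.diagonal_mul_diagonal]
    have h3 : (fun k => S.c * lam k * (S.c * lam k)⁻¹) = fun _ => 1 := funext fun k =>
      mul_inv_cancel₀ (mul_ne_zero hc (eigenvalue_pos hv k).ne')
    rw [h3, Matrix.diagonal_one, Matrix.mul_one, eigenvectorMatrix_mul_transpose]
  have h4 : Matrix.diagonal (fun k => (lam k)⁻¹) =
      S.c • Matrix.diagonal fun k => (S.c * lam k)⁻¹ := by
    rw [← Matrix.diagonal_smul]
    congr 1
    funext k
    simp only [Pi.smul_apply, smul_eq_mul, mul_inv, mul_inv_cancel_left₀ hc]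
  rw [h2, h4, Matrix.mul_smul, Matrix.smul_mul]

variable {g : EuclideanSpace ℝ (Fin n) → EuclideanSpace ℝ (Fin n)}
  {u : ℝ → EuclideanSpace ℝ (Fin n)} {p₀ : S.StateSpace} {t₁ : ℝ} {p : ℝ → S.StateSpace}

theorem IsMildSolutionOn.coordCov_eq_diagonal
    (hp : S.IsMildSolutionOn g u (fun _ => 0) p₀ t₁ p) (hg : Continuous g)
    (hu : ContinuousOn u (Ici 0))
    (hv : ∀ k, S.Γ.mulVec (v k).ofLp = (S.c * lam k) • (v k).ofLp) (hp₀ : ∫ x, p₀ x = 1)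
    {t : ℝ} (ht : t ∈ Icc 0 t₁) (k l : Fin n) :
    coordCov v (p t) k l = Real.exp (-(S.c * t) * lam k) *
      (coordCov v p₀ - Matrix.diagonal fun k => (lam k)⁻¹) k l *
      Real.exp (-(S.c * t) * lam l) + Matrix.diagonal (fun k => (lam k)⁻¹) k l := by
  have h1 : ⟪v k, v l⟫_ℝ / lam k = Matrix.diagonal (fun k => (lam k)⁻¹) k l := by
    rw [orthonormal_iff_ite.1 v.orthonormal, Matrix.diagonal_apply]
    split_ifs <;> simp
  have h2 := hp.coordCov_eq hg hu hv hp₀ k l ht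
  rw [h1] at h2
  rw [Matrix.sub_apply, mul_right_comm, ← Real.exp_add,
    show -(S.c * t) * lam k + -(S.c * t) * lam l = -((S.c * lam k + S.c * lam l) * t) by ring]
  linarith

/-- Here `K = 4 R (C₀ - Λ⁻¹) R`, with `C₀` the initial covariance in the eigenbasis. Diagonal
matrices commute, so the outer factors `R⁻¹` cancel those in `K`, and `2 R⁻² = 4 Λ⁻¹` accounts for
the stationary part. -/
theorem IsMildSolutionOn.covMatrix_eq_formula
    (hp : S.IsMildSolutionOn g u (fun _ => 0) p₀ t₁ p) (hg : Continuous g)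
    (hu : ContinuousOn u (Ici 0))
    (hv : ∀ k, S.Γ.mulVec (v k).ofLp = (S.c * lam k) • (v k).ofLp) (hp₀ : ∫ x, p₀ x = 1)
    {t : ℝ} (ht : t ∈ Icc 0 t₁) :
    covMatrix (p t) = (1 / 4 : ℝ) • (eigenvectorMatrix v * (rMatrix lam)⁻¹ *
      (NormedSpace.exp (-(S.c * t) • lambdaMatrix lam) *
        ((4 : ℝ) • (rMatrix lam * (coordCov v p₀ - Matrix.diagonal fun k => (lam k)⁻¹) *
          rMatrix lam)) *
        NormedSpace.exp (-(S.c * t) • lambdaMatrix lam) +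
        (2 : ℝ) • (1 : Matrix (Fin n) (Fin n) ℝ)) *
      (rMatrix lam)⁻¹ * (eigenvectorMatrix v).transpose) := by
  rw [covMatrix_eq v (p t) ((hp.integral_eq hg hu ht).trans hp₀)]
  have hpos := fun k => eigenvalue_pos hv k
  have key : coordCov v (p t) = (1 / 4 : ℝ) • ((rMatrix lam)⁻¹ *
      (NormedSpace.exp (-(S.c * t) • lambdaMatrix lam) *
        ((4 : ℝ) • (rMatrix lam * (coordCov v p₀ - Matrix.diagonal fun k => (lam k)⁻¹) *
          rMatrix lam)) *
        NormedSpace.exp (-(S.c * t) • lambdaMatrix lam) +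
        (2 : ℝ) • (1 : Matrix (Fin n) (Fin n) ℝ)) * (rMatrix lam)⁻¹) := by
    rw [rMatrix_inv hpos, exp_smul_lambdaMatrix, rMatrix]
    ext k l
    rw [hp.coordCov_eq_diagonal hg hu hv hp₀ ht]
    have hk : √(lam k / 2) ≠ 0 := (Real.sqrt_pos.2 (half_pos (hpos k))).ne'
    have hl : √(lam l / 2) ≠ 0 := (Real.sqrt_pos.2 (half_pos (hpos l))).ne'
    simp only [Matrix.smul_apply, Matrix.diagonal_mul, Matrix.mul_diagonal, Matrix.add_apply,
      smul_eq_mul]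
    have h1 : Matrix.diagonal (fun k => (lam k)⁻¹) k l =
        1 / 4 * ((√(lam k / 2))⁻¹ * (2 * (1 : Matrix (Fin n) (Fin n) ℝ) k l) *
          (√(lam l / 2))⁻¹) := by
      rw [Matrix.diagonal_apply, Matrix.one_apply]
      split_ifs with h
      · subst h
        have := Real.mul_self_sqrt (half_pos (hpos k)).le
        have hkk := (hpos k).ne'
        rw [mul_one, mul_right_comm, ← mul_inv, this]
        field_simp
        norm_num
      · simp
    rw [h1]
    field_simp
  rw [key]
  simp only [Matrix.mul_smul, Matrix.smul_mul, Matrix.mul_assoc]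

/-- The smallest eigenvalue of `Γ`, or `1` if `n = 0`. -/
theorem exists_rate (hv : ∀ k, S.Γ.mulVec (v k).ofLp = (S.c * lam k) • (v k).ofLp) :
    ∃ r : ℝ, 0 < r ∧ ∀ k, r ≤ S.c * lam k := by
  rcases isEmpty_or_nonempty (Fin n) with h | h
  · exact ⟨1, one_pos, fun k => h.elim k⟩
  · obtain ⟨k, hk⟩ := Finite.exists_min lam
    exact ⟨S.c * lam k, mul_pos S.c_pos (eigenvalue_pos hv k), fun j =>
      mul_le_mul_of_nonneg_left (hk j) S.c_pos.le⟩

/-- Each entry of the deviation in the eigenbasis carries two exponentials, each at most `e^{-rt}`.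
The entries of the change of basis are at most one in absolute value, so the sum of the absolute
initial entries is a sufficient constant. -/
theorem IsMildSolutionOn.abs_covMatrix_sub_le
    (hp : S.IsMildSolutionOn g u (fun _ => 0) p₀ t₁ p) (hg : Continuous g)
    (hu : ContinuousOn u (Ici 0))
    (hv : ∀ k, S.Γ.mulVec (v k).ofLp = (S.c * lam k) • (v k).ofLp) (hp₀ : ∫ x, p₀ x = 1)
    {r : ℝ} (hr : ∀ k, r ≤ S.c * lam k) {t : ℝ} (ht : t ∈ Icc 0 t₁) (i j : Fin n) :
    |covMatrix (p t) i j - (S.c • S.Γ⁻¹) i j| ≤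
      (∑ l, ∑ k, |(coordCov v p₀ - Matrix.diagonal fun k => (lam k)⁻¹) k l|) *
        Real.exp (-(2 * r * t)) := by
  rw [covMatrix_eq v (p t) ((hp.integral_eq hg hu ht).trans hp₀), smul_inv_eq hv,
    ← Matrix.sub_apply, ← Matrix.sub_mul, ← Matrix.mul_sub, Matrix.mul_apply]
  simp only [Matrix.mul_apply, Finset.sum_mul]
  refine (Finset.abs_sum_le_sum_abs _ _).trans (Finset.sum_le_sum fun l _ => ?_)
  refine (Finset.abs_sum_le_sum_abs _ _).trans (Finset.sum_le_sum fun k _ => ?_)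
  set D := coordCov v p₀ - Matrix.diagonal fun k => (lam k)⁻¹ with hD
  rw [Matrix.sub_apply, hp.coordCov_eq_diagonal hg hu hv hp₀ ht, add_sub_cancel_right,
    mul_right_comm (Real.exp _), ← Real.exp_add, abs_mul, abs_mul, abs_mul,
    abs_of_pos (Real.exp_pos _)]
  have h1 : Real.exp (-(S.c * t) * lam k + -(S.c * t) * lam l) ≤ Real.exp (-(2 * r * t)) := by
    rw [Real.exp_le_exp]
    nlinarith [mul_le_mul_of_nonneg_right (hr k) ht.1, mul_le_mul_of_nonneg_right (hr l) ht.1]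
  have h2 := abs_basis_apply_le_one v k i
  have h3 := abs_basis_apply_le_one v l j
  change |v k i| * (Real.exp (-(S.c * t) * lam k + -(S.c * t) * lam l) * |D k l|) * |v l j| ≤ _
  calc |v k i| * (Real.exp (-(S.c * t) * lam k + -(S.c * t) * lam l) * |D k l|) * |v l j|
      ≤ 1 * (Real.exp (-(2 * r * t)) * |D k l|) * 1 := by gcongr
    _ = |D k l| * Real.exp (-(2 * r * t)) := by ring

end OUParams
end FokkerPlanck

/-! ### Plane waves and Mehler's formula -/

namespace FokkerPlanck

/-- Mean value inequality for `s ↦ cos(α + s) + s sin α`, whose derivative is at most `|δ|` between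
`0` and `δ` as `sin` is 1-Lipschitz. The bound is uniform in `α`, which lets it pass to `L²`. -/
theorem abs_cos_sub_cos_add_sin_mul_le (α δ : ℝ) :
    |Real.cos (α + δ) - Real.cos α + Real.sin α * δ| ≤ δ ^ 2 := by
  have hd : ∀ s ∈ uIcc 0 δ, HasDerivWithinAt
      (fun s => Real.cos (α + s) + Real.sin α * s) (-Real.sin (α + s) + Real.sin α)
      (uIcc 0 δ) s := fun s _ => by
    have h1 : HasDerivAt (fun s => Real.cos (α + s)) (-Real.sin (α + s) * 1) s :=
      (Real.hasDerivAt_cos _).comp s ((hasDerivAt_id s).const_add α)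
    have h2 : HasDerivAt (fun s : ℝ => Real.sin α * s) (Real.sin α * 1) s :=
      (hasDerivAt_id s).const_mul _
    simpa using (h1.fun_add h2).hasDerivWithinAt
  have hb : ∀ s ∈ uIcc 0 δ, ‖-Real.sin (α + s) + Real.sin α‖ ≤ |δ| := fun s hs => by
    have h1 := Real.lipschitzWith_sin.dist_le_mul α (α + s)
    rw [Real.dist_eq, Real.dist_eq] at h1
    have h2 : |s| ≤ |δ| := by simpa using abs_sub_left_of_mem_uIcc hs
    rw [Real.norm_eq_abs, neg_add_eq_sub]
    simp only [NNReal.coe_one, one_mul, sub_add_cancel_left, abs_neg] at h1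
    exact h1.trans h2
  have h := (convex_uIcc 0 δ).norm_image_sub_le_of_norm_hasDerivWithin_le hd hb
    left_mem_uIcc right_mem_uIcc
  simp only [add_zero, mul_zero, sub_zero, Real.norm_eq_abs] at h
  rw [← sq_abs, sq, show Real.cos (α + δ) - Real.cos α + Real.sin α * δ =
    Real.cos (α + δ) + Real.sin α * δ - Real.cos α by ring]
  exact h

/-- The diagonal operator with entries `d` in an orthonormal basis. -/
noncomputable def diagOp {n : ℕ} (v : OrthonormalBasis (Fin n) ℝ (EuclideanSpace ℝ (Fin n)))
    (d : Fin n → ℝ) : EuclideanSpace ℝ (Fin n) →L[ℝ] EuclideanSpace ℝ (Fin n) :=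
  ∑ k, d k • (innerSL ℝ (v k)).smulRight (v k)

section DiagOp
variable {n : ℕ} (v : OrthonormalBasis (Fin n) ℝ (EuclideanSpace ℝ (Fin n))) (d d' : Fin n → ℝ)
  (x y : EuclideanSpace ℝ (Fin n))

theorem diagOp_apply : diagOp v d x = ∑ k, (d k * ⟪v k, x⟫_ℝ) • v k := by
  simp [diagOp, smul_smul]

theorem inner_diagOp (k : Fin n) : ⟪v k, diagOp v d x⟫_ℝ = d k * ⟪v k, x⟫_ℝ := by
  rw [diagOp_apply, inner_sum, Finset.sum_eq_single k]
  · rw [real_inner_smul_right, real_inner_self_eq_norm_sq, v.norm_eq_one]; ring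
  · intro j _ hj
    rw [real_inner_smul_right, v.inner_eq_zero hj.symm, mul_zero]
  · simp

theorem inner_diagOp_left : ⟪diagOp v d x, y⟫_ℝ = ⟪x, diagOp v d y⟫_ℝ := by
  rw [← v.sum_inner_mul_inner, ← v.sum_inner_mul_inner]
  refine Finset.sum_congr rfl fun k _ => ?_
  rw [inner_diagOp, real_inner_comm, inner_diagOp, real_inner_comm (v k) x]
  ring

theorem norm_diagOp_sq : ‖diagOp v d x‖ ^ 2 = ∑ k, d k ^ 2 * ⟪v k, x⟫_ℝ ^ 2 := by
  rw [← v.sum_sq_norm_inner_right]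
  refine Finset.sum_congr rfl fun k _ => ?_
  rw [inner_diagOp, Real.norm_eq_abs, sq_abs, mul_pow]

theorem diagOp_diagOp : diagOp v d (diagOp v d' x) = diagOp v (fun k => d k * d' k) x := by
  simp only [diagOp_apply v d, inner_diagOp, diagOp_apply v (fun k => d k * d' k), mul_assoc]

theorem diagOp_one : diagOp v (fun _ => 1) x = x := by
  rw [diagOp_apply]
  simpa using v.sum_repr' x

variable {v d x} in
theorem hasDerivAt_diagOp {e : ℝ → Fin n → ℝ} {e' : Fin n → ℝ} {t : ℝ}
    (h : ∀ k, HasDerivAt (fun t => e t k) (e' k) t) :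
    HasDerivAt (fun t => diagOp v (e t) x) (diagOp v e' x) t := by
  simp only [diagOp_apply]
  exact HasDerivAt.fun_sum fun k _ => ((h k).mul_const _).smul_const _

end DiagOp

namespace OUParams
variable {n : ℕ} {S : OUParams n}

theorem temp_cos (η : EuclideanSpace ℝ (Fin n)) (θ : ℝ) :
    (fun x => Real.cos (⟪η, x⟫_ℝ + θ)).HasTemperateGrowth :=
  hasTemperateGrowth_cos.comp (by fun_prop : (fun x => ⟪η, x⟫_ℝ + θ).HasTemperateGrowth)

theorem temp_sin (η : EuclideanSpace ℝ (Fin n)) (θ : ℝ) :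
    (fun x => Real.sin (⟪η, x⟫_ℝ + θ)).HasTemperateGrowth :=
  hasTemperateGrowth_sin.comp (by fun_prop : (fun x => ⟪η, x⟫_ℝ + θ).HasTemperateGrowth)

theorem temp_sin_mul (η : EuclideanSpace ℝ (Fin n)) (θ : ℝ) (η' : EuclideanSpace ℝ (Fin n)) :
    (fun x => -(Real.sin (⟪η, x⟫_ℝ + θ) * ⟪η', x⟫_ℝ)).HasTemperateGrowth :=
  ((temp_sin η θ).fun_mul (by fun_prop)).fun_neg

/-- The gradient has the single direction `η`. The phase `θ` keeps everything real: `0` and `-π/2`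
give the cosine and the sine. -/
theorem isTestFunction_cos (η : EuclideanSpace ℝ (Fin n)) (θ : ℝ) :
    S.IsTestFunction (fun x => Real.cos (⟪η, x⟫_ℝ + θ))
      (fun x => ‖η‖ ^ 2 * Real.cos (⟪η, x⟫_ℝ + θ) +
        -(Real.sin (⟪η, x⟫_ℝ + θ) * fderiv ℝ S.phi x η))
      (fun x => (-Real.sin (⟪η, x⟫_ℝ + θ)) • η) := by
  have hd : ∀ x, HasFDerivAt (fun x => ⟪η, x⟫_ℝ + θ) (innerSL ℝ η) x := fun x =>
    (innerSL ℝ η).hasFDerivAt.add_const θ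
  refine (S.isTestFunction (ι := Unit) (temp_cos η θ)
    (ψ := fun _ x => -Real.sin (⟪η, x⟫_ℝ + θ)) (fun _ => (temp_sin η θ).fun_neg) (fun _ => η)
    fun x => ?_).congr (fun _ => rfl) (fun x => ?_) (by simp)
  · refine (hd x).cos.congr_fderiv ?_
    ext y
    simp
  · have h1 := ((hd x).sin.fun_neg).fderiv
    simp only [Finset.univ_unique, Finset.sum_singleton, h1]
    simp
    ring

/-- The derivative of `η ↦ cos(η · x + θ)` as a map into `L²(e^{-φ})`. -/
noncomputable def cosLpDeriv (S : OUParams n) (θ : ℝ) (η : EuclideanSpace ℝ (Fin n)) :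
    EuclideanSpace ℝ (Fin n) →L[ℝ] S.HSpace :=
  LinearMap.toContinuousLinearMap
    { toFun := fun η' => S.tempLp _ (temp_sin_mul η θ η')
      map_add' := fun a b => by
        rw [← tempLp_add]
        exact tempLp_congr _ _ fun x => by rw [inner_add_left]; ring
      map_smul' := fun r a => by
        rw [RingHom.id_apply, ← tempLp_smul]
        exact tempLp_congr _ _ fun x => by rw [real_inner_smul_left, smul_eq_mul]; ring }

/-- The pointwise Taylor remainder is at most `‖x‖² ‖η' - η‖²`, and `‖x‖²` belongs to `L²(e^{-φ})`.
-/
theorem hasFDerivAt_cosLp (θ : ℝ) (η : EuclideanSpace ℝ (Fin n)) :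
    HasFDerivAt (fun η => S.tempLp _ (temp_cos η θ)) (S.cosLpDeriv θ η) η := by
  have hsq : (fun x : EuclideanSpace ℝ (Fin n) => ‖x‖ ^ 2).HasTemperateGrowth := by fun_prop
  have hle : ∀ η', ‖S.tempLp _ (temp_cos η' θ) - S.tempLp _ (temp_cos η θ) -
      S.cosLpDeriv θ η (η' - η)‖ ≤ ‖S.tempLp _ hsq‖ * ‖η' - η‖ ^ 2 := by
    intro η'
    rw [mul_comm]
    refine Lp.norm_le_mul_norm_of_ae_le_mul ?_
    have h0 : S.cosLpDeriv θ η (η' - η) = S.tempLp _ (temp_sin_mul η θ (η' - η)) := rfl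
    rw [h0]
    filter_upwards [Lp.coeFn_sub (S.tempLp _ (temp_cos η' θ) - S.tempLp _ (temp_cos η θ))
        (S.tempLp _ (temp_sin_mul η θ (η' - η))),
      Lp.coeFn_sub (S.tempLp _ (temp_cos η' θ)) (S.tempLp _ (temp_cos η θ)),
      (S.memLp_of_hasTemperateGrowth (temp_cos η' θ)).coeFn_toLp,
      (S.memLp_of_hasTemperateGrowth (temp_cos η θ)).coeFn_toLp,
      (S.memLp_of_hasTemperateGrowth (temp_sin_mul η θ (η' - η))).coeFn_toLp,
      (S.memLp_of_hasTemperateGrowth hsq).coeFn_toLp] with x h1 h2 h3 h4 h5 h6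
    rw [h1, Pi.sub_apply, h2, Pi.sub_apply]
    simp only [tempLp]
    rw [h3, h4, h5, h6, sub_neg_eq_add, Real.norm_eq_abs, Real.norm_of_nonneg (by positivity)]
    have h7 := abs_cos_sub_cos_add_sin_mul_le (⟪η, x⟫_ℝ + θ) ⟪η' - η, x⟫_ℝ
    rw [show ⟪η, x⟫_ℝ + θ + ⟪η' - η, x⟫_ℝ = ⟪η', x⟫_ℝ + θ by rw [inner_sub_left]; ring] at h7
    refine h7.trans ?_
    rw [← mul_pow, ← sq_abs]
    exact pow_le_pow_left₀ (abs_nonneg _) (abs_real_inner_le_norm _ _) 2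
  rw [hasFDerivAt_iff_isLittleO]
  refine (Asymptotics.IsBigO.of_bound ‖S.tempLp _ hsq‖ (g := fun η' => ‖η' - η‖ ^ 2)
    (Eventually.of_forall fun η' => ?_)).trans_isLittleO ?_
  · rw [Real.norm_of_nonneg (by positivity)]
    exact hle η'
  · refine (Asymptotics.isLittleO_norm_pow_id one_lt_two).comp_tendsto (k := fun η' => η' - η) ?_
    simpa using (continuous_id.sub continuous_const).tendsto (X := EuclideanSpace ℝ (Fin n)) η
      (f := fun η' => η' - η)

section Flow
variable (S) (v : OrthonormalBasis (Fin n) ℝ (EuclideanSpace ℝ (Fin n))) (lam : Fin n → ℝ)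

/-- The flow `e^{-Γ t}`. -/
noncomputable def flow (t : ℝ) : EuclideanSpace ℝ (Fin n) →L[ℝ] EuclideanSpace ℝ (Fin n) :=
  diagOp v fun k => Real.exp (-(S.c * lam k * t))

/-- The quadratic form of the covariance matrix at time `t` of the process started at a point. -/
noncomputable def covForm (t : ℝ) (ξ : EuclideanSpace ℝ (Fin n)) : ℝ :=
  ∑ k, (1 - Real.exp (-(2 * (S.c * lam k) * t))) / lam k * ⟪v k, ξ⟫_ℝ ^ 2

theorem flow_zero (ξ : EuclideanSpace ℝ (Fin n)) : S.flow v lam 0 ξ = ξ := by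
  simp [flow, diagOp_one]

theorem covForm_zero (ξ : EuclideanSpace ℝ (Fin n)) : S.covForm v lam 0 ξ = 0 := by
  simp [covForm]

theorem flow_flow (s t : ℝ) (ξ : EuclideanSpace ℝ (Fin n)) :
    S.flow v lam s (S.flow v lam t ξ) = S.flow v lam (s + t) ξ := by
  simp only [flow, diagOp_diagOp]
  congr 2
  funext k
  rw [← Real.exp_add]
  congr 1; ring

/-- Cocycle identity along the flow. It expresses the semigroup property of the Gaussian factors in
Mehler's formula. -/
theorem covForm_add (s t : ℝ) (ξ : EuclideanSpace ℝ (Fin n)) :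
    S.covForm v lam t ξ + S.covForm v lam s (S.flow v lam t ξ) = S.covForm v lam (s + t) ξ := by
  simp only [covForm, ← Finset.sum_add_distrib]
  refine Finset.sum_congr rfl fun k _ => ?_
  have h1 : Real.exp (-(2 * (S.c * lam k) * (s + t))) =
      Real.exp (-(2 * (S.c * lam k) * s)) * Real.exp (-(S.c * lam k * t)) ^ 2 := by
    rw [← Real.exp_nat_mul, ← Real.exp_add]; congr 1; push_cast; ring
  have h2 : Real.exp (-(2 * (S.c * lam k) * t)) = Real.exp (-(S.c * lam k * t)) ^ 2 := by
    rw [← Real.exp_nat_mul]; congr 1; push_cast; ring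
  rw [flow, inner_diagOp, h1, h2]
  ring

theorem hasDerivAt_flow (ξ : EuclideanSpace ℝ (Fin n)) (t : ℝ) :
    HasDerivAt (fun t => S.flow v lam t ξ) (-(S.c • diagOp v lam (S.flow v lam t ξ))) t := by
  have h1 : ∀ k, HasDerivAt (fun t : ℝ => Real.exp (-(S.c * lam k * t)))
      (-(S.c * (lam k * Real.exp (-(S.c * lam k * t))))) t := fun k => by
    have h2 : HasDerivAt (fun t : ℝ => -(S.c * lam k * t)) (-(S.c * lam k)) t := by
      simpa using ((hasDerivAt_id t).const_mul (S.c * lam k)).fun_neg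
    refine h2.exp.congr_deriv ?_
    ring
  refine (hasDerivAt_diagOp (v := v) (x := ξ) h1).congr_deriv ?_
  rw [flow, diagOp_diagOp, diagOp_apply, diagOp_apply, Finset.smul_sum, ← Finset.sum_neg_distrib]
  refine Finset.sum_congr rfl fun k _ => ?_
  rw [smul_smul, ← neg_smul]
  congr 1; ring

theorem hasDerivAt_covForm (hlam : ∀ k, 0 < lam k) (ξ : EuclideanSpace ℝ (Fin n)) (t : ℝ) :
    HasDerivAt (fun t => S.covForm v lam t ξ) (2 * S.c * ‖S.flow v lam t ξ‖ ^ 2) t := by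
  have h1 : ∀ k, HasDerivAt (fun t : ℝ => Real.exp (-(2 * (S.c * lam k) * t)))
      (-(2 * (S.c * lam k)) * Real.exp (-(S.c * lam k * t)) ^ 2) t := fun k => by
    have h2 : HasDerivAt (fun t : ℝ => -(2 * (S.c * lam k) * t)) (-(2 * (S.c * lam k))) t := by
      simpa using ((hasDerivAt_id t).const_mul (2 * (S.c * lam k))).fun_neg
    refine h2.exp.congr_deriv ?_
    rw [← Real.exp_nat_mul, mul_comm]
    congr 2; push_cast; ring
  refine (HasDerivAt.fun_sum fun k _ =>
    (((h1 k).const_sub 1).div_const (lam k)).mul_const (⟪v k, ξ⟫_ℝ ^ 2)).congr_deriv ?_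
  rw [flow, norm_diagOp_sq, Finset.mul_sum]
  refine Finset.sum_congr rfl fun k _ => ?_
  have := (hlam k).ne'
  field_simp

end Flow

section Mehler
variable {v : OrthonormalBasis (Fin n) ℝ (EuclideanSpace ℝ (Fin n))} {lam : Fin n → ℝ}

/-- Product rule. The Gaussian factor contributes `-c‖η‖²` times the cosine, since the derivative of
`covForm` is `2c‖η‖²`. The motion of `η` contributes the term with `∇φ`, since `⟨η', x⟩ = -c ∇φ(x) ·
η`. Together they are `-c A` of the wave. -/
theorem hasDerivAt_mehler (hv : ∀ k, S.Γ.mulVec (v k).ofLp = (S.c * lam k) • (v k).ofLp)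
    (ξ : EuclideanSpace ℝ (Fin n)) (θ t : ℝ) :
    HasDerivAt (fun t => Real.exp (-(S.covForm v lam t ξ / 2)) •
        S.tempLp _ (temp_cos (S.flow v lam t ξ) θ))
      (-(S.c • (Real.exp (-(S.covForm v lam t ξ / 2)) •
        S.tempLp _ (isTestFunction_cos (S := S) (S.flow v lam t ξ) θ).temp_L))) t := by
  have h1 := ((S.hasDerivAt_covForm v lam (eigenvalue_pos hv) ξ t).div_const 2).fun_neg.exp
  have h2 := (hasFDerivAt_cosLp (S := S) θ (S.flow v lam t ξ)).comp_hasDerivAt t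
    (S.hasDerivAt_flow v lam ξ t)
  refine (h1.smul h2).congr_deriv ?_
  set η := S.flow v lam t ξ with hη
  have hφη : (fun x => -(Real.sin (⟪η, x⟫_ℝ + θ) * fderiv ℝ S.phi x η)).HasTemperateGrowth :=
    ((temp_sin η θ).fun_mul
      (hasTemperateGrowth_fderiv_apply (phi_hasTemperateGrowth (S := S)) η)).fun_neg
  have e1 : S.tempLp _ (isTestFunction_cos (S := S) η θ).temp_L =
      ‖η‖ ^ 2 • S.tempLp _ (temp_cos η θ) + S.tempLp _ hφη := by
    rw [← tempLp_smul, ← tempLp_add]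
    rfl
  have e2 : S.cosLpDeriv θ η (diagOp v lam η) = S.tempLp _ hφη := by
    refine tempLp_congr (temp_sin_mul η θ (diagOp v lam η)) _ fun x => ?_
    have h3 : ⟪diagOp v lam η, x⟫_ℝ = ∑ k, lam k * (⟪v k, x⟫_ℝ * ⟪v k, η⟫_ℝ) := by
      rw [diagOp_apply, sum_inner]
      refine Finset.sum_congr rfl fun k _ => ?_
      rw [real_inner_smul_left]
      ring
    rw [fderiv_phi hv, h3]
  rw [e1, map_neg, map_smul, e2, Function.comp_apply]
  module

variable {g : EuclideanSpace ℝ (Fin n) → EuclideanSpace ℝ (Fin n)}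
  {u : ℝ → EuclideanSpace ℝ (Fin n)} {p₀ : S.StateSpace} {t₁ : ℝ} {p : ℝ → S.StateSpace}

theorem IsMildSolutionOn.integral_mul_cos (hp : S.IsMildSolutionOn g u (fun _ => 0) p₀ t₁ p)
    (hg : Continuous g) (hu : ContinuousOn u (Ici 0))
    (hv : ∀ k, S.Γ.mulVec (v k).ofLp = (S.c * lam k) • (v k).ofLp)
    (ξ : EuclideanSpace ℝ (Fin n)) (θ : ℝ) {t : ℝ} (ht : t ∈ Icc 0 t₁) :
    ∫ x, p t x * Real.cos (⟪ξ, x⟫_ℝ + θ) = Real.exp (-(S.covForm v lam t ξ / 2)) *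
        (∫ x, p₀ x * Real.cos (⟪S.flow v lam t ξ, x⟫_ℝ + θ)) +
      ∫ s in (0 : ℝ)..t, ⟪g (u s), S.flow v lam (t - s) ξ⟫_ℝ *
        (Real.exp (-(S.covForm v lam (t - s) ξ / 2)) *
          ∫ x, p s x * -Real.sin (⟪S.flow v lam (t - s) ξ, x⟫_ℝ + θ)) := by
  have h1 := hp.integral_mul_eq hg hu
    (fun t => (isTestFunction_cos (S := S) (S.flow v lam t ξ) θ).smul
      (Real.exp (-(S.covForm v lam t ξ / 2))))
    (fun t => by
      simp only [tempLp_smul _ (temp_cos _ _), tempLp_smul _ (isTestFunction_cos _ _).temp_L]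
      exact hasDerivAt_mehler hv ξ θ t) ht
  simp only [flow_zero, covForm_zero, zero_div, neg_zero, Real.exp_zero, one_smul] at h1
  rw [h1, ← integral_const_mul]
  congr 1
  · refine integral_congr_ae (Eventually.of_forall fun x => ?_)
    simp only [smul_eq_mul]; ring
  · refine intervalIntegral.integral_congr fun s _ => ?_
    simp only [← integral_const_mul]
    refine integral_congr_ae (Eventually.of_forall fun x => ?_)
    simp only [real_inner_smul_right]; ring

end Mehler

end OUParams
end FokkerPlanck

/-! ### Fourier transform and nonnegativity -/

namespace FokkerPlanck

/-- The solution of the rotation equation `(P + i Q)' = i k (P + i Q)`. -/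
theorem add_mul_I_eq_of_rotation {k P Q : ℝ → ℝ} {P₀ Q₀ T : ℝ} (hT : 0 ≤ T)
    (hk : ContinuousOn k (Icc 0 T)) (hPc : ContinuousOn P (Icc 0 T))
    (hQc : ContinuousOn Q (Icc 0 T))
    (hP : ∀ t ∈ Icc 0 T, P t = P₀ + ∫ s in (0 : ℝ)..t, k s * -Q s)
    (hQ : ∀ t ∈ Icc 0 T, Q t = Q₀ + ∫ s in (0 : ℝ)..t, k s * P s) :
    (P T + Q T * Complex.I : ℂ) =
      Complex.exp ((∫ s in (0 : ℝ)..T, k s : ℝ) * Complex.I) * (P₀ + Q₀ * Complex.I) := by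
  obtain ⟨K, K', -, hK, hKe⟩ := exists_primitive hT hk
  obtain ⟨A, A', -, hA, hAe⟩ := exists_primitive hT (hk.mul hQc.neg)
  obtain ⟨B, B', -, hB, hBe⟩ := exists_primitive hT (hk.mul hPc)
  -- Integrating factor: `e^{-iK}(P + iQ)` has derivative zero on `[0, T)`, where `K` is the
  -- primitive of `k`.
  have hd : ∀ t, HasDerivAt (fun t => Complex.exp (-(K t * Complex.I)) *
      ((P₀ + A t : ℂ) + (Q₀ + B t) * Complex.I))
      (Complex.exp (-(K t * Complex.I)) * -(K' t * Complex.I) *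
        ((P₀ + A t : ℂ) + (Q₀ + B t) * Complex.I) +
        Complex.exp (-(K t * Complex.I)) * (A' t + B' t * Complex.I)) t := fun t =>
    (((hK t).ofReal_comp.mul_const Complex.I).fun_neg.cexp).mul
      (((hA t).ofReal_comp.const_add _).add
        (((hB t).ofReal_comp.const_add _).mul_const Complex.I))
  have hPe : ∀ t ∈ Icc 0 T, P t = P₀ + A t := fun t ht => by rw [hP t ht, (hAe t ht).2]; rfl
  have hQe : ∀ t ∈ Icc 0 T, Q t = Q₀ + B t := fun t ht => by rw [hQ t ht, (hBe t ht).2]; rfl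
  have hTm : T ∈ Icc 0 T := ⟨hT, le_rfl⟩
  have h0m : (0 : ℝ) ∈ Icc 0 T := ⟨le_rfl, hT⟩
  have h := constant_of_has_deriv_right_zero (a := 0) (b := T)
    (fun t _ => (hd t).continuousAt.continuousWithinAt) (fun t ht => by
      have ht' : t ∈ Icc 0 T := ⟨ht.1, ht.2.le⟩
      refine ((hd t).congr_deriv ?_).hasDerivWithinAt
      have h1 : (P t : ℂ) = P₀ + A t := by rw [hPe t ht']; push_cast; rfl
      have h2 : (Q t : ℂ) = Q₀ + B t := by rw [hQe t ht']; push_cast; rfl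
      rw [← h1, ← h2, (hKe t ht').1, (hAe t ht').1, (hBe t ht').1]
      simp only [Pi.mul_apply, Pi.neg_apply]
      push_cast
      linear_combination (-Complex.exp (-(K t * Complex.I)) * k t * Q t) * Complex.I_sq) T hTm
  have hK0 : K 0 = 0 := by rw [(hKe 0 h0m).2, intervalIntegral.integral_same]
  have hA0 : A 0 = 0 := by rw [(hAe 0 h0m).2, intervalIntegral.integral_same]
  have hB0 : B 0 = 0 := by rw [(hBe 0 h0m).2, intervalIntegral.integral_same]
  simp only [hK0, hA0, hB0, Complex.ofReal_zero, zero_mul, neg_zero, Complex.exp_zero, one_mul,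
    add_zero] at h
  rw [← h, ← mul_assoc, ← Complex.exp_add, (hKe T hTm).2, add_neg_cancel, Complex.exp_zero, one_mul,
    hPe T hTm, hQe T hTm]
  push_cast
  rfl

section CharFun
variable {E : Type*} [NormedAddCommGroup E] [InnerProductSpace ℝ E] [MeasurableSpace E]

theorem charFun_withDensity_ofReal {μ : Measure E} {f : E → ℝ} (hf : Measurable f)
    (hf0 : ∀ᵐ x ∂μ, 0 ≤ f x) (ξ : E) :
    charFun (μ.withDensity fun x => ENNReal.ofReal (f x)) ξ =
      ∫ x, (f x : ℂ) * Complex.exp (⟪ξ, x⟫_ℝ * Complex.I) ∂μ := by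
  rw [charFun_apply, integral_withDensity_eq_integral_toReal_smul hf.ennreal_ofReal
    (Eventually.of_forall fun _ => ENNReal.ofReal_lt_top)]
  refine integral_congr_ae ?_
  filter_upwards [hf0] with x hx
  rw [ENNReal.toReal_ofReal hx, real_inner_comm, Complex.real_smul]

theorem integrable_mul_cexp [BorelSpace E] {μ : Measure E} {f : E → ℝ} (hf : Integrable f μ) (ξ : E) :
    Integrable (fun x => (f x : ℂ) * Complex.exp (⟪ξ, x⟫_ℝ * Complex.I)) μ := by
  refine hf.ofReal.mul_bdd (c := 1) (Continuous.aestronglyMeasurable (by fun_prop))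
    (Eventually.of_forall fun x => ?_)
  rw [Complex.norm_exp_ofReal_mul_I]

/-- A function whose Fourier transform is that of a measure is nonnegative. -/
theorem ae_nonneg_of_charFun_eq [BorelSpace E] [SecondCountableTopology E] [CompleteSpace E]
    {μ : Measure E} {f : E → ℝ} (hfm : Measurable f)
    (hf : Integrable f μ) (ν : Measure E) [IsFiniteMeasure ν]
    (h : ∀ ξ, ∫ x, (f x : ℂ) * Complex.exp (⟪ξ, x⟫_ℝ * Complex.I) ∂μ = charFun ν ξ) :
    ∀ᵐ x ∂μ, 0 ≤ f x := by
  have hpos : Integrable (fun x => max (f x) 0) μ := hf.pos_part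
  have hneg : Integrable (fun x => max (-f x) 0) μ := hf.neg_part
  have := isFiniteMeasure_withDensity_ofReal hpos.2
  have := isFiniteMeasure_withDensity_ofReal hneg.2
  have hm1 : Measurable fun x => max (f x) 0 := hfm.max measurable_const
  have hm2 : Measurable fun x => max (-f x) 0 := hfm.neg.max measurable_const
  -- The Fourier hypothesis says `f⁺ - f⁻ = ν`. Written as `f⁺ = f⁻ + ν` it compares finite positive
  -- measures, which their characteristic functions determine.
  have key : μ.withDensity (fun x => ENNReal.ofReal (max (f x) 0)) =
      μ.withDensity (fun x => ENNReal.ofReal (max (-f x) 0)) + ν := by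
    refine Measure.ext_of_charFun (funext fun ξ => ?_)
    have e : ∀ (ρ : Measure E) [IsFiniteMeasure ρ],
        Integrable (fun x => Complex.exp (⟪x, ξ⟫_ℝ * Complex.I)) ρ := fun ρ _ =>
      Integrable.of_bound (C := 1) (Continuous.aestronglyMeasurable (by fun_prop))
        (Eventually.of_forall fun x => by rw [Complex.norm_exp_ofReal_mul_I])
    rw [charFun_apply (μ := _ + ν), integral_add_measure (e _) (e _), ← charFun_apply,
      ← charFun_apply, ← h, charFun_withDensity_ofReal hm1 (by simp),
      charFun_withDensity_ofReal hm2 (by simp),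
      ← integral_add (integrable_mul_cexp hneg ξ) (integrable_mul_cexp hf ξ)]
    refine integral_congr_ae (Eventually.of_forall fun x => ?_)
    simp only [← add_mul, ← Complex.ofReal_add]
    congr 2
    rcases le_total 0 (f x) with hx | hx
    · rw [max_eq_left hx, max_eq_right (neg_nonpos.2 hx), zero_add]
    · rw [max_eq_right hx, max_eq_left (neg_nonneg.2 hx), neg_add_cancel]
  have hs : MeasurableSet {x | f x < 0} := measurableSet_lt hfm measurable_const
  -- On `{f < 0}` the left side of `key` has mass zero, hence so has the density `f⁻`, which is
  -- positive there.
  have h1 : μ.withDensity (fun x => ENNReal.ofReal (max (f x) 0)) {x | f x < 0} = 0 := by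
    rw [withDensity_apply_eq_zero' hm1.ennreal_ofReal.aemeasurable]
    convert measure_empty (μ := μ)
    ext x
    simp only [mem_inter_iff, mem_ofPred_eq, mem_empty_iff_false, iff_false, not_and, not_lt]
    intro hx
    by_contra! hx'
    rw [max_eq_right hx'.le, ENNReal.ofReal_zero] at hx
    exact hx rfl
  rw [key, Measure.add_apply, add_eq_zero,
    withDensity_apply_eq_zero' hm2.ennreal_ofReal.aemeasurable] at h1
  rw [ae_iff]
  refine measure_mono_null (fun x hx => ?_) h1.1
  have hx : f x < 0 := not_le.1 hx
  refine ⟨?_, hx⟩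
  simpa using hx

end CharFun

section DiagOp
variable {n : ℕ} (v : OrthonormalBasis (Fin n) ℝ (EuclideanSpace ℝ (Fin n))) (d : Fin n → ℝ)

theorem charFun_map_diagOp (μ : Measure (EuclideanSpace ℝ (Fin n)))
    (ξ : EuclideanSpace ℝ (Fin n)) :
    charFun (μ.map (diagOp v d)) ξ = charFun μ (diagOp v d ξ) := by
  rw [charFun_apply, integral_map (by fun_prop) (Continuous.aestronglyMeasurable (by fun_prop)),
    charFun_apply]
  simp only [inner_diagOp_left]

variable {d} in
theorem continuousOn_diagOp {d : ℝ → Fin n → ℝ} {f : ℝ → EuclideanSpace ℝ (Fin n)} {s : Set ℝ}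
    (hd : ∀ k, ContinuousOn (fun t => d t k) s) (hf : ContinuousOn f s) :
    ContinuousOn (fun t => diagOp v (d t) (f t)) s := by
  simp only [diagOp_apply]
  exact continuousOn_finsetSum _ fun k _ =>
    ((hd k).mul (continuousOn_const.inner hf)).smul continuousOn_const

end DiagOp

namespace OUParams
variable {n : ℕ} {S : OUParams n}

/-- `sin` is `cos` shifted by `-π/2`, so the real waves with two phases contain the whole Fourier
transform. -/
theorem integral_mul_cexp (f : S.StateSpace) (η : EuclideanSpace ℝ (Fin n)) :
    ∫ x, (f x : ℂ) * Complex.exp (⟪η, x⟫_ℝ * Complex.I) =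
      (∫ x, f x * Real.cos (⟪η, x⟫_ℝ + 0) : ℝ) +
        (∫ x, f x * Real.cos (⟪η, x⟫_ℝ + -(Real.pi / 2)) : ℝ) * Complex.I := by
  rw [← integral_complex_ofReal, ← integral_complex_ofReal, ← integral_mul_const,
    ← integral_add (integrable_mul f (temp_cos η _)).ofReal
      ((integrable_mul f (temp_cos η _)).ofReal.mul_const _)]
  refine integral_congr_ae (Eventually.of_forall fun x => ?_)
  simp only [add_zero, ← sub_eq_add_neg, Real.cos_sub_pi_div_two, Complex.exp_mul_I]
  push_cast
  ring

variable {v : OrthonormalBasis (Fin n) ℝ (EuclideanSpace ℝ (Fin n))} {lam : Fin n → ℝ}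
  {g : EuclideanSpace ℝ (Fin n) → EuclideanSpace ℝ (Fin n)}
  {u : ℝ → EuclideanSpace ℝ (Fin n)} {p₀ : S.StateSpace} {t₁ : ℝ} {p : ℝ → S.StateSpace}

/-- The integral is the inner product in `𝔥` of `p t` with a continuous curve, namely the wave whose
frequency follows the flow. -/
theorem continuousOn_integral_mul_cos (hp : ContinuousOn p (Icc 0 t₁)) (T θ : ℝ)
    (ξ : EuclideanSpace ℝ (Fin n)) :
    ContinuousOn (fun t => Real.exp (-(S.covForm v lam (T - t) ξ / 2)) *
      ∫ x, p t x * Real.cos (⟪S.flow v lam (T - t) ξ, x⟫_ℝ + θ)) (Icc 0 t₁) := by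
  simp only [← inner_h_tempLp _ (temp_cos _ _)]
  have h1 : Continuous fun t => S.covForm v lam (T - t) ξ := by
    unfold covForm
    fun_prop
  have h2 : Continuous fun η => S.tempLp _ (temp_cos η θ) :=
    continuous_iff_continuousAt.2 fun η => (hasFDerivAt_cosLp θ η).continuousAt
  have h3 : Continuous fun t => S.flow v lam t ξ :=
    continuous_iff_continuousAt.2 fun t => (S.hasDerivAt_flow v lam ξ t).continuousAt
  refine (h1.div_const 2).neg.rexp.continuousOn.mul (hp.inner ?_)
  exact (S.h.continuous.comp (h2.comp (h3.comp (continuous_const.sub continuous_id)))).continuousOn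

/-- The Fourier transform of a mild solution. -/
theorem IsMildSolutionOn.integral_mul_cexp_eq (hp : S.IsMildSolutionOn g u (fun _ => 0) p₀ t₁ p)
    (hg : Continuous g) (hu : ContinuousOn u (Ici 0))
    (hv : ∀ k, S.Γ.mulVec (v k).ofLp = (S.c * lam k) • (v k).ofLp) {T : ℝ} (hT : T ∈ Icc 0 t₁)
    (ξ : EuclideanSpace ℝ (Fin n)) :
    ∫ x, (p T x : ℂ) * Complex.exp (⟪ξ, x⟫_ℝ * Complex.I) =
      Complex.exp (⟪∫ s in (0 : ℝ)..T, S.flow v lam (T - s) (g (u s)), ξ⟫_ℝ * Complex.I) *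
        (Real.exp (-(S.covForm v lam T ξ / 2)) *
          ∫ x, (p₀ x : ℂ) * Complex.exp (⟪S.flow v lam T ξ, x⟫_ℝ * Complex.I)) := by
  have hsub : Icc 0 T ⊆ Icc 0 t₁ := Icc_subset_Icc_right hT.2
  have hgu : ContinuousOn (fun s => g (u s)) (Icc 0 T) :=
    hg.comp_continuousOn (hu.mono fun s hs => hs.1)
  have hflow : ContinuousOn (fun s => S.flow v lam (T - s) (g (u s))) (Icc 0 T) :=
    continuousOn_diagOp v (fun k => by fun_prop) hgu
  have hint : IntervalIntegrable (fun s => S.flow v lam (T - s) (g (u s))) volume 0 T :=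
    ContinuousOn.intervalIntegrable_of_Icc hT.1 hflow
  have hke : ∀ s, ⟪g (u s), S.flow v lam (T - s) ξ⟫_ℝ = ⟪S.flow v lam (T - s) (g (u s)), ξ⟫_ℝ :=
    fun s => (inner_diagOp_left _ _ _ _).symm
  -- The final time `T` is fixed and `p(t)` is tested with the dual solution that is the wave `ξ` at
  -- time `T`. By the flow and cocycle identities the integrand no longer depends on `t`, so this is
  -- an integral equation in `t`.
  have hF : ∀ θ, ∀ t ∈ Icc 0 T, Real.exp (-(S.covForm v lam (T - t) ξ / 2)) *
      ∫ x, p t x * Real.cos (⟪S.flow v lam (T - t) ξ, x⟫_ℝ + θ) =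
      Real.exp (-(S.covForm v lam T ξ / 2)) *
        (∫ x, p₀ x * Real.cos (⟪S.flow v lam T ξ, x⟫_ℝ + θ)) +
      ∫ s in (0 : ℝ)..t, ⟪g (u s), S.flow v lam (T - s) ξ⟫_ℝ *
        (Real.exp (-(S.covForm v lam (T - s) ξ / 2)) *
          ∫ x, p s x * -Real.sin (⟪S.flow v lam (T - s) ξ, x⟫_ℝ + θ)) := by
    intro θ t ht
    have e1 : ∀ s, S.flow v lam (t - s) (S.flow v lam (T - t) ξ) = S.flow v lam (T - s) ξ :=
      fun s => by rw [flow_flow]; congr 2; ring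
    have e2 : ∀ s, Real.exp (-(S.covForm v lam (T - s) ξ / 2)) =
        Real.exp (-(S.covForm v lam (T - t) ξ / 2)) *
          Real.exp (-(S.covForm v lam (t - s) (S.flow v lam (T - t) ξ) / 2)) := fun s => by
      rw [← Real.exp_add, show T - s = t - s + (T - t) by ring, ← covForm_add]
      congr 1; ring
    have e3 := e1 0
    have e4 := e2 0
    simp only [sub_zero] at e3 e4
    rw [hp.integral_mul_cos hg hu hv (S.flow v lam (T - t) ξ) θ (hsub ht), mul_add,
      ← intervalIntegral.integral_const_mul, e3, e4, mul_assoc]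
    congr 1
    refine intervalIntegral.integral_congr fun s _ => ?_
    simp only [e1]
    rw [e2 s]
    ring
  -- The phases `0` and `-π/2` close the system: `-sin(· + 0)` is `-Q` and `-sin(· - π/2)` is `P`
  -- under the integral.
  have hrot := add_mul_I_eq_of_rotation
    (P₀ := Real.exp (-(S.covForm v lam T ξ / 2)) *
      ∫ x, p₀ x * Real.cos (⟪S.flow v lam T ξ, x⟫_ℝ + 0))
    (Q₀ := Real.exp (-(S.covForm v lam T ξ / 2)) *
      ∫ x, p₀ x * Real.cos (⟪S.flow v lam T ξ, x⟫_ℝ + -(Real.pi / 2)))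
    (k := fun s => ⟪g (u s), S.flow v lam (T - s) ξ⟫_ℝ)
    (P := fun t => Real.exp (-(S.covForm v lam (T - t) ξ / 2)) *
      ∫ x, p t x * Real.cos (⟪S.flow v lam (T - t) ξ, x⟫_ℝ + 0))
    (Q := fun t => Real.exp (-(S.covForm v lam (T - t) ξ / 2)) *
      ∫ x, p t x * Real.cos (⟪S.flow v lam (T - t) ξ, x⟫_ℝ + -(Real.pi / 2)))
    hT.1 (by simp only [hke]; exact hflow.inner continuousOn_const)
    ((continuousOn_integral_mul_cos hp.1 T 0 ξ).mono hsub)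
    ((continuousOn_integral_mul_cos hp.1 T _ ξ).mono hsub)
    (fun t ht => (hF 0 t ht).trans (by
      simp only [← sub_eq_add_neg, Real.cos_sub_pi_div_two, add_zero, mul_neg, integral_neg]))
    (fun t ht => (hF (-(Real.pi / 2)) t ht).trans (by
      simp only [← sub_eq_add_neg, Real.sin_sub_pi_div_two, add_zero, neg_neg]))
  simp only [sub_self, flow_zero, covForm_zero, zero_div, neg_zero, Real.exp_zero, one_mul] at hrot
  rw [integral_mul_cexp, hrot, integral_mul_cexp]
  congr 1
  · simp only [hke]
    congr 3
    -- The rotation angle is linear in `ξ`: with the flow moved onto `g(u s)` by self-adjointness,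
    -- it is the inner product of `ξ` with one integrated vector, the translation in `ν` below.
    rw [real_inner_comm, ← innerSL_apply_apply ℝ, ← ContinuousLinearMap.intervalIntegral_comp_comm _ hint]
    simp only [innerSL_apply_apply, real_inner_comm]
  · push_cast
    ring

/-- The transform of `p T` is that of `ν`: the image of `p₀` under the flow, convolved with a
Gaussian and translated. Nonnegativity of `p₀` is what makes its density a measure with the right
characteristic function. -/
theorem IsMildSolutionOn.ae_nonneg (hp : S.IsMildSolutionOn g u (fun _ => 0) p₀ t₁ p)
    (hg : Continuous g) (hu : ContinuousOn u (Ici 0)) (hp₀ : ∀ᵐ x, 0 ≤ p₀ x) {T : ℝ}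
    (hT : T ∈ Icc 0 t₁) : ∀ᵐ x, 0 ≤ p T x := by
  obtain ⟨v, lam, hv⟩ := S.exists_eigenbasis
  have := isFiniteMeasure_withDensity_ofReal (integrable_stateSpace p₀).2
  -- Square roots of the coefficients of `covForm`, so that the image of the standard Gaussian has
  -- the characteristic function `e^{-covForm/2}`. The radicands are nonnegative as `T ≥ 0`.
  set σ : Fin n → ℝ := fun k => √((1 - Real.exp (-(2 * (S.c * lam k) * T))) / lam k)
  set ν : Measure (EuclideanSpace ℝ (Fin n)) :=
    (((volume.withDensity fun x => ENNReal.ofReal (p₀ x)).map (S.flow v lam T)) ∗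
      ((ProbabilityTheory.stdGaussian (EuclideanSpace ℝ (Fin n))).map (diagOp v σ))) ∗
    Measure.dirac (∫ s in (0 : ℝ)..T, S.flow v lam (T - s) (g (u s))) with hν
  refine ae_nonneg_of_charFun_eq (Lp.stronglyMeasurable (p T)).measurable
    (integrable_stateSpace (p T)) ν fun ξ => ?_
  have hσ : ‖diagOp v σ ξ‖ ^ 2 = S.covForm v lam T ξ := by
    rw [norm_diagOp_sq, covForm]
    refine Finset.sum_congr rfl fun k _ => ?_
    have h1 := eigenvalue_pos hv k
    rw [Real.sq_sqrt]
    refine div_nonneg (sub_nonneg.2 (Real.exp_le_one_iff.2 ?_)) h1.le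
    have := mul_nonneg (mul_nonneg zero_le_two (mul_nonneg S.c_pos.le h1.le)) hT.1
    linarith
  rw [hp.integral_mul_cexp_eq hg hu hv hT ξ, hν, charFun_conv, charFun_conv, charFun_dirac,
    charFun_map_diagOp, ProbabilityTheory.charFun_stdGaussian, flow, charFun_map_diagOp,
    charFun_withDensity_ofReal (Lp.stronglyMeasurable p₀).measurable hp₀, ← Complex.ofReal_pow, hσ]
  push_cast
  rw [neg_div]
  ring

end OUParams
end FokkerPlanck

/-- Properties of the mild solutions `p` of `p' = -c 𝔄 p - div (g(u) p)`, `p(0) = p₀`: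
conservation of mass, preservation of nonnegativity, the formula for the covariance matrix with a
matrix `K` that depends neither on `t₁` nor on the input, and its exponential convergence. -/
theorem proposition3p5 {n : ℕ} (S : FokkerPlanck.OUParams n) :
    -- conservation of mass and preservation of nonnegativity
    (∀ (g : EuclideanSpace ℝ (Fin n) → EuclideanSpace ℝ (Fin n))
        (u : ℝ → EuclideanSpace ℝ (Fin n)) (p₀ : S.StateSpace) (t₁ : ℝ) (p : ℝ → S.StateSpace),
      FokkerPlanck.IsAdmissibleDrift g → ContinuousOn u (Set.Ici 0) → 0 < t₁ →
      S.IsMildSolutionOn g u (fun _ => 0) p₀ t₁ p →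
        (Integrable p₀ ∧ ∀ t ∈ Set.Icc 0 t₁, Integrable (p t) ∧ ∫ x, p t x = ∫ x, p₀ x) ∧
        ((∀ᵐ x, 0 ≤ p₀ x) → ∀ t ∈ Set.Icc 0 t₁, ∀ᵐ x, 0 ≤ p t x)) ∧
    -- the covariance matrix, for every choice of an orthonormal eigenbasis of `Γ`
    (∀ (v : OrthonormalBasis (Fin n) ℝ (EuclideanSpace ℝ (Fin n))) (lam : Fin n → ℝ),
      (∀ k, S.Γ.mulVec (v k).ofLp = (S.c * lam k) • (v k).ofLp) →
      ∀ p₀ : S.StateSpace, ∫ x, p₀ x = 1 →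
      ∃ K : Matrix (Fin n) (Fin n) ℝ,
        ∀ (g : EuclideanSpace ℝ (Fin n) → EuclideanSpace ℝ (Fin n))
          (u : ℝ → EuclideanSpace ℝ (Fin n)) (t₁ : ℝ) (p : ℝ → S.StateSpace),
        FokkerPlanck.IsAdmissibleDrift g → ContinuousOn u (Set.Ici 0) → 0 < t₁ →
        S.IsMildSolutionOn g u (fun _ => 0) p₀ t₁ p →
          ∀ t ∈ Set.Icc 0 t₁,
            FokkerPlanck.HasSecondMoments (p t) ∧
            FokkerPlanck.covMatrix (p t) =
              (1 / 4 : ℝ) • (FokkerPlanck.eigenvectorMatrix v * (FokkerPlanck.rMatrix lam)⁻¹ *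
                (NormedSpace.exp (-(S.c * t) • FokkerPlanck.lambdaMatrix lam) * K *
                  NormedSpace.exp (-(S.c * t) • FokkerPlanck.lambdaMatrix lam) +
                  (2 : ℝ) • (1 : Matrix (Fin n) (Fin n) ℝ)) *
                (FokkerPlanck.rMatrix lam)⁻¹ * (FokkerPlanck.eigenvectorMatrix v).transpose)) ∧
    -- convergence of the covariance matrix to `c Γ⁻¹`, at an exponential rate
    (∃ rate : ℝ, 0 < rate ∧ ∀ p₀ : S.StateSpace, ∫ x, p₀ x = 1 →
      ∃ M : ℝ, ∀ (g : EuclideanSpace ℝ (Fin n) → EuclideanSpace ℝ (Fin n))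
        (u : ℝ → EuclideanSpace ℝ (Fin n)) (p : ℝ → S.StateSpace),
      FokkerPlanck.IsAdmissibleDrift g → ContinuousOn u (Set.Ici 0) →
      S.IsMildSolution g u (fun _ => 0) p₀ p →
        Tendsto (fun t => FokkerPlanck.covMatrix (p t)) atTop (𝓝 (S.c • S.Γ⁻¹)) ∧
        ∀ t : ℝ, 0 ≤ t → ∀ i j,
          |FokkerPlanck.covMatrix (p t) i j - (S.c • S.Γ⁻¹) i j| ≤ M * Real.exp (-(rate * t))) := by
  refine ⟨fun g u p₀ t₁ p hg hu _ hp => ?_, fun v lam hv p₀ hp₀ => ?_, ?_⟩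
  · exact ⟨⟨FokkerPlanck.OUParams.integrable_stateSpace p₀, fun t ht =>
      ⟨FokkerPlanck.OUParams.integrable_stateSpace (p t),
        hp.integral_eq hg.contDiff.continuous hu ht⟩⟩,
      fun h t ht => hp.ae_nonneg hg.contDiff.continuous hu h ht⟩
  -- Unification with the formula supplies `K = 4 R (C₀ - Λ⁻¹) R`; since it is fixed before `g`, `u`
  -- and `t₁` are introduced, it cannot depend on them.
  · exact ⟨_, fun g u t₁ p hg hu _ hp t ht => ⟨FokkerPlanck.OUParams.hasSecondMoments (p t),
      hp.covMatrix_eq_formula hg.contDiff.continuous hu hv hp₀ ht⟩⟩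
  · obtain ⟨v, lam, hv⟩ := S.exists_eigenbasis
    obtain ⟨r, hr, hle⟩ := FokkerPlanck.OUParams.exists_rate hv
    refine ⟨2 * r, by positivity, fun p₀ hp₀ =>
      ⟨∑ l, ∑ k, |(FokkerPlanck.coordCov v p₀ - Matrix.diagonal fun k => (lam k)⁻¹) k l|,
        fun g u p hg hu hp => ?_⟩⟩
    -- The interval `[0, t + 1]` has positive length even for `t = 0`, as the definition of a global
    -- mild solution demands.
    have hbound := fun (t : ℝ) (ht : 0 ≤ t) i j =>
      (hp (t + 1) (by linarith)).abs_covMatrix_sub_le hg.contDiff.continuous hu hv hp₀ hle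
        ⟨ht, (lt_add_one t).le⟩ i j
    refine ⟨?_, hbound⟩
    refine tendsto_pi_nhds.2 fun i => tendsto_pi_nhds.2 fun j => ?_
    rw [tendsto_iff_norm_sub_tendsto_zero]
    have hexp : Tendsto (fun t : ℝ => Real.exp (-(2 * r * t))) atTop (𝓝 0) :=
      Real.tendsto_exp_neg_atTop_nhds_zero.comp (tendsto_id.const_mul_atTop (by positivity))
    refine squeeze_zero' (Eventually.of_forall fun t => norm_nonneg _)
      ((eventually_ge_atTop 0).mono fun t ht => hbound t ht i j) ?_
    simpa using hexp.const_mul _
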